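/- Let $\mathcal{T}$ be a compact 3-manifold triangulation formed from $n$ tetrahedra $\Delta_1,\ldots,\Delta_n$ by identifying some of their faces affinely in pairs (different faces of the same tetrahedron may be identified, and likewise edges and vertices). Here "compact 3-manifold triangulation" means that no edge is identified with itself in reverse and that every vertex has a small neighbourhood whose frontier (the vertex link) is a sphere or a disc. A normal triangle, normal quadrilateral or normal octagon in a tetrahedron is a (tame) properly embedded disc whose boundary consists of three, four or eight normal arcs respectively. In each tetrahedron there are four triangle types (one for each vertex), three quadrilateral types and three octagon types (one quadrilateral type and one octagon type for each pair of opposite edges; the quadrilateral misses these two edges and meets each of the other four once, while the octagon meets these two edges twice each and each of the other four once). An octagonal almost normal surface in $\mathcal{T}$ is a properly embedded surface that meets every tetrahedron in a finite collection of pairwise disjoint normal triangles, quadrilaterals and octagons, with precisely one octagon in the whole of $\mathcal{T}$. Its quadrilateral-octagon vector representation is the $6n$-dimensional vector \[ \mathbf{k}(S) = (q_{1,1},q_{1,2},q_{1,3},\,k_{1,1},k_{1,2},k_{1,3};\ \ldots;\ q_{n,1},q_{n,2},q_{n,3},\,k_{n,1},k_{n,2},k_{n,3}), \] where $q_{i,j}$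 and $k_{i,j}$ are the numbers of quadrilaterals and octagons of the $j$-th type in which $S$ meets $\Delta_i$. Two surfaces are normal isotopic if some ambient isotopy that preserves each simplex of $\mathcal{T}$ carries one to the other. A vertex linking component of a surface is a connected component that is normal isotopic to the link of some vertex of $\mathcal{T}$. Let $S$ and $S'$ be octagonal almost normal surfaces in $\mathcal{T}$. Then $\mathbf{k}(S)=\mathbf{k}(S')$ if and only if either (i) $S$ and $S'$ are normal isotopic, or (ii) $S$ and $S'$ can be made normal isotopic by adding or removing finitely many vertex linking components. -/

import Mathlib

/-! ### Normal discs in a single tetrahedron -/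

/-- The standard tetrahedron, in barycentric coordinates: its vertices are indexed by `Fin 4`, and
the face opposite vertex `f` is `{x | x f = 0}`. -/
abbrev Tetra : Type := stdSimplex ℝ (Fin 4)

/-- A self-homeomorphism of the tetrahedron that maps every face onto itself (and hence also every
edge and every vertex). -/
def FacePreserving (h : Tetra ≃ₜ Tetra) : Prop :=
  ∀ (x : Tetra) (f : Fin 4), h x f = 0 ↔ x f = 0

/-- The ten disc types: four triangle types (one for each vertex), three quadrilateral types and
three octagon types (one of each for each splitting of the vertices into two pairs). -/
inductive DiscType : Type
  | tri : Fin 4 → DiscType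
  | quad : Fin 3 → DiscType
  | oct : Fin 3 → DiscType

/-- A flat triangle, meeting the three edges at the vertex `v`. -/
def triModel (v : Fin 4) : Set Tetra := {x | x v = 1 / 2}

/-- A flat quadrilateral that separates the edge `ab` from the opposite edge `cd`. -/
def quadModel (a b c d : Fin 4) : Set Tetra := {x | x a + x b = x c + x d}

/-- A piecewise linear octagon that meets the opposite edges `ab` and `cd` twice each and every
other edge once. It is the cone from the barycentre over a closed curve of eight straight arcs;
that curve runs through the points of `ab` and of `cd` with coordinates `3/4, 1/4` and through the
midpoints of the other four edges. In the face opposite `d` it consists of the two arcs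
`x a - x b = 1/2` and `x b - x a = 1/2`, and likewise in the other faces. -/
def octModel (a b c d : Fin 4) : Set Tetra :=
  {x | (x a + x b) - (x c + x d) = 2 * |x a - x b| - 2 * |x c - x d|}

/-- The model disc of each type. Quadrilaterals of type `i` miss the two edges that octagons of
type `i` meet twice. -/
def DiscType.model : DiscType → Set Tetra
  | .tri v => triModel v
  | .quad i => ![quadModel 0 1 2 3, quadModel 0 2 1 3, quadModel 0 3 1 2] i
  | .oct i => ![octModel 0 1 2 3, octModel 0 2 1 3, octModel 0 3 1 2] i

/-- `D` is a (tame, properly embedded) normal triangle, normal quadrilateral or normal octagon of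
type `τ`: some self-homeomorphism of the tetrahedron that preserves every face carries the model
disc of type `τ` onto `D`. -/
def IsDisc (τ : DiscType) (D : Set Tetra) : Prop :=
  ∃ h : Tetra ≃ₜ Tetra, FacePreserving h ∧ D = h '' τ.model

/-! ### Triangulations -/

/-- A (generalised) triangulation formed from `n` tetrahedra by identifying some of their faces in
pairs. `glue t f = some (u, p)` means that the face of tetrahedron `t` opposite its vertex `f` is
glued to the face of tetrahedron `u` opposite its vertex `p f`, each vertex `v ≠ f` of the first
face going to the vertex `p v` of the second; `glue t f = none` means a boundary face. Different
faces of the same tetrahedron may be glued together. -/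
structure Triangulation (n : ℕ) where
  glue : Fin n → Fin 4 → Option (Fin n × Equiv.Perm (Fin 4))
  glue_symm : ∀ t f u p, glue t f = some (u, p) → glue u (p f) = some (t, p.symm)
  glue_ne_self : ∀ t f u p, glue t f = some (u, p) → (u, p f) ≠ (t, f)

namespace Triangulation

variable {n : ℕ} (T : Triangulation n)

/-- The affine identification of glued faces. -/
def GlueRel (P Q : Fin n × Tetra) : Prop :=
  ∃ (f : Fin 4) (p : Equiv.Perm (Fin 4)),
    T.glue P.1 f = some (Q.1, p) ∧ P.2 f = 0 ∧ ∀ v, Q.2 (p v) = P.2 v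

/-- The underlying topological space `|T|`: the quotient of the disjoint union of the tetrahedra by
the equivalence relation generated by the face gluings, with the quotient topology. -/
abbrev Space : Type := Quot T.GlueRel

/-- The characteristic map of tetrahedron `t`. -/
def char (t : Fin n) (x : Tetra) : T.Space := Quot.mk T.GlueRel (t, x)

/-- The point of `|T|` that is vertex `v` of tetrahedron `t`. -/
def vertex (t : Fin n) (v : Fin 4) : T.Space :=
  T.char t ⟨Pi.single v 1, single_mem_stdSimplex ℝ v⟩

/-- The vertex link of a vertex `V` of the triangulation: the frontier of a small regular
neighbourhood of `V`, consisting of one small flat triangle in every corner of a tetrahedron that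
lies at `V`. -/
def link (V : T.Space) : Set T.Space :=
  {P | ∃ (t : Fin n) (v : Fin 4) (x : Tetra), T.vertex t v = V ∧ x v = 3 / 4 ∧ P = T.char t x}

/-- A compact 3-manifold triangulation: every open simplex embeds in `|T|` (which says precisely
that no edge is identified with itself in reverse), and every vertex link is a sphere or a disc. -/
def IsCompactManifold : Prop :=
  (∀ (t : Fin n) (x y : Tetra), (∀ v, x v = 0 ↔ y v = 0) → T.char t x = T.char t y → x = y) ∧
  ∀ (t : Fin n) (v : Fin 4),
    Nonempty (T.link (T.vertex t v) ≃ₜ Metric.sphere (0 : EuclideanSpace ℝ (Fin 3)) 1) ∨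
    Nonempty (T.link (T.vertex t v) ≃ₜ Metric.closedBall (0 : EuclideanSpace ℝ (Fin 2)) 1)

/-! ### Surfaces and their coordinates -/

/-- The pieces in which `S` meets tetrahedron `t`: the connected components of the preimage of `S`
under the characteristic map. -/
def pieces (S : Set T.Space) (t : Fin n) : Set (Set Tetra) :=
  {D | ∃ x ∈ T.char t ⁻¹' S, D = connectedComponentIn (T.char t ⁻¹' S) x}

/-- An octagonal almost normal surface: a subset of `|T|` that meets each tetrahedron in finitely
many pairwise disjoint triangles, quadrilaterals and octagons, with exactly one octagon in the
whole triangulation. (The discs of adjacent tetrahedra match along common faces because they are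
cut out by the same subset of `|T|`, so such a subset is a properly embedded surface.) -/
structure OctSurface where
  carrier : Set T.Space
  finite_pieces : ∀ t, (T.pieces carrier t).Finite
  isDisc_of_mem_pieces : ∀ t, ∀ D ∈ T.pieces carrier t, ∃ τ, IsDisc τ D
  existsUnique_octagon : ∃! P : Fin n × Set Tetra,
    P.2 ∈ T.pieces carrier P.1 ∧ ∃ i, IsDisc (.oct i) P.2

variable {T}

/-- The number of discs of type `τ` of the surface `S` in tetrahedron `t`. -/
noncomputable def OctSurface.count (S : T.OctSurface) (t : Fin n) (τ : DiscType) : ℕ :=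
  {D | D ∈ T.pieces S.carrier t ∧ IsDisc τ D}.ncard

/-- The `6n`-dimensional quadrilateral-octagon vector representation of `S`: the three numbers
`q` of quadrilaterals and the three numbers `k` of octagons in every tetrahedron. -/
noncomputable def OctSurface.quadOctVector (S : T.OctSurface) :
    Fin n × (Fin 3 ⊕ Fin 3) → ℝ
  | (t, .inl i) => (S.count t (.quad i) : ℝ)
  | (t, .inr i) => (S.count t (.oct i) : ℝ)

/-! ### Normal isotopy and vertex linking components -/

variable (T)

/-- A self-homeomorphism of `|T|` that preserves each simplex: it restricts, in every tetrahedron,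
to a self-homeomorphism that preserves each face (hence also each edge and each vertex). -/
def PreservesSimplices (φ : T.Space ≃ₜ T.Space) : Prop :=
  ∀ t, ∃ h : Tetra ≃ₜ Tetra, FacePreserving h ∧ ∀ x, φ (T.char t x) = T.char t (h x)

/-- Normal isotopy: some ambient isotopy of `|T|` that preserves each simplex at all times carries
`S` to `S'`. -/
def NormalIsotopic (S S' : Set T.Space) : Prop :=
  ∃ H : unitInterval → (T.Space ≃ₜ T.Space),
    Continuous (fun P : unitInterval × T.Space => H P.1 P.2) ∧
    (∀ s, T.PreservesSimplices (H s)) ∧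
    H 0 = Homeomorph.refl T.Space ∧
    H 1 '' S = S'

/-- `C` is a vertex linking component of `S`: a connected component of `S` that is (normal isotopic
to) the vertex link of some vertex of the triangulation. -/
def IsVertexLinkingComponent (S C : Set T.Space) : Prop :=
  (∃ x ∈ S, C = connectedComponentIn S x) ∧
  ∃ t v, T.NormalIsotopic C (T.link (T.vertex t v))

variable {T}

/-- `S₁` is obtained from `S` by removing one vertex linking component. -/
def OctSurface.RemovesLink (S S₁ : T.OctSurface) : Prop :=
  ∃ C, T.IsVertexLinkingComponent S.carrier C ∧ S₁.carrier = S.carrier \ C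

/-- `S₁` is obtained from `S` by adding or removing finitely many vertex linking components. -/
def OctSurface.AddRemoveLinks : T.OctSurface → T.OctSurface → Prop :=
  Relation.ReflTransGen fun S S₁ => S.RemovesLink S₁ ∨ S₁.RemovesLink S

end Triangulation

/-! One direction is invariance. A normal isotopy preserves the number of discs of each type
(`count_eq_of_normalIsotopic`). A quadrilateral or octagon never lies in a vertex linking component:
being connected it would lie in a single triangle of the link, yet it meets an edge opposite the
corner of that triangle. Hence adding or removing vertex links leaves the vector unchanged
(`AddRemoveLinks.count_eq`).

For the converse, let the quadrilateral and octagon numbers agree, and let d(t, v) be the difference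
of the numbers of triangles at corner v of tetrahedron t. A surface meets an edge pq of t once for
each triangle at p or q, plus a number determined by the quadrilaterals and octagons; so the two
edge weights differ by d(t, p) + d(t, q). Edge weights agree across glued faces, and the three
pairwise sums over a face determine their terms. Hence d depends only on the vertex of the
triangulation (`triDiff_vertex`). Adding copies of vertex links, very close to the vertices, to
whichever surface has fewer triangles there (`exists_add_link`) makes d vanish (`exists_common`).
The copy is a single component because a sphere or a disc is connected.

It remains to show that two surfaces with equal numbers of discs of every type are normal isotopic
(`normalIsotopic_of_count_eq`), which takes up most of the file. In one tetrahedron, disjoint discs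
with at most one octagon can be carried by a face-preserving homeomorphism to a standard family that
depends only on their numbers (`exists_standardise`). A boundary map that preserves the standard
family extends over faces and tetrahedra (`exists_std_face_ext`, `exists_std_tetra_ext`). So
homeomorphisms of the tetrahedra that carry one surface to the other can be built skeleton by
skeleton: the map of an edge depends only on the positions of the marked points, and the map of a
face is chosen once for each glued pair, which makes them compatible (`exists_matching`). Finally
the Alexander isotopy, coned from barycentres over the skeleta, is natural under relabelling of
vertices, so the isotopies of the tetrahedra fit together (`normalIsotopic_of_compat`).

The tool behind the extensions is linear: a homeomorphism of the boundary of a polytope that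
preserves the signs of given functionals extends with the same property (`HomeoOn.exists_sign_ext`),
by cutting along one hyperplane after another and coning in the cells. The octagon is not flat, but
its model is a cone from the barycentre, so coning preserves it (`exists_oct_ext`).
`HomeoOn.exists_ext_eqOn` combines prescribed behaviour on one disc with prescribed signs for the
others. -/

open Set Filter Topology

/-! ### Homeomorphisms of compact sets -/

/-- `g` restricts to a continuous bijection of `K` onto itself. -/
structure HomeoOn {X : Type*} [TopologicalSpace X] (g : X → X) (K : Set X) : Prop where
  cont : ContinuousOn g K
  bij : BijOn g K K

namespace HomeoOn

variable {X : Type*} [TopologicalSpace X] {g h : X → X} {K K₁ K₂ P : Set X}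

theorem id (K : Set X) : HomeoOn (fun x => x) K := ⟨continuousOn_id, bijOn_id K⟩

theorem comp (hg : HomeoOn g K) (hh : HomeoOn h K) : HomeoOn (fun x => g (h x)) K :=
  ⟨hg.cont.comp hh.cont hh.bij.mapsTo, hg.bij.comp hh.bij⟩

theorem congr (hg : HomeoOn g K) (e : EqOn g h K) : HomeoOn h K :=
  ⟨hg.cont.congr e.symm, hg.bij.congr e⟩

theorem mem (hg : HomeoOn g K) {x : X} (hx : x ∈ K) : g x ∈ K := hg.bij.mapsTo hx

theorem inj (hg : HomeoOn g K) {x y : X} (hx : x ∈ K) (hy : y ∈ K) (e : g x = g y) : x = y :=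
  hg.bij.injOn hx hy e

theorem surj (hg : HomeoOn g K) {y : X} (hy : y ∈ K) : ∃ x ∈ K, g x = y := hg.bij.surjOn hy

theorem restrict (hg : HomeoOn g K) (hP : ∀ x ∈ K, g x ∈ P ↔ x ∈ P) : HomeoOn g (K ∩ P) := by
  refine ⟨hg.cont.mono inter_subset_left, fun x hx => ⟨hg.mem hx.1, (hP x hx.1).2 hx.2⟩,
    hg.bij.injOn.mono inter_subset_left, fun y hy => ?_⟩
  obtain ⟨x, hx, rfl⟩ := hg.surj hy.1
  exact ⟨x, ⟨hx, (hP x hx).1 hy.2⟩, rfl⟩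

theorem restrict_sub (hg : HomeoOn g K) (hPK : P ⊆ K) (hP : ∀ x ∈ K, g x ∈ P ↔ x ∈ P) :
    HomeoOn g P := by
  have := hg.restrict hP
  rwa [inter_eq_self_of_subset_right hPK] at this

theorem exists_inv [T2Space X] (hg : HomeoOn g K) (hK : IsCompact K) :
    ∃ g', HomeoOn g' K ∧ (∀ x ∈ K, g' (g x) = x) ∧ ∀ x ∈ K, g (g' x) = x := by
  classical
  rcases K.eq_empty_or_nonempty with rfl | ⟨x₀, hx₀⟩
  · exact ⟨fun x => x, HomeoOn.id _, by simp, by simp⟩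
  have : Nonempty X := ⟨x₀⟩
  have hinv := hg.bij.invOn_invFunOn
  have hb : BijOn (Function.invFunOn g K) K K := hinv.symm.bijOn hg.bij.surjOn.mapsTo_invFunOn hg.bij.mapsTo
  refine ⟨Function.invFunOn g K, ⟨?_, hb⟩, hinv.1, hinv.2⟩
  rw [continuousOn_iff_isClosed]
  intro t ht
  refine ⟨g '' (K ∩ t), ((hK.inter_right ht).image_of_continuousOn
    (hg.cont.mono inter_subset_left)).isClosed, ?_⟩
  ext y
  constructor
  · rintro ⟨hy, hyK⟩
    exact ⟨⟨_, ⟨hb.mapsTo hyK, hy⟩, hinv.2 hyK⟩, hyK⟩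
  · rintro ⟨⟨x, ⟨hx, hxt⟩, rfl⟩, hyK⟩
    refine ⟨?_, hyK⟩
    show Function.invFunOn g K (g x) ∈ t
    rw [hinv.1 hx]; exact hxt

/-- Injectivity across the two pieces comes from `hi`: a value taken on both `K₁` and `K₂` lies in
the intersection, where it is already attained at a point of the intersection. -/
theorem union (hg : HomeoOn g K₁) (hh : HomeoOn h K₂) (h1 : IsClosed K₁) (h2 : IsClosed K₂)
    (e : EqOn g h (K₁ ∩ K₂)) (hi : SurjOn g (K₁ ∩ K₂) (K₁ ∩ K₂)) {f : X → X}
    (f1 : EqOn f g K₁) (f2 : EqOn f h K₂) : HomeoOn f (K₁ ∪ K₂) := by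
  have key : ∀ x ∈ K₁, ∀ y ∈ K₂, g x = h y → x = y := by
    intro x hx y hy exy
    obtain ⟨z, hz, ez⟩ := hi ⟨hg.mem hx, exy ▸ hh.mem hy⟩
    have e1 : z = x := hg.inj hz.1 hx ez
    have e2 : z = y := hh.inj hz.2 hy (by rw [← e hz, ez, exy])
    exact e1.symm.trans e2
  refine ⟨(hg.cont.congr f1).union_of_isClosed (hh.cont.congr f2) h1 h2, ?_, ?_, ?_⟩
  · rintro x (hx | hx)
    · rw [f1 hx]; exact Or.inl (hg.mem hx)
    · rw [f2 hx]; exact Or.inr (hh.mem hx)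
  · rintro x (hx | hx) y (hy | hy) exy
    · rw [f1 hx, f1 hy] at exy; exact hg.inj hx hy exy
    · rw [f1 hx, f2 hy] at exy; exact key x hx y hy exy
    · rw [f2 hx, f1 hy] at exy; exact (key y hy x hx exy.symm).symm
    · rw [f2 hx, f2 hy] at exy; exact hh.inj hx hy exy
  · rintro y (hy | hy)
    · obtain ⟨x, hx, rfl⟩ := hg.surj hy; exact ⟨x, Or.inl hx, f1 hx⟩
    · obtain ⟨x, hx, rfl⟩ := hh.surj hy; exact ⟨x, Or.inr hx, f2 hx⟩

end HomeoOn

/-! ### Cones -/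

section Cone

variable {E : Type*} [NormedAddCommGroup E] [NormedSpace ℝ E]

/-- The extension of `g`, defined on the level set `ρ = 1`, by coning from `c`. -/
noncomputable def coneExt (c : E) (ρ : E → ℝ) (g : E → E) (x : E) : E :=
  c + ρ x • (g (c + (ρ x)⁻¹ • (x - c)) - c)

/-- `ρ` is a gauge, with respect to the point `c`, on the cone `A` with apex `c`. -/
structure IsConeGauge (A : Set E) (c : E) (ρ : E → ℝ) : Prop where
  cone : ∀ x ∈ A, ∀ μ : ℝ, 0 ≤ μ → c + μ • (x - c) ∈ A
  cont : Continuous ρ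
  homog : ∀ x ∈ A, ∀ μ : ℝ, 0 ≤ μ → ρ (c + μ • (x - c)) = μ * ρ x
  pos : ∀ x ∈ A, x ≠ c → 0 < ρ x

namespace IsConeGauge

variable {A : Set E} {c : E} {ρ : E → ℝ} {g : E → E}

theorem self (H : IsConeGauge A c ρ) {x : E} (hx : x ∈ A) : ρ c = 0 := by
  simpa using H.homog x hx 0 le_rfl

/-- Reduces statements about the cone to the level set of gauge one, on which `g` is given. -/
theorem exists_ray (H : IsConeGauge A c ρ) {x : E} (hx : x ∈ A) (hxc : x ≠ c) :
    ∃ y ∈ A, ρ y = 1 ∧ 0 < ρ x ∧ x = c + ρ x • (y - c) ∧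
      ∀ g : E → E, coneExt c ρ g x = c + ρ x • (g y - c) := by
  have hp := H.pos x hx hxc
  refine ⟨c + (ρ x)⁻¹ • (x - c), H.cone x hx _ (inv_pos.2 hp).le, ?_, hp, ?_, fun g => rfl⟩
  · rw [H.homog x hx _ (inv_pos.2 hp).le, inv_mul_cancel₀ hp.ne']
  · simp [smul_smul, hp.ne']

theorem coneExt_apex (H : IsConeGauge A c ρ) {x : E} (hx : x ∈ A) : coneExt c ρ g c = c := by
  simp [coneExt, H.self hx]

theorem coneExt_eq (x : E) (hx : ρ x = 1) : coneExt c ρ g x = g x := by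
  simp [coneExt, hx]

theorem mem (H : IsConeGauge A c ρ) (hg : MapsTo g {x ∈ A | ρ x = 1} {x ∈ A | ρ x = 1}) {x : E}
    (hx : x ∈ A) : coneExt c ρ g x ∈ A ∧ ρ (coneExt c ρ g x) = ρ x := by
  by_cases h : x = c
  · subst h; rw [H.coneExt_apex hx]; exact ⟨hx, rfl⟩
  · obtain ⟨y, hy, hy1, hp, -, e⟩ := H.exists_ray hx h
    rw [e g]
    obtain ⟨h1, h2⟩ := hg ⟨hy, hy1⟩
    exact ⟨H.cone _ h1 _ hp.le, by rw [H.homog _ h1 _ hp.le, h2, mul_one]⟩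

/-- The map preserves the gauge and is linear along rays, so bijectivity passes from the level set
to the cone. Continuity is delicate only at the apex, and there boundedness of the level set is
needed. -/
theorem homeoOn (H : IsConeGauge A c ρ) (hb : Bornology.IsBounded {x ∈ A | ρ x = 1})
    (hg : HomeoOn g {x ∈ A | ρ x = 1}) : HomeoOn (coneExt c ρ g) {x ∈ A | ρ x ≤ 1} := by
  refine ⟨?_, ?_, ?_, ?_⟩
  · intro x hx
    by_cases h : x = c
    · subst h
      obtain ⟨M, hM⟩ := hb.exists_norm_le
      -- The distance of the image from the apex is at most the gauge times a bound for the size of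
      -- the level set.
      have hM0 : ∀ y ∈ {y ∈ A | ρ y ≤ 1}, ‖coneExt x ρ g y - x‖ ≤ ρ y * (M + ‖x‖) := by
        intro y hy
        by_cases hyx : y = x
        · subst hyx; simp [H.coneExt_apex hx.1, H.self hx.1]
        · obtain ⟨z, hz, hz1, hp, -, e⟩ := H.exists_ray hy.1 hyx
          rw [e g, add_sub_cancel_left, norm_smul, Real.norm_of_nonneg hp.le]
          gcongr
          exact (norm_sub_le _ _).trans (by gcongr; exact hM _ (hg.mem ⟨hz, hz1⟩))
      rw [ContinuousWithinAt, H.coneExt_apex hx.1, tendsto_iff_norm_sub_tendsto_zero]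
      refine squeeze_zero' (Eventually.of_forall fun _ => norm_nonneg _)
        (eventually_nhdsWithin_of_forall hM0) ?_
      have : Tendsto (fun y => ρ y * (M + ‖x‖)) (𝓝 x) (𝓝 (ρ x * (M + ‖x‖))) :=
        (H.cont.mul continuous_const).tendsto x
      rw [H.self hx.1, zero_mul] at this
      exact this.mono_left nhdsWithin_le_nhds
    · have hp := H.pos x hx.1 h
      have hne : ∀ᶠ y in 𝓝[{y ∈ A | ρ y ≤ 1}] x, y ≠ c :=
        nhdsWithin_le_nhds (isOpen_ne.mem_nhds h)
      have c1 : ContinuousWithinAt (fun y => c + (ρ y)⁻¹ • (y - c)) {y ∈ A | ρ y ≤ 1} x := by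
        refine ContinuousAt.continuousWithinAt ?_
        exact continuousAt_const.add ((H.cont.continuousAt.inv₀ hp.ne').smul
          (continuousAt_id.sub continuousAt_const))
      have c2 : ContinuousWithinAt g {y ∈ A | ρ y = 1} (c + (ρ x)⁻¹ • (x - c)) := by
        refine hg.cont _ ⟨H.cone x hx.1 _ (inv_pos.2 hp).le, ?_⟩
        rw [H.homog x hx.1 _ (inv_pos.2 hp).le, inv_mul_cancel₀ hp.ne']
      have c3 : ContinuousWithinAt (fun y => g (c + (ρ y)⁻¹ • (y - c))) {y ∈ A | ρ y ≤ 1} x := by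
        refine ContinuousWithinAt.mono_of_mem_nhdsWithin (t := {y | (y ∈ A ∧ ρ y ≤ 1) ∧ y ≠ c}) ?_ ?_
        -- The apex is removed from the domain, since its radial projection is not on the level set.
        · refine ContinuousWithinAt.comp (t := {y ∈ A | ρ y = 1})
            (f := fun y => c + (ρ y)⁻¹ • (y - c)) c2 (c1.mono fun y hy => hy.1) ?_
          intro y hy
          have hyp := H.pos y hy.1.1 hy.2
          exact ⟨H.cone y hy.1.1 _ (inv_pos.2 hyp).le, by
            rw [H.homog y hy.1.1 _ (inv_pos.2 hyp).le, inv_mul_cancel₀ hyp.ne']⟩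
        · filter_upwards [hne, self_mem_nhdsWithin] with y h1 h2 using ⟨h2, h1⟩
      exact continuousWithinAt_const.add (H.cont.continuousWithinAt.smul
        (c3.sub continuousWithinAt_const))
  · intro x hx
    obtain ⟨h1, h2⟩ := H.mem hg.bij.mapsTo hx.1
    exact ⟨h1, h2.trans_le hx.2⟩
  · intro x hx x' hx' e
    have er : ρ x = ρ x' := by
      rw [← (H.mem hg.bij.mapsTo hx.1).2, ← (H.mem hg.bij.mapsTo hx'.1).2, e]
    by_cases h : x = c
    · by_contra hne
      have h' : x' ≠ c := fun h' => hne (h.trans h'.symm)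
      have := H.pos x' hx'.1 h'
      rw [← er, h, H.self hx.1] at this
      exact lt_irrefl _ this
    · have h' : x' ≠ c := by
        rintro rfl
        have := H.pos x hx.1 h
        rw [er, H.self hx.1] at this
        exact lt_irrefl _ this
      obtain ⟨y, hy, hy1, hp, ex, eg⟩ := H.exists_ray hx.1 h
      obtain ⟨y', hy', hy1', hp', ex', eg'⟩ := H.exists_ray hx'.1 h'
      rw [eg, eg', ← er] at e
      have e2 : g y = g y' := by
        have := smul_right_injective E hp.ne' (add_left_cancel e)
        exact sub_left_injective this
      rw [ex, ex', hg.inj ⟨hy, hy1⟩ ⟨hy', hy1'⟩ e2, er]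
  · intro z hz
    by_cases h : z = c
    · exact ⟨c, h ▸ hz, by rw [H.coneExt_apex hz.1, h]⟩
    · obtain ⟨y, hy, hy1, hp, ez, -⟩ := H.exists_ray hz.1 h
      obtain ⟨w, hw, rfl⟩ := hg.surj ⟨hy, hy1⟩
      have hwA := H.cone w hw.1 (ρ z) hp.le
      have hwρ : ρ (c + ρ z • (w - c)) = ρ z := by rw [H.homog _ hw.1 _ hp.le, hw.2, mul_one]
      refine ⟨c + ρ z • (w - c), ⟨hwA, hwρ.trans_le hz.2⟩, ?_⟩
      rw [coneExt, hwρ, add_sub_cancel_left, smul_smul, inv_mul_cancel₀ hp.ne', one_smul,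
        add_sub_cancel]
      exact ez.symm

end IsConeGauge

end Cone

/-! ### Sign-preserving maps -/

section Sign

variable {E : Type*}

/-- `g` preserves the sign of `f` on `K`. -/
def SignPres (f : E → ℝ) (g : E → E) (K : Set E) : Prop :=
  ∀ x ∈ K, SignType.sign (f (g x)) = SignType.sign (f x)

theorem SignPres.mono {f : E → ℝ} {g : E → E} {K K' : Set E} (h : SignPres f g K) (hK : K' ⊆ K) :
    SignPres f g K' := fun x hx => h x (hK hx)

theorem SignPres.congr {f : E → ℝ} {g g' : E → E} {K : Set E} (h : SignPres f g K)
    (e : EqOn g g' K) : SignPres f g' K := fun x hx => by rw [← e hx]; exact h x hx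

theorem SignPres.eq_zero_iff {f : E → ℝ} {g : E → E} {K : Set E} (h : SignPres f g K) {x : E}
    (hx : x ∈ K) : f (g x) = 0 ↔ f x = 0 := by
  rw [← sign_eq_zero_iff, h x hx, sign_eq_zero_iff]

theorem SignPres.pos_iff {f : E → ℝ} {g : E → E} {K : Set E} (h : SignPres f g K) {x : E}
    (hx : x ∈ K) : 0 < f (g x) ↔ 0 < f x := by
  rw [← sign_eq_one_iff, h x hx, sign_eq_one_iff]

theorem SignPres.neg_iff {f : E → ℝ} {g : E → E} {K : Set E} (h : SignPres f g K) {x : E}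
    (hx : x ∈ K) : f (g x) < 0 ↔ f x < 0 := by
  rw [← sign_eq_neg_one_iff, h x hx, sign_eq_neg_one_iff]

theorem SignPres.nonneg_iff {f : E → ℝ} {g : E → E} {K : Set E} (h : SignPres f g K) {x : E}
    (hx : x ∈ K) : 0 ≤ f (g x) ↔ 0 ≤ f x := by
  rw [← not_lt, h.neg_iff hx, not_lt]

theorem SignPres.comp {f : E → ℝ} {g g' : E → E} {K K' : Set E} (h : SignPres f g K)
    (h' : SignPres f g' K') (hm : MapsTo g' K' K) : SignPres f (fun x => g (g' x)) K' :=
  fun x hx => (h _ (hm hx)).trans (h' x hx)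

theorem signPres_of_const {f : E → ℝ} {g : E → E} {K : Set E} (hm : MapsTo g K K)
    (s : SignType) (hs : ∀ x ∈ K, SignType.sign (f x) = s) : SignPres f g K :=
  fun x hx => (hs _ (hm hx)).trans (hs x hx).symm

end Sign

/-! ### Polytopes -/

section Polytope

variable {E : Type*} [NormedAddCommGroup E] [NormedSpace ℝ E]

/-- A closed set that contains the line through any two of its points. -/
structure IsFlat (A : Set E) : Prop where
  closed : IsClosed A
  line : ∀ x ∈ A, ∀ y ∈ A, ∀ μ : ℝ, x + μ • (y - x) ∈ A

/-- The polytope cut out of `A` by the inequalities `0 ≤ ℓ` for `ℓ ∈ L`. -/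
def Polytope (A : Set E) (L : List (E →L[ℝ] ℝ)) : Set E := {x | x ∈ A ∧ ∀ ℓ ∈ L, 0 ≤ ℓ x}

/-- The interior of the polytope, relative to `A`. -/
def PolyInt (A : Set E) (L : List (E →L[ℝ] ℝ)) : Set E := {x | x ∈ A ∧ ∀ ℓ ∈ L, 0 < ℓ x}

/-- The boundary of the polytope, relative to `A`. -/
def PolyBd (A : Set E) (L : List (E →L[ℝ] ℝ)) : Set E :=
  {x | x ∈ Polytope A L ∧ ∃ ℓ ∈ L, ℓ x = 0}

theorem SignPres.neg {f : E →L[ℝ] ℝ} {g : E → E} {K : Set E} (h : SignPres f g K) :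
    SignPres (-f) g K := fun x hx => by
  simp only [_root_.neg_apply, Left.sign_neg, h x hx]

theorem map_line (ℓ : E →L[ℝ] ℝ) (x y : E) (μ : ℝ) :
    ℓ (x + μ • (y - x)) = ℓ x + μ * (ℓ y - ℓ x) := by simp

namespace IsFlat

variable {A : Set E}

theorem inter_ker (hA : IsFlat A) (ℓ : E →L[ℝ] ℝ) : IsFlat (A ∩ {x | ℓ x = 0}) := by
  refine ⟨hA.closed.inter (isClosed_eq ℓ.continuous continuous_const), ?_⟩
  rintro x ⟨hx, hx0⟩ y ⟨hy, hy0⟩ μ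
  refine ⟨hA.line x hx y hy μ, ?_⟩
  simp only [mem_ofPred_eq] at hx0 hy0 ⊢
  rw [map_line, hx0, hy0]; simp

theorem convex (hA : IsFlat A) : Convex ℝ A := by
  intro x hx y hy a b ha hb hab
  have := hA.line x hx y hy b
  convert this using 1
  rw [← eq_sub_iff_add_eq] at hab
  rw [hab]; module

end IsFlat

variable {A : Set E} {L : List (E →L[ℝ] ℝ)} {c : E}

theorem polyInt_sub : PolyInt A L ⊆ Polytope A L := fun _ hx => ⟨hx.1, fun ℓ hℓ => (hx.2 ℓ hℓ).le⟩

theorem polyBd_sub : PolyBd A L ⊆ Polytope A L := fun _ hx => hx.1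

theorem poly_cases {x : E} (hx : x ∈ Polytope A L) : x ∈ PolyBd A L ∨ x ∈ PolyInt A L := by
  by_cases h : ∃ ℓ ∈ L, ℓ x = 0
  · exact Or.inl ⟨hx, h⟩
  · push Not at h
    exact Or.inr ⟨hx.1, fun ℓ hℓ => lt_of_le_of_ne (hx.2 ℓ hℓ) (h ℓ hℓ).symm⟩

theorem Polytope.isClosed (hA : IsClosed A) : IsClosed (Polytope A L) := by
  have : Polytope A L = A ∩ ⋂ ℓ ∈ L, {x | 0 ≤ ℓ x} := by ext; simp [Polytope]
  rw [this]
  exact hA.inter (isClosed_biInter fun ℓ _ => isClosed_le continuous_const ℓ.continuous)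

theorem PolyBd.isClosed (hA : IsClosed A) : IsClosed (PolyBd A L) := by
  have : PolyBd A L = Polytope A L ∩ ⋃ ℓ ∈ {ℓ | ℓ ∈ L}, {x | ℓ x = 0} := by ext; simp [PolyBd]
  rw [this]
  exact (Polytope.isClosed hA).inter ((List.finite_toSet L).isClosed_biUnion
    fun ℓ _ => isClosed_eq ℓ.continuous continuous_const)

theorem Polytope.convex (hA : Convex ℝ A) : Convex ℝ (Polytope A L) := by
  intro x hx y hy a b ha hb hab
  refine ⟨hA hx.1 hy.1 ha hb hab, fun ℓ hℓ => ?_⟩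
  simp only [map_add, map_smul, smul_eq_mul]
  exact add_nonneg (mul_nonneg ha (hx.2 ℓ hℓ)) (mul_nonneg hb (hy.2 ℓ hℓ))

theorem PolyInt.convex (hA : Convex ℝ A) : Convex ℝ (PolyInt A L) := by
  intro x hx y hy a b ha hb hab
  refine ⟨hA hx.1 hy.1 ha hb hab, fun ℓ hℓ => ?_⟩
  simp only [map_add, map_smul, smul_eq_mul]
  rcases ha.eq_or_lt with rfl | ha
  · have : b = 1 := by linarith
    subst this; simpa using hy.2 ℓ hℓ
  · exact add_pos_of_pos_of_nonneg (mul_pos ha (hx.2 ℓ hℓ)) (mul_nonneg hb (hy.2 ℓ hℓ).le)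

/-- The gauge of a polytope with respect to an interior point `c`. -/
noncomputable def polyGauge (L : List (E →L[ℝ] ℝ)) (c x : E) : ℝ :=
  L.foldr (fun ℓ r => max (1 - ℓ x / ℓ c) r) 0

theorem polyGauge_nonneg (x : E) : 0 ≤ polyGauge L c x := by
  induction L with
  | nil => exact le_rfl
  | cons ℓ L ih => exact le_max_of_le_right ih

theorem polyGauge_le_iff {x : E} {r : ℝ} (hr : 0 ≤ r) :
    polyGauge L c x ≤ r ↔ ∀ ℓ ∈ L, 1 - ℓ x / ℓ c ≤ r := by
  induction L with
  | nil => simpa [polyGauge] using hr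
  | cons ℓ L ih =>
    rw [List.forall_mem_cons, ← ih]
    exact max_le_iff

theorem exists_polyGauge_eq {x : E} (h : 0 < polyGauge L c x) :
    ∃ ℓ ∈ L, 1 - ℓ x / ℓ c = polyGauge L c x := by
  induction L with
  | nil => exact absurd h (lt_irrefl _)
  | cons ℓ L ih =>
    rcases le_total (1 - ℓ x / ℓ c) (polyGauge L c x) with h1 | h1
    · have e : polyGauge (ℓ :: L) c x = polyGauge L c x := max_eq_right h1
      rw [e] at h ⊢
      obtain ⟨m, hm, em⟩ := ih h
      exact ⟨m, List.mem_cons_of_mem _ hm, em⟩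
    · exact ⟨ℓ, List.mem_cons_self, (max_eq_left h1).symm⟩

theorem le_polyGauge {x : E} {ℓ : E →L[ℝ] ℝ} (hℓ : ℓ ∈ L) : 1 - ℓ x / ℓ c ≤ polyGauge L c x :=
  (polyGauge_le_iff (polyGauge_nonneg x)).1 le_rfl ℓ hℓ

theorem continuous_polyGauge : Continuous (polyGauge L c) := by
  induction L with
  | nil => exact continuous_const
  | cons ℓ L ih => exact (continuous_const.sub (ℓ.continuous.div_const _)).max ih

theorem polyGauge_homog (hc : ∀ ℓ ∈ L, 0 < ℓ c) (x : E) {μ : ℝ} (hμ : 0 ≤ μ) :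
    polyGauge L c (c + μ • (x - c)) = μ * polyGauge L c x := by
  induction L with
  | nil => simp [polyGauge]
  | cons ℓ L ih =>
    have ih' := ih fun m hm => hc m (List.mem_cons_of_mem _ hm)
    have h0 := hc ℓ List.mem_cons_self
    show max (1 - ℓ (c + μ • (x - c)) / ℓ c) (polyGauge L c (c + μ • (x - c))) =
      μ * max (1 - ℓ x / ℓ c) (polyGauge L c x)
    rw [ih', mul_max_of_nonneg _ _ hμ, map_line]
    congr 1
    field_simp
    ring

theorem polyGauge_le_one_iff (hc : ∀ ℓ ∈ L, 0 < ℓ c) {x : E} :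
    polyGauge L c x ≤ 1 ↔ ∀ ℓ ∈ L, 0 ≤ ℓ x := by
  rw [polyGauge_le_iff zero_le_one]
  refine forall₂_congr fun ℓ hℓ => ?_
  rw [sub_le_self_iff, le_div_iff₀ (hc ℓ hℓ), zero_mul]

theorem polyGauge_eq_one_iff (hc : ∀ ℓ ∈ L, 0 < ℓ c) {x : E} :
    polyGauge L c x = 1 ↔ (∀ ℓ ∈ L, 0 ≤ ℓ x) ∧ ∃ ℓ ∈ L, ℓ x = 0 := by
  rw [← polyGauge_le_one_iff hc]
  constructor
  · intro h
    obtain ⟨ℓ, hℓ, e⟩ := exists_polyGauge_eq (L := L) (c := c) (x := x) (by rw [h]; norm_num)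
    refine ⟨h.le, ℓ, hℓ, ?_⟩
    rw [h] at e
    have : ℓ x / ℓ c = 0 := by linarith
    exact (div_eq_zero_iff.1 this).resolve_right (hc ℓ hℓ).ne'
  · rintro ⟨h, ℓ, hℓ, e⟩
    refine le_antisymm h ?_
    have := le_polyGauge (c := c) (x := x) hℓ
    rwa [e, zero_div, sub_zero] at this

theorem poly_eq_gauge (hc : ∀ ℓ ∈ L, 0 < ℓ c) : Polytope A L = {x ∈ A | polyGauge L c x ≤ 1} := by
  ext x; simp only [Polytope, mem_ofPred_eq, polyGauge_le_one_iff hc]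

theorem polyBd_eq_gauge (hc : ∀ ℓ ∈ L, 0 < ℓ c) :
    PolyBd A L = {x ∈ A | polyGauge L c x = 1} := by
  ext x; simp only [PolyBd, Polytope, mem_ofPred_eq, polyGauge_eq_one_iff hc, and_assoc]

theorem isConeGauge_poly (hA : IsFlat A) (hc : c ∈ PolyInt A L)
    (hb : Bornology.IsBounded (Polytope A L)) : IsConeGauge A c (polyGauge L c) where
  cone x hx μ _ := hA.line c hc.1 x hx μ
  cont := continuous_polyGauge
  homog x _ μ hμ := polyGauge_homog hc.2 x hμ
  pos x hx hxc := by
    -- With gauge zero, the whole ray from `c` through `x` would lie in the bounded polytope. The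
    -- multiple used below is at distance `M + ‖c‖ + 1` from `c`, too far for a point of norm at
    -- most `M`.
    by_contra h
    have h0 : polyGauge L c x = 0 := le_antisymm (not_lt.1 h) (polyGauge_nonneg x)
    obtain ⟨M, hM⟩ := hb.exists_norm_le
    have hn : 0 < ‖x - c‖ := norm_pos_iff.2 (sub_ne_zero.2 hxc)
    have hM0 : 0 ≤ M := (norm_nonneg _).trans (hM c (polyInt_sub hc))
    have hμ : 0 ≤ (M + ‖c‖ + 1) / ‖x - c‖ := by positivity
    have hm : c + ((M + ‖c‖ + 1) / ‖x - c‖) • (x - c) ∈ Polytope A L := by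
      rw [poly_eq_gauge hc.2]
      exact ⟨hA.line c hc.1 x hx _, by rw [polyGauge_homog hc.2 x hμ, h0]; simp⟩
    have h1 := hM _ hm
    have h2 : ‖((M + ‖c‖ + 1) / ‖x - c‖) • (x - c)‖ = M + ‖c‖ + 1 := by
      rw [norm_smul, Real.norm_of_nonneg hμ, div_mul_cancel₀ _ hn.ne']
    have h3 := norm_sub_le (c + ((M + ‖c‖ + 1) / ‖x - c‖) • (x - c)) c
    rw [add_sub_cancel_left, h2] at h3
    linarith

/-- Alexander's trick for a polytope, with control over functions that are conical about `c`. -/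
theorem HomeoOn.exists_cone_ext (hA : IsFlat A) (hc : c ∈ PolyInt A L)
    (hb : Bornology.IsBounded (Polytope A L)) {g : E → E} (hg : HomeoOn g (PolyBd A L)) :
    ∃ G, HomeoOn G (Polytope A L) ∧ EqOn G g (PolyBd A L) ∧
      (∀ x ∈ PolyInt A L, G x ∈ PolyInt A L) ∧
      ∀ f : E → ℝ, (∀ x ∈ Polytope A L, ∀ r : ℝ, 0 < r → r ≤ 1 →
        SignType.sign (f (c + r • (x - c))) = SignType.sign (f x)) →
        SignPres f g (PolyBd A L) → SignPres f G (Polytope A L) := by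
  have H := isConeGauge_poly hA hc hb
  have hsub : {x ∈ A | polyGauge L c x = 1} ⊆ Polytope A L := by
    rw [← polyBd_eq_gauge hc.2]; exact polyBd_sub
  have hg' : HomeoOn g {x ∈ A | polyGauge L c x = 1} := by rwa [← polyBd_eq_gauge hc.2]
  have hG := H.homeoOn (hb.subset hsub) hg'
  rw [← poly_eq_gauge hc.2] at hG
  refine ⟨_, hG, ?_, ?_, ?_⟩
  · intro x hx
    rw [polyBd_eq_gauge hc.2] at hx
    exact IsConeGauge.coneExt_eq x hx.2
  · intro x hx
    have h1 := H.mem hg'.bij.mapsTo hx.1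
    rcases poly_cases (hG.mem (polyInt_sub hx)) with h | h
    · rw [polyBd_eq_gauge hc.2] at h
      have h2 : x ∈ PolyBd A L := by
        rw [polyBd_eq_gauge hc.2]; exact ⟨hx.1, h1.2.symm.trans h.2⟩
      obtain ⟨ℓ, hℓ, e⟩ := h2.2
      exact absurd e (hx.2 ℓ hℓ).ne'
    · exact h
  · intro f hf hfg x hx
    by_cases h : x = c
    · rw [h, H.coneExt_apex hc.1]
    · obtain ⟨y, hy, hy1, hp, ex, eg⟩ := H.exists_ray hx.1 h
      have hyB : y ∈ PolyBd A L := by rw [polyBd_eq_gauge hc.2]; exact ⟨hy, hy1⟩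
      have hr1 : polyGauge L c x ≤ 1 := by
        rw [poly_eq_gauge hc.2] at hx; exact hx.2
      -- Conicality moves both signs along rays to the boundary, where `g` is known to preserve
      -- them.
      have e2 := hf y hyB.1 _ hp hr1
      rw [← ex] at e2
      rw [eg, hf _ (hg.mem hyB).1 _ hp hr1, hfg y hyB, e2]

end Polytope

/-! ### Extension of homeomorphisms that respect a hyperplane arrangement -/

section Arrangement

variable {E : Type*} [NormedAddCommGroup E] [NormedSpace ℝ E]

theorem polytope_cons (A : Set E) (ℓ : E →L[ℝ] ℝ) (L : List (E →L[ℝ] ℝ)) :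
    Polytope A (ℓ :: L) = Polytope A L ∩ {x | 0 ≤ ℓ x} := by
  ext x
  simp only [Polytope, List.forall_mem_cons, mem_inter_iff, mem_ofPred_eq]
  tauto

theorem polytope_inter_ker (A : Set E) (ℓ : E →L[ℝ] ℝ) (L : List (E →L[ℝ] ℝ)) :
    Polytope (A ∩ {x | ℓ x = 0}) L = Polytope A L ∩ {x | ℓ x = 0} := by
  ext x
  simp only [Polytope, mem_inter_iff, mem_ofPred_eq]
  tauto

theorem polyBd_inter_ker (A : Set E) (ℓ : E →L[ℝ] ℝ) (L : List (E →L[ℝ] ℝ)) :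
    PolyBd (A ∩ {x | ℓ x = 0}) L = PolyBd A L ∩ {x | ℓ x = 0} := by
  ext x
  simp only [PolyBd, polytope_inter_ker, mem_inter_iff, mem_ofPred_eq]
  tauto

theorem polyBd_cons (A : Set E) (ℓ : E →L[ℝ] ℝ) (L : List (E →L[ℝ] ℝ)) :
    PolyBd A (ℓ :: L) = (PolyBd A L ∪ Polytope (A ∩ {x | ℓ x = 0}) L) ∩ {x | 0 ≤ ℓ x} := by
  ext x
  simp only [PolyBd, polytope_inter_ker, polytope_cons, mem_inter_iff, mem_ofPred_eq, mem_union,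
    List.exists_mem_cons_iff]
  grind

/-- If `ℓ` is non-negative on the relative interior and vanishes at a point `x` of it, then the
segment from any `y` can be prolonged a little beyond `x`; there `ℓ` would be negative unless `ℓ y =
0`. -/
theorem polyInt_sign_const {A : Set E} {L : List (E →L[ℝ] ℝ)} (hA : IsFlat A) (ℓ : E →L[ℝ] ℝ)
    (h : ¬ ((∃ x ∈ PolyInt A L, 0 < ℓ x) ∧ ∃ x ∈ PolyInt A L, ℓ x < 0)) :
    ∃ s, ∀ x ∈ PolyInt A L, SignType.sign (ℓ x) = s := by
  wlog hn : ∀ x ∈ PolyInt A L, 0 ≤ ℓ x generalizing ℓ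
  · have hp : ∀ x ∈ PolyInt A L, 0 ≤ (-ℓ) x := by
      intro x hx
      rw [_root_.neg_apply, Left.nonneg_neg_iff]
      by_contra hx'
      push Not at hn hx'
      exact h ⟨⟨x, hx, hx'⟩, hn⟩
    obtain ⟨s, hs⟩ := this (-ℓ) (by
      rintro ⟨-, x, hx, hx'⟩
      exact absurd (hp x hx) (not_le.2 hx')) hp
    refine ⟨-s, fun x hx => ?_⟩
    rw [← hs x hx, _root_.neg_apply, Left.sign_neg, neg_neg]
  by_cases h0 : ∃ x ∈ PolyInt A L, ℓ x = 0
  · obtain ⟨x, hx, hx0⟩ := h0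
    refine ⟨0, fun y hy => ?_⟩
    rw [sign_eq_zero_iff]
    have hev : ∀ᶠ μ in 𝓝[<] (0 : ℝ), x + μ • (y - x) ∈ PolyInt A L := by
      have h1 : ∀ m ∈ L, ∀ᶠ μ in 𝓝[<] (0 : ℝ), 0 < m (x + μ • (y - x)) := by
        intro m hm
        have hc : Continuous fun μ : ℝ => m (x + μ • (y - x)) := by fun_prop
        have : Tendsto (fun μ : ℝ => m (x + μ • (y - x))) (𝓝[<] 0) (𝓝 (m x)) := by
          have := hc.tendsto 0
          simp only [zero_smul, add_zero] at this
          exact this.mono_left nhdsWithin_le_nhds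
        exact this.eventually (lt_mem_nhds (hx.2 m hm))
      have h2 : ∀ᶠ μ in 𝓝[<] (0 : ℝ), ∀ m ∈ {m | m ∈ L}, 0 < m (x + μ • (y - x)) :=
        (Filter.eventually_all_finite (List.finite_toSet L)).2 h1
      filter_upwards [h2] with μ hμ using ⟨hA.line x hx.1 y hy.1 μ, hμ⟩
    obtain ⟨μ, hμ, hμ0⟩ := (hev.and self_mem_nhdsWithin).exists
    have := hn _ hμ
    rw [map_line, hx0, zero_add, sub_zero] at this
    exact le_antisymm (nonpos_of_mul_nonneg_right this hμ0) (hn y hy)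
  · push Not at h0
    exact ⟨1, fun x hx => sign_eq_one_iff.2 (lt_of_le_of_ne (hn x hx) (h0 x hx).symm)⟩

/-- A homeomorphism of the boundary of a polytope that preserves the sign of every functional in
`L` and `C` extends to such a homeomorphism of the polytope. -/
theorem HomeoOn.exists_sign_ext (C : List (E →L[ℝ] ℝ)) : ∀ (A : Set E) (L : List (E →L[ℝ] ℝ))
    (g : E → E), IsFlat A → Bornology.IsBounded (Polytope A L) → (PolyInt A L).Nonempty →
    HomeoOn g (PolyBd A L) → (∀ ℓ ∈ L, SignPres ℓ g (PolyBd A L)) →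
    (∀ ℓ ∈ C, SignPres ℓ g (PolyBd A L)) →
    ∃ G, HomeoOn G (Polytope A L) ∧ EqOn G g (PolyBd A L) ∧
      (∀ ℓ ∈ L, SignPres ℓ G (Polytope A L)) ∧ ∀ ℓ ∈ C, SignPres ℓ G (Polytope A L) := by
  classical
  -- The induction is on `C` alone. The flat, the facet functionals and the boundary map must vary,
  -- because a slice shrinks `A` and a half enlarges `L`.
  induction C with
  | nil =>
    rintro A L g hA hb ⟨c, hc⟩ hg hL -
    obtain ⟨G, hG, e, hi, -⟩ := HomeoOn.exists_cone_ext hA hc hb hg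
    refine ⟨G, hG, e, fun ℓ hℓ x hx => ?_, by simp⟩
    rcases poly_cases hx with h | h
    · rw [e h, hL ℓ hℓ x h]
    · rw [sign_pos (h.2 ℓ hℓ), sign_pos ((hi x h).2 ℓ hℓ)]
  | cons ℓ C ih =>
    intro A L g hA hb hne hg hL hC
    have hCℓ := hC ℓ List.mem_cons_self
    have hCC : ∀ m ∈ C, SignPres m g (PolyBd A L) := fun m hm => hC m (List.mem_cons_of_mem _ hm)
    -- A functional that takes both signs in the interior cuts the polytope. The map is extended
    -- over the slice first, and then over the two halves, in which `ℓ` and `-ℓ` have become facet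
    -- functionals.
    by_cases hcross : (∃ x ∈ PolyInt A L, 0 < ℓ x) ∧ ∃ x ∈ PolyInt A L, ℓ x < 0
    · obtain ⟨⟨x, hx, hx0⟩, y, hy, hy0⟩ := hcross
      obtain ⟨c, hc, hc0⟩ : ∃ c ∈ PolyInt A L, ℓ c = 0 :=
        (PolyInt.convex hA.convex).isPreconnected.intermediate_value hy hx
          ℓ.continuous.continuousOn ⟨hy0.le, hx0.le⟩
      have hgK : HomeoOn g (PolyBd (A ∩ {x | ℓ x = 0}) L) := by
        rw [polyBd_inter_ker]
        exact hg.restrict fun x hx => hCℓ.eq_zero_iff hx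
      have sub0 : PolyBd (A ∩ {x | ℓ x = 0}) L ⊆ PolyBd A L := by
        rw [polyBd_inter_ker]; exact inter_subset_left
      obtain ⟨G₀, hG₀, e₀, hL₀, hC₀⟩ := ih (A ∩ {x | ℓ x = 0}) L g (hA.inter_ker ℓ)
        (hb.subset (by rw [polytope_inter_ker]; exact inter_subset_left)) ⟨c, ⟨hc.1, hc0⟩, hc.2⟩ hgK
        (fun m hm => (hL m hm).mono sub0) (fun m hm => (hCC m hm).mono sub0)
      set D := Polytope (A ∩ {x | ℓ x = 0}) L with hD
      have hDA : D = Polytope A L ∩ {x | ℓ x = 0} := polytope_inter_ker A ℓ L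
      have hDcl : IsClosed D := Polytope.isClosed (hA.inter_ker ℓ).closed
      have hint : PolyBd A L ∩ D = PolyBd (A ∩ {x | ℓ x = 0}) L := by
        rw [polyBd_inter_ker, hDA]
        ext z
        simp only [PolyBd, mem_inter_iff, mem_ofPred_eq]
        tauto
      set g₁ : E → E := fun x => if x ∈ PolyBd A L then g x else G₀ x with hg₁def
      have f1 : EqOn g₁ g (PolyBd A L) := fun z hz => if_pos hz
      have f2 : EqOn g₁ G₀ D := fun z hz => by
        by_cases h : z ∈ PolyBd A L
        · rw [f1 h, e₀ (hint ▸ ⟨h, hz⟩)]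
        · exact if_neg h
      have hg₁ : HomeoOn g₁ (PolyBd A L ∪ D) :=
        hg.union hG₀ (PolyBd.isClosed hA.closed) hDcl
          (by rw [hint]; exact e₀.symm) (by rw [hint]; exact hgK.bij.surjOn) f1 f2
      have sp : ∀ m : E →L[ℝ] ℝ, SignPres m g (PolyBd A L) → SignPres m G₀ D →
          SignPres m g₁ (PolyBd A L ∪ D) := by
        rintro m h1 h2 z (hz | hz)
        · exact h1.congr f1.symm z hz
        · exact h2.congr f2.symm z hz
      have spℓ : SignPres ℓ g₁ (PolyBd A L ∪ D) := by
        refine sp ℓ hCℓ (signPres_of_const hG₀.bij.mapsTo 0 fun z hz => ?_)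
        rw [hDA] at hz
        exact sign_eq_zero_iff.2 hz.2
      have spL : ∀ m ∈ L, SignPres m g₁ (PolyBd A L ∪ D) := fun m hm => sp m (hL m hm) (hL₀ m hm)
      have spC : ∀ m ∈ C, SignPres m g₁ (PolyBd A L ∪ D) := fun m hm => sp m (hCC m hm) (hC₀ m hm)
      have bp : PolyBd A (ℓ :: L) = (PolyBd A L ∪ D) ∩ {x | 0 ≤ ℓ x} := polyBd_cons A ℓ L
      have bm : PolyBd A (-ℓ :: L) = (PolyBd A L ∪ D) ∩ {x | 0 ≤ (-ℓ) x} := by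
        rw [polyBd_cons A (-ℓ) L, hD]
        simp only [_root_.neg_apply, neg_eq_zero]
      have hbs : ∀ m : E →L[ℝ] ℝ, Bornology.IsBounded (Polytope A (m :: L)) := fun m =>
        hb.subset (by rw [polytope_cons]; exact inter_subset_left)
      obtain ⟨Gp, hGp, ep, hLp, hCp⟩ := ih A (ℓ :: L) g₁ hA (hbs ℓ)
        ⟨x, hx.1, List.forall_mem_cons.2 ⟨hx0, hx.2⟩⟩
        (by rw [bp]; exact hg₁.restrict fun z hz => spℓ.nonneg_iff hz)
        (by rw [bp]; exact List.forall_mem_cons.2 ⟨spℓ.mono inter_subset_left,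
          fun m hm => (spL m hm).mono inter_subset_left⟩)
        (by rw [bp]; exact fun m hm => (spC m hm).mono inter_subset_left)
      obtain ⟨Gm, hGm, em, hLm, hCm⟩ := ih A (-ℓ :: L) g₁ hA (hbs (-ℓ))
        ⟨y, hy.1, List.forall_mem_cons.2 ⟨by simpa using hy0, hy.2⟩⟩
        (by rw [bm]; exact hg₁.restrict fun z hz => spℓ.neg.nonneg_iff hz)
        (by rw [bm]; exact List.forall_mem_cons.2 ⟨spℓ.neg.mono inter_subset_left,
          fun m hm => (spL m hm).mono inter_subset_left⟩)
        (by rw [bm]; exact fun m hm => (spC m hm).mono inter_subset_left)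
      have hcap : Polytope A (ℓ :: L) ∩ Polytope A (-ℓ :: L) = D := by
        rw [hDA, polytope_cons, polytope_cons]
        ext z
        simp only [mem_inter_iff, mem_ofPred_eq, _root_.neg_apply, Left.nonneg_neg_iff]
        exact ⟨fun h => ⟨h.1.1, le_antisymm h.2.2 h.1.2⟩, fun h => ⟨⟨h.1, h.2.ge⟩, h.1, h.2.le⟩⟩
      have hcup : Polytope A (ℓ :: L) ∪ Polytope A (-ℓ :: L) = Polytope A L := by
        rw [polytope_cons, polytope_cons, ← inter_union_distrib_left]
        refine inter_eq_self_of_subset_left fun z _ => ?_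
        simp only [mem_union, mem_ofPred_eq, _root_.neg_apply, Left.nonneg_neg_iff]
        exact le_total _ _
      have Dp : D ⊆ PolyBd A (ℓ :: L) := fun z hz => by
        rw [bp]; refine ⟨Or.inr hz, ?_⟩; rw [hDA] at hz; exact hz.2.ge
      have Dm : D ⊆ PolyBd A (-ℓ :: L) := fun z hz => by
        rw [bm]; refine ⟨Or.inr hz, ?_⟩; rw [hDA] at hz
        have h2 : ℓ z = 0 := hz.2
        simp [h2]
      have eDp : EqOn Gp G₀ D := fun z hz => (ep (Dp hz)).trans (f2 hz)
      have eDm : EqOn Gm G₀ D := fun z hz => (em (Dm hz)).trans (f2 hz)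
      set G : E → E := fun x => if 0 ≤ ℓ x then Gp x else Gm x with hGdef
      have F1 : EqOn G Gp (Polytope A (ℓ :: L)) := fun z hz => if_pos (hz.2 ℓ List.mem_cons_self)
      have F2 : EqOn G Gm (Polytope A (-ℓ :: L)) := fun z hz => by
        by_cases h : 0 ≤ ℓ z
        · have hzD : z ∈ D := by
            rw [← hcap]; refine ⟨?_, hz⟩
            rw [polytope_cons] at hz ⊢; exact ⟨hz.1, h⟩
          rw [eDm hzD, ← eDp hzD]; exact if_pos h
        · exact if_neg h
      have hG : HomeoOn G (Polytope A L) := by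
        rw [← hcup]
        refine hGp.union hGm (Polytope.isClosed hA.closed) (Polytope.isClosed hA.closed) ?_ ?_ F1 F2
        · rw [hcap]; exact eDp.trans eDm.symm
        · rw [hcap]; exact (hG₀.congr eDp.symm).bij.surjOn
      have SG : ∀ m : E →L[ℝ] ℝ, SignPres m Gp (Polytope A (ℓ :: L)) →
          SignPres m Gm (Polytope A (-ℓ :: L)) → SignPres m G (Polytope A L) := by
        intro m h1 h2 z hz
        rw [← hcup] at hz
        rcases hz with hz | hz
        · exact h1.congr F1.symm z hz
        · exact h2.congr F2.symm z hz
      refine ⟨G, hG, ?_, ?_, ?_⟩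
      · intro z hz
        by_cases h : 0 ≤ ℓ z
        · have hz' : z ∈ PolyBd A (ℓ :: L) := by rw [bp]; exact ⟨Or.inl hz, h⟩
          rw [F1 hz'.1, ep hz', f1 hz]
        · have hz' : z ∈ PolyBd A (-ℓ :: L) := by
            rw [bm]; exact ⟨Or.inl hz, by simpa using (not_le.1 h).le⟩
          rw [F2 hz'.1, em hz', f1 hz]
      · exact fun m hm => SG m (hLp m (List.mem_cons_of_mem _ hm)) (hLm m (List.mem_cons_of_mem _ hm))
      · refine List.forall_mem_cons.2 ⟨SG ℓ (hLp ℓ List.mem_cons_self) ?_,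
          fun m hm => SG m (hCp m hm) (hCm m hm)⟩
        have := (hLm (-ℓ) List.mem_cons_self).neg
        rwa [neg_neg] at this
    -- No cut is needed here: an extension that preserves the facet signs maps the interior to
    -- itself, and `ℓ` has constant sign there.
    · obtain ⟨s, hs⟩ := polyInt_sign_const hA ℓ hcross
      obtain ⟨G, hG, e, hL', hC'⟩ := ih A L g hA hb hne hg hL hCC
      refine ⟨G, hG, e, hL', List.forall_mem_cons.2 ⟨fun x hx => ?_, hC'⟩⟩
      rcases poly_cases hx with h | h
      · rw [e h, hCℓ x h]
      · have h' : G x ∈ PolyInt A L :=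
          ⟨(hG.mem hx).1, fun m hm => (hL' m hm |>.pos_iff hx).2 (h.2 m hm)⟩
        rw [hs _ h, hs _ h']

/-! ### Confining a homeomorphism to one side of hyperplanes -/

/-- The homeomorphism that fixes `δ ≤ ℓ` and scales `δ - ℓ` by `κ` where it is positive, moving
points along the rays from `p`. -/
noncomputable def pushToward (ℓ : E →L[ℝ] ℝ) (p : E) (δ κ : ℝ) (x : E) : E :=
  p + ((ℓ p - δ + κ * max (δ - ℓ x) 0) / (ℓ p - δ + max (δ - ℓ x) 0)) • (x - p)

theorem continuous_pushToward {ℓ : E →L[ℝ] ℝ} {p : E} {δ κ : ℝ} (hp : δ < ℓ p) :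
    Continuous (pushToward ℓ p δ κ) := by
  have h1 : Continuous fun x : E => max (δ - ℓ x) 0 :=
    (continuous_const.sub ℓ.continuous).max continuous_const
  refine continuous_const.add (Continuous.smul (Continuous.div ?_ ?_ ?_) ?_)
  · exact continuous_const.add (continuous_const.mul h1)
  · exact continuous_const.add h1
  · intro x
    have := le_max_right (δ - ℓ x) 0
    linarith
  · exact continuous_id.sub continuous_const

theorem pushToward_of_le {ℓ : E →L[ℝ] ℝ} {p x : E} {δ κ : ℝ} (hp : δ < ℓ p) (hx : δ ≤ ℓ x) :
    pushToward ℓ p δ κ x = x := by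
  have h : max (δ - ℓ x) 0 = 0 := max_eq_right (by linarith)
  have h' : ℓ p - δ ≠ 0 := by linarith
  simp [pushToward, h, h']

theorem apply_pushToward {ℓ : E →L[ℝ] ℝ} {p x : E} {δ κ : ℝ} (hp : δ < ℓ p) (hκ : 0 ≤ κ) :
    max (δ - ℓ (pushToward ℓ p δ κ x)) 0 = κ * max (δ - ℓ x) 0 := by
  rcases le_total δ (ℓ x) with h | h
  · have h' : max (δ - ℓ x) 0 = 0 := max_eq_right (by linarith)
    rw [pushToward_of_le hp h, h', mul_zero]
  · have h' : max (δ - ℓ x) 0 = δ - ℓ x := max_eq_left (by linarith)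
    have hne : ℓ p - δ + (δ - ℓ x) ≠ 0 := by linarith
    rw [pushToward, h', map_line]
    have : δ - (ℓ p + (ℓ p - δ + κ * (δ - ℓ x)) / (ℓ p - δ + (δ - ℓ x)) * (ℓ x - ℓ p)) =
        κ * (δ - ℓ x) := by
      field_simp
      ring
    rw [this, max_eq_left (mul_nonneg hκ (by linarith))]

theorem pushToward_pushToward {ℓ : E →L[ℝ] ℝ} {p x : E} {δ κ κ' : ℝ} (hp : δ < ℓ p) (hκ : 0 ≤ κ)
    (h : κ' * κ = 1) : pushToward ℓ p δ κ' (pushToward ℓ p δ κ x) = x := by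
  have h0 := le_max_right (δ - ℓ x) 0
  set w := max (δ - ℓ x) 0 with hw
  have h1 : ℓ p - δ + w ≠ 0 := by linarith
  have h2 : ℓ p - δ + κ * w ≠ 0 := by have := mul_nonneg hκ h0; linarith
  rw [pushToward, apply_pushToward hp hκ, ← mul_assoc, h, one_mul, ← hw, pushToward, ← hw,
    add_sub_cancel_left, smul_smul, div_mul_div_cancel₀ h2, div_self h1, one_smul, add_sub_cancel]

/-- Conjugate `k` by a homeomorphism `c` that squeezes `W` toward a point of `D` into the region `δ
/ 2 ≤ ℓ`. Since `c` fixes every point with `δ ≤ ℓ`, in particular `D` and its image, the conjugate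
still agrees with `k` on `D`. Closure of `W` under contraction toward points of `D` keeps the
squeezed set inside `W`; the same property of `W'` allows iteration over several functionals. -/
theorem exists_confined_aux {A W D : Set E} {k : E → E} (hA : IsFlat A) (hWb : Bornology.IsBounded W)
    (hDA : D ⊆ A) (hD : IsCompact D) (hne : D.Nonempty)
    (hW : ∀ x ∈ W, ∀ p ∈ D, ∀ θ : ℝ, 0 < θ → θ ≤ 1 → p + θ • (x - p) ∈ W)
    (hk : ContinuousOn k A) (hkb : BijOn k A A) (hid : ∀ x ∈ A, x ∉ W → k x = x)
    (ℓ : E →L[ℝ] ℝ) (h1 : ∀ x ∈ D, 0 < ℓ x) (h2 : ∀ x ∈ D, 0 < ℓ (k x)) :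
    ∃ W' k', W' ⊆ W ∧ (∀ x ∈ W', 0 < ℓ x) ∧
      (∀ x ∈ W', ∀ p ∈ D, ∀ θ : ℝ, 0 < θ → θ ≤ 1 → p + θ • (x - p) ∈ W') ∧
      ContinuousOn k' A ∧ BijOn k' A A ∧ (∀ x ∈ A, x ∉ W' → k' x = x) ∧ EqOn k' k D := by
  obtain ⟨δ, hδ, hδ1, hδ2⟩ : ∃ δ : ℝ, 0 < δ ∧ (∀ x ∈ D, δ < ℓ x) ∧ ∀ x ∈ D, δ < ℓ (k x) := by
    obtain ⟨a, ha, hamin⟩ := hD.exists_isMinOn hne ℓ.continuous.continuousOn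
    obtain ⟨b, hb, hbmin⟩ := hD.exists_isMinOn hne
      (ℓ.continuous.comp_continuousOn (hk.mono hDA))
    have hab : 0 < min (ℓ a) (ℓ (k b)) := lt_min (h1 a ha) (h2 b hb)
    refine ⟨min (ℓ a) (ℓ (k b)) / 2, half_pos hab, fun x hx => ?_, fun x hx => ?_⟩
    · exact (half_lt_self hab).trans_le ((min_le_left _ _).trans (hamin hx))
    · exact (half_lt_self hab).trans_le ((min_le_right _ _).trans (hbmin hx))
  obtain ⟨M, hM⟩ := hWb.exists_norm_le
  obtain ⟨R, hR0, hR⟩ : ∃ R : ℝ, 0 ≤ R ∧ ∀ x ∈ W, -R ≤ ℓ x := by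
    refine ⟨‖ℓ‖ * |M|, by positivity, fun x hx => ?_⟩
    have h3 : ‖ℓ x‖ ≤ ‖ℓ‖ * |M| :=
      (ℓ.le_opNorm x).trans (by gcongr; exact (hM x hx).trans (le_abs_self M))
    exact (abs_le.1 h3).1
  obtain ⟨p, hp⟩ := hne
  have hpδ := hδ1 p hp
  -- On `W` the deficit `δ - ℓ` is at most `δ + R`, so scaling by this factor leaves a deficit of at
  -- most `δ / 2`.
  set κ : ℝ := δ / 2 / (δ + R) with hκdef
  have hδR : 0 < δ + R := by linarith
  have hκ : 0 < κ := by positivity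
  have hκ1 : κ ≤ 1 := by rw [hκdef, div_le_one hδR]; linarith
  set c := pushToward ℓ p δ κ
  set c' := pushToward ℓ p δ κ⁻¹
  have hcc' : ∀ x, c (c' x) = x := fun x =>
    pushToward_pushToward hpδ (inv_pos.2 hκ).le (mul_inv_cancel₀ hκ.ne')
  have hc'c : ∀ x, c' (c x) = x := fun x =>
    pushToward_pushToward hpδ hκ.le (inv_mul_cancel₀ hκ.ne')
  have hcA : MapsTo c A A := fun x hx => hA.line p (hDA hp) x hx _
  have hc'A : MapsTo c' A A := fun x hx => hA.line p (hDA hp) x hx _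
  have hcbij : BijOn c A A := ⟨hcA, fun x _ y _ e => by rw [← hc'c x, e, hc'c],
    fun x hx => ⟨c' x, hc'A hx, hcc' x⟩⟩
  have hc'bij : BijOn c' A A := ⟨hc'A, fun x _ y _ e => by rw [← hcc' x, e, hcc'],
    fun x hx => ⟨c x, hcA hx, hc'c x⟩⟩
  have hcW : ∀ x ∈ W, c x ∈ W ∧ δ / 2 ≤ ℓ (c x) := by
    intro x hx
    have hw0 := le_max_right (δ - ℓ x) 0
    have hw1 : max (δ - ℓ x) 0 ≤ δ + R := max_le (by linarith [hR x hx]) hδR.le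
    constructor
    · refine hW x hx p hp _ ?_ ?_
      · have := mul_nonneg hκ.le hw0
        exact div_pos (by linarith) (by linarith)
      · rw [div_le_one (by linarith)]
        have := mul_le_mul_of_nonneg_right hκ1 hw0
        linarith
    · have h3 : max (δ - ℓ (c x)) 0 = κ * max (δ - ℓ x) 0 := apply_pushToward hpδ hκ.le
      have h4 := le_max_left (δ - ℓ (c x)) 0
      have h5 : κ * max (δ - ℓ x) 0 ≤ κ * (δ + R) := by gcongr
      have h6 : κ * (δ + R) = δ / 2 := div_mul_cancel₀ _ hδR.ne'
      linarith
  refine ⟨W ∩ {x | δ / 2 ≤ ℓ x}, fun x => c (k (c' x)), inter_subset_left,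
    fun x hx => (half_pos hδ).trans_le hx.2, ?_, ?_, ?_, ?_, ?_⟩
  · rintro x ⟨hx, hx'⟩ q hq θ hθ hθ1
    refine ⟨hW x hx q hq θ hθ hθ1, ?_⟩
    simp only [mem_ofPred_eq] at hx' ⊢
    rw [map_line]
    nlinarith [hδ1 q hq]
  · exact (continuous_pushToward hpδ).comp_continuousOn
      (hk.comp (continuous_pushToward hpδ).continuousOn hc'A)
  · exact hcbij.comp (hkb.comp hc'bij)
  · intro x hx hxW
    have : c' x ∉ W := fun h => hxW (by have := hcW _ h; rwa [hcc'] at this)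
    show c (k (c' x)) = x
    rw [hid _ (hc'A hx) this, hcc']
  · intro x hx
    show c (k (c' x)) = k x
    rw [show c' x = x from pushToward_of_le hpδ (hδ1 x hx).le]
    exact pushToward_of_le hpδ (hδ2 x hx).le

theorem exists_confined {A D : Set E} (hA : IsFlat A) (hDA : D ⊆ A) (hD : IsCompact D)
    (hne : D.Nonempty) (C : List (E →L[ℝ] ℝ)) : ∀ (W : Set E) (k : E → E), Bornology.IsBounded W →
    (∀ x ∈ W, ∀ p ∈ D, ∀ θ : ℝ, 0 < θ → θ ≤ 1 → p + θ • (x - p) ∈ W) →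
    ContinuousOn k A → BijOn k A A → (∀ x ∈ A, x ∉ W → k x = x) →
    (∀ ℓ ∈ C, ∀ x ∈ D, 0 < ℓ x) → (∀ ℓ ∈ C, ∀ x ∈ D, 0 < ℓ (k x)) →
    ∃ k', ContinuousOn k' A ∧ BijOn k' A A ∧ (∀ x ∈ A, x ∉ W → k' x = x) ∧
      (∀ ℓ ∈ C, ∀ x ∈ A, ℓ x ≤ 0 → k' x = x) ∧ EqOn k' k D := by
  induction C with
  | nil => exact fun W k _ _ h1 h2 h3 _ _ => ⟨k, h1, h2, h3, by simp, fun _ _ => rfl⟩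
  | cons ℓ C ih =>
    intro W k hb hW hk hkb hid h1 h2
    rw [List.forall_mem_cons] at h1 h2
    obtain ⟨W', k', hWW', hpos, hW', c', b', id', e'⟩ :=
      exists_confined_aux hA hb hDA hD hne hW hk hkb hid ℓ h1.1 h2.1
    obtain ⟨k'', c'', b'', id'', hC'', e''⟩ := ih W' k' (hb.subset hWW') hW' c' b' id' h1.2
      (fun m hm x hx => by rw [e' hx]; exact h2.2 m hm x hx)
    refine ⟨k'', c'', b'', fun x hx hxW => id'' x hx fun h => hxW (hWW' h),
      List.forall_mem_cons.2 ⟨fun x hx hx0 => id'' x hx fun h => (hpos x h).not_ge hx0, hC''⟩,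
      e''.trans e'⟩

/-- If `g` extends to a homeomorphism `k` of the polytope, then it also extends to one that agrees
with `k` on `D` and preserves the signs of functionals in `C`, provided that these are positive on
`D` and on its image and that `g` preserves their signs. -/
theorem HomeoOn.exists_ext_eqOn {A D : Set E} {L C : List (E →L[ℝ] ℝ)} {g k : E → E}
    (hA : IsFlat A) (hK : IsCompact (Polytope A L)) (hi : (PolyInt A L).Nonempty)
    (hD : IsClosed D) (hDK : D ⊆ Polytope A L)
    (hg : HomeoOn g (PolyBd A L)) (hgL : ∀ ℓ ∈ L, SignPres ℓ g (PolyBd A L))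
    (hgC : ∀ ℓ ∈ C, SignPres ℓ g (PolyBd A L))
    (hk : HomeoOn k (Polytope A L)) (hkg : EqOn k g (PolyBd A L))
    (h1 : ∀ ℓ ∈ C, ∀ x ∈ D, 0 < ℓ x) (h2 : ∀ ℓ ∈ C, ∀ x ∈ D, 0 < ℓ (k x)) :
    ∃ G, HomeoOn G (Polytope A L) ∧ EqOn G g (PolyBd A L) ∧ EqOn G k D ∧
      (∀ ℓ ∈ L, SignPres ℓ G (Polytope A L)) ∧ ∀ ℓ ∈ C, SignPres ℓ G (Polytope A L) := by
  classical
  -- The extension `G₂` has the right signs, and `k` has the right values on `D`. Their discrepancy,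
  -- `k` followed by the inverse of `G₂`, is the identity on the boundary. It is confined to the
  -- region where the functionals in `C` are positive, without a change on `D`, and then composed
  -- with `G₂`.
  obtain ⟨G₂, hG₂, e₂, hL₂, hC₂⟩ :=
    HomeoOn.exists_sign_ext C A L g hA hK.isBounded hi hg hgL hgC
  rcases D.eq_empty_or_nonempty with rfl | hne
  · exact ⟨G₂, hG₂, e₂, by simp, hL₂, hC₂⟩
  obtain ⟨G₂', hG₂', inv1, inv2⟩ := hG₂.exists_inv hK
  have hκ := hG₂'.comp hk
  have hκid : ∀ x ∈ PolyBd A L, G₂' (k x) = x := fun x hx => by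
    rw [hkg hx, ← e₂ hx, inv1 x hx.1]
  -- Extending by the identity gives a bijection of the whole flat, which can be conjugated with
  -- maps that squeeze along rays.
  set κ : E → E := fun x => if x ∈ Polytope A L then G₂' (k x) else x with hκdef
  set K₂ : Set E := {x | x ∈ A ∧ ∃ ℓ ∈ L, ℓ x ≤ 0} with hK₂
  have hK₂c : IsClosed K₂ := by
    have : K₂ = A ∩ ⋃ ℓ ∈ {ℓ | ℓ ∈ L}, {x | ℓ x ≤ 0} := by ext; simp [K₂]
    rw [this]
    exact hA.closed.inter ((List.finite_toSet L).isClosed_biUnion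
      fun ℓ _ => isClosed_le ℓ.continuous continuous_const)
  have hcap : Polytope A L ∩ K₂ = PolyBd A L := by
    ext x
    constructor
    · rintro ⟨hx, -, ℓ, hℓ, h⟩
      exact ⟨hx, ℓ, hℓ, le_antisymm h (hx.2 ℓ hℓ)⟩
    · rintro ⟨hx, ℓ, hℓ, h⟩
      exact ⟨hx, hx.1, ℓ, hℓ, h.le⟩
  have hcup : Polytope A L ∪ K₂ = A := by
    ext x
    constructor
    · rintro (hx | hx)
      exacts [hx.1, hx.1]
    · intro hx
      by_cases h : ∃ ℓ ∈ L, ℓ x ≤ 0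
      · exact Or.inr ⟨hx, h⟩
      · push Not at h
        exact Or.inl ⟨hx, fun ℓ hℓ => (h ℓ hℓ).le⟩
  have f1 : EqOn κ (fun x => G₂' (k x)) (Polytope A L) := fun x hx => if_pos hx
  have f2 : EqOn κ (fun x => x) K₂ := fun x hx => by
    by_cases h : x ∈ Polytope A L
    · rw [f1 h]; exact hκid x (hcap ▸ ⟨h, hx⟩)
    · exact if_neg h
  have hκA : HomeoOn κ A := by
    rw [← hcup]
    refine hκ.union (HomeoOn.id K₂) (Polytope.isClosed hA.closed) hK₂c ?_ ?_ f1 f2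
    · rw [hcap]; exact hκid
    · rw [hcap]; exact fun x hx => ⟨x, hx, hκid x hx⟩
  obtain ⟨κ', c', b', id', hC', e'⟩ := exists_confined (D := D) hA (hDK.trans fun x hx => hx.1)
    (hK.of_isClosed_subset hD hDK) hne C (PolyInt A L) κ (hK.isBounded.subset polyInt_sub)
    (by
      intro x hx p hp θ hθ hθ1
      have hpK := hDK hp
      refine ⟨hA.line p hpK.1 x hx.1 θ, fun ℓ hℓ => ?_⟩
      rw [map_line]
      nlinarith [hx.2 ℓ hℓ, hpK.2 ℓ hℓ, mul_pos hθ (hx.2 ℓ hℓ)])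
    hκA.cont hκA.bij
    (by
      intro x hx hxi
      by_cases h : x ∈ Polytope A L
      · rw [f1 h]; exact hκid x ((poly_cases h).resolve_right hxi)
      · exact if_neg h)
    h1
    (fun ℓ hℓ x hx => by
      rw [f1 (hDK hx)]
      refine (hC₂ ℓ hℓ |>.pos_iff (hG₂'.mem (hk.mem (hDK hx)))).1 ?_
      rw [inv2 _ (hk.mem (hDK hx))]
      exact h2 ℓ hℓ x hx)
  -- A bijection that fixes every point outside `P` preserves `P`.
  have stay : ∀ {P : Set E}, (∀ x ∈ A, x ∉ P → κ' x = x) → ∀ x ∈ A, κ' x ∈ P ↔ x ∈ P := by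
    intro P hP x hx
    constructor
    · intro h; by_contra hxP; rw [hP x hx hxP] at h; exact hxP h
    · intro h
      by_contra hxP
      have := b'.injOn (b'.mapsTo hx) hx (hP _ (b'.mapsTo hx) hxP)
      rw [this] at hxP
      exact hxP h
  have hint := stay id'
  have hpol : ∀ x ∈ A, κ' x ∈ Polytope A L ↔ x ∈ Polytope A L :=
    stay fun x hx h => id' x hx fun h' => h (polyInt_sub h')
  have hκ'K : HomeoOn κ' (Polytope A L) :=
    HomeoOn.restrict_sub (K := A) ⟨c', b'⟩ (fun x hx => hx.1) hpol
  refine ⟨fun x => G₂ (κ' x), hG₂.comp hκ'K, ?_, ?_, ?_, ?_⟩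
  · intro x hx
    have : κ' x = x := id' x hx.1.1 fun h => by
      obtain ⟨ℓ, hℓ, h0⟩ := hx.2
      exact (h.2 ℓ hℓ).ne' h0
    show G₂ (κ' x) = g x
    rw [this, e₂ hx]
  · intro x hx
    show G₂ (κ' x) = k x
    rw [e' hx, f1 (hDK hx), inv2 _ (hk.mem (hDK hx))]
  · intro ℓ hℓ
    refine (hL₂ ℓ hℓ).comp (fun x hx => ?_) hκ'K.bij.mapsTo
    by_cases h : x ∈ PolyInt A L
    · rw [sign_pos (h.2 ℓ hℓ), sign_pos (((hint x hx.1).2 h).2 ℓ hℓ)]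
    · rw [id' x hx.1 h]
  · intro ℓ hℓ
    refine (hC₂ ℓ hℓ).comp (fun x hx => ?_) hκ'K.bij.mapsTo
    by_cases h : 0 < ℓ x
    · have : 0 < ℓ (κ' x) := (stay (P := {x | 0 < ℓ x})
        (fun x hx h => hC' ℓ hℓ x hx (not_lt.1 h)) x hx.1).2 h
      rw [sign_pos h, sign_pos this]
    · rw [hC' ℓ hℓ x hx.1 (not_lt.1 h)]

end Arrangement

/-! ### Extension from one skeleton to the next -/

theorem ContinuousOn.of_finite_cover {X Y ι : Type*} [TopologicalSpace X] [TopologicalSpace Y]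
    [Finite ι] {f : ι → Set X} {K : Set X} {g : X → Y} (hc : ∀ i, IsClosed (f i))
    (hg : ∀ i, ContinuousOn g (f i)) (hK : K ⊆ ⋃ i, f i) : ContinuousOn g K :=
  ((locallyFinite_of_finite f).continuousOn_iUnion hc hg).mono hK

/-- The support map `σ` is abstract so that the lemma serves both the tetrahedron and the prism over
it. Supports are preserved, so images of points with different supports cannot coincide, and
injectivity can be checked one support at a time. -/
theorem HomeoOn.skeleton_ext {X : Type*} [TopologicalSpace X] {σ : X → Finset (Fin 4)} {Z : Set X}
    {k : ℕ} (hk : k < 4) (hcl : ∀ s, IsClosed {x | x ∈ Z ∧ σ x ⊆ s}) {g G : X → X}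
    {γ : Finset (Fin 4) → X → X} (hg : HomeoOn g {x | x ∈ Z ∧ (σ x).card ≤ k})
    (hgσ : ∀ x ∈ Z, (σ x).card ≤ k → σ (g x) = σ x)
    (hγ : ∀ s, s.card = k + 1 → HomeoOn (γ s) {x | x ∈ Z ∧ σ x ⊆ s})
    (hγσ : ∀ s, s.card = k + 1 → ∀ x ∈ Z, σ x ⊆ s → σ (γ s x) = σ x)
    (agree : ∀ s, s.card = k + 1 → ∀ x ∈ Z, σ x ⊂ s → γ s x = g x)
    (hG : ∀ x ∈ Z, (σ x).card ≤ k → G x = g x)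
    (hG' : ∀ x ∈ Z, (σ x).card = k + 1 → G x = γ (σ x) x) :
    HomeoOn G {x | x ∈ Z ∧ (σ x).card ≤ k + 1} ∧
      (∀ x ∈ Z, (σ x).card ≤ k + 1 → σ (G x) = σ x) ∧
      ∀ s, s.card = k + 1 → EqOn G (γ s) {x | x ∈ Z ∧ σ x ⊆ s} := by
  have eqs : ∀ s, s.card = k + 1 → EqOn G (γ s) {x | x ∈ Z ∧ σ x ⊆ s} := by
    rintro s hs x ⟨hxZ, hx⟩
    rcases hx.eq_or_ssubset with h | h
    · rw [hG' x hxZ (h ▸ hs), h]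
    · rw [agree s hs x hxZ h, hG x hxZ]
      have := Finset.card_lt_card h
      omega
  have hσ : ∀ x ∈ Z, (σ x).card ≤ k + 1 → σ (G x) = σ x := by
    intro x hx hc
    rcases Nat.le_succ_iff.1 hc with h | h
    · rw [hG x hx h, hgσ x hx h]
    · rw [hG' x hx h, hγσ _ h x hx subset_rfl]
  have hmem : ∀ x ∈ Z, (σ x).card ≤ k + 1 → G x ∈ Z := by
    intro x hx hc
    rcases Nat.le_succ_iff.1 hc with h | h
    · rw [hG x hx h]; exact (hg.mem ⟨hx, h⟩).1
    · rw [hG' x hx h]; exact ((hγ _ h).mem ⟨hx, subset_rfl⟩).1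
  refine ⟨⟨?_, ?_, ?_, ?_⟩, hσ, eqs⟩
  · refine ContinuousOn.of_finite_cover (ι := {s : Finset (Fin 4) // s.card = k + 1})
      (f := fun s => {x | x ∈ Z ∧ σ x ⊆ s.1}) (fun s => hcl s.1)
      (fun s => (hγ s.1 s.2).cont.congr (eqs s.1 s.2)) ?_
    rintro x ⟨hx, hc⟩
    obtain ⟨s, hs, hcard⟩ := Finset.exists_superset_card_eq hc (by simpa using hk)
    exact mem_iUnion.2 ⟨⟨s, hcard⟩, hx, hs⟩
  · rintro x ⟨hx, hc⟩
    exact ⟨hmem x hx hc, (hσ x hx hc).symm ▸ hc⟩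
  · rintro x ⟨hx, hc⟩ y ⟨hy, hc'⟩ e
    have e' : σ x = σ y := by rw [← hσ x hx hc, ← hσ y hy hc', e]
    rcases Nat.le_succ_iff.1 hc with h | h
    · rw [hG x hx h, hG y hy (e' ▸ h)] at e
      exact hg.inj ⟨hx, h⟩ ⟨hy, e' ▸ h⟩ e
    · rw [hG' x hx h, hG' y hy (e' ▸ h), ← e'] at e
      exact (hγ _ h).inj ⟨hx, subset_rfl⟩ ⟨hy, e'.ge⟩ e
  · rintro y ⟨hy, hc⟩
    rcases Nat.le_succ_iff.1 hc with h | h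
    · obtain ⟨x, hx, rfl⟩ := hg.surj ⟨hy, h⟩
      exact ⟨x, ⟨hx.1, hx.2.trans k.le_succ⟩, hG x hx.1 hx.2⟩
    · obtain ⟨x, hx, e⟩ := (hγ _ h).surj ⟨hy, subset_rfl⟩
      have e' : σ x = σ y := by rw [← hγσ _ h x hx.1 hx.2, e]
      exact ⟨x, ⟨hx.1, e' ▸ hc⟩, by rw [hG' x hx.1 (e' ▸ h), e', e]⟩

/-! ### The faces of the tetrahedron -/

/-- The ambient space of the standard tetrahedron. -/
abbrev Vec : Type := Fin 4 → ℝ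

/-- The standard tetrahedron as a subset of `Vec`. -/
abbrev simplex : Set Vec := stdSimplex ℝ (Fin 4)

/-- The set of vertices of the smallest face that contains `x`. -/
noncomputable def supp (x : Vec) : Finset (Fin 4) := Finset.univ.filter fun i => x i ≠ 0

theorem mem_supp {x : Vec} {i : Fin 4} : i ∈ supp x ↔ x i ≠ 0 := by simp [supp]

theorem supp_subset {x : Vec} {s : Finset (Fin 4)} : supp x ⊆ s ↔ ∀ i ∉ s, x i = 0 := by
  constructor
  · intro h i hi
    by_contra h0
    exact hi (h (mem_supp.2 h0))
  · intro h i hi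
    by_contra hs
    exact mem_supp.1 hi (h i hs)

theorem supp_eq_supp {x y : Vec} : supp x = supp y ↔ ∀ i, x i = 0 ↔ y i = 0 := by
  simp only [Finset.ext_iff, mem_supp, not_iff_not, ne_eq]

/-- The face spanned by the vertices in `s`. -/
def face (s : Finset (Fin 4)) : Set Vec := {x | x ∈ simplex ∧ supp x ⊆ s}

/-- The faces of dimension less than `k`. -/
def skel (k : ℕ) : Set Vec := {x | x ∈ simplex ∧ (supp x).card ≤ k}

/-- The flat spanned by the vertices in `s`. -/
def faceFlat (s : Finset (Fin 4)) : Set Vec := {x | ∑ i, x i = 1 ∧ ∀ i ∉ s, x i = 0}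

/-- The `i`-th coordinate, as a functional. -/
noncomputable abbrev coord (i : Fin 4) : Vec →L[ℝ] ℝ := ContinuousLinearMap.proj i

noncomputable def faceCoords (s : Finset (Fin 4)) : List (Vec →L[ℝ] ℝ) := s.toList.map coord

theorem forall_faceCoords {s : Finset (Fin 4)} {P : (Vec →L[ℝ] ℝ) → Prop} :
    (∀ ℓ ∈ faceCoords s, P ℓ) ↔ ∀ i ∈ s, P (coord i) := by
  simp [faceCoords]

theorem isFlat_faceFlat (s : Finset (Fin 4)) : IsFlat (faceFlat s) := by
  constructor
  · have : faceFlat s = {x | ∑ i, x i = 1} ∩ ⋂ i ∈ {i | i ∉ s}, {x : Vec | x i = 0} := by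
      ext; simp [faceFlat]
    rw [this]
    exact (isClosed_eq (by fun_prop) continuous_const).inter
      (isClosed_biInter fun i _ => isClosed_eq (continuous_apply i) continuous_const)
  · rintro x ⟨hx, hx'⟩ y ⟨hy, hy'⟩ μ
    refine ⟨?_, fun i hi => ?_⟩
    · simp only [Pi.add_apply, Pi.smul_apply, Pi.sub_apply, smul_eq_mul, Finset.sum_add_distrib,
        ← Finset.mul_sum, Finset.sum_sub_distrib, hx, hy]
      ring
    · simp [hx' i hi, hy' i hi]

theorem face_eq_polytope (s : Finset (Fin 4)) : face s = Polytope (faceFlat s) (faceCoords s) := by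
  ext x
  simp only [face, Polytope, faceFlat, mem_ofPred_eq, forall_faceCoords, supp_subset, simplex,
    stdSimplex]
  constructor
  · rintro ⟨⟨h1, h2⟩, h3⟩
    exact ⟨⟨h2, h3⟩, fun i _ => h1 i⟩
  · rintro ⟨⟨h2, h3⟩, h1⟩
    refine ⟨⟨fun i => ?_, h2⟩, h3⟩
    by_cases hi : i ∈ s
    · exact h1 i hi
    · rw [h3 i hi]

theorem isClosed_face (s : Finset (Fin 4)) : IsClosed (face s) := by
  rw [face_eq_polytope]; exact Polytope.isClosed (isFlat_faceFlat s).closed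

theorem isCompact_face (s : Finset (Fin 4)) : IsCompact (face s) :=
  (isCompact_stdSimplex ℝ (Fin 4)).of_isClosed_subset (isClosed_face s) fun _ hx => hx.1

theorem convex_face (s : Finset (Fin 4)) : Convex ℝ (face s) := by
  rw [face_eq_polytope]; exact Polytope.convex (isFlat_faceFlat s).convex

/-- The boundary of a face. -/
def faceBd (s : Finset (Fin 4)) : Set Vec := {x | x ∈ simplex ∧ supp x ⊂ s}

theorem faceBd_eq_polyBd (s : Finset (Fin 4)) :
    faceBd s = PolyBd (faceFlat s) (faceCoords s) := by
  ext x
  rw [PolyBd, ← face_eq_polytope]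
  simp only [faceBd, face, mem_ofPred_eq, ssubset_iff_subset_ne, ne_eq, and_assoc]
  refine and_congr_right fun _ => and_congr_right fun h => ?_
  have : (∃ ℓ ∈ faceCoords s, ℓ x = 0) ↔ ∃ i ∈ s, x i = 0 := by simp [faceCoords]
  rw [this]
  constructor
  · intro hne
    by_contra hall
    push Not at hall
    exact hne (h.antisymm fun i hi => mem_supp.2 (hall i hi))
  · rintro ⟨i, hi, h0⟩ e
    rw [← e, mem_supp] at hi
    exact hi h0

theorem mem_faceInt {s : Finset (Fin 4)} {x : Vec} :
    x ∈ PolyInt (faceFlat s) (faceCoords s) ↔ x ∈ simplex ∧ supp x = s := by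
  constructor
  · intro hx
    have h1 : x ∈ face s := by rw [face_eq_polytope]; exact polyInt_sub hx
    refine ⟨h1.1, h1.2.antisymm fun i hi => mem_supp.2 ?_⟩
    exact (forall_faceCoords.1 hx.2 i hi).ne'
  · rintro ⟨hx, rfl⟩
    have h1 : x ∈ face (supp x) := ⟨hx, subset_rfl⟩
    rw [face_eq_polytope] at h1
    refine ⟨h1.1, forall_faceCoords.2 fun i hi => lt_of_le_of_ne (hx.1 i) (mem_supp.1 hi).symm⟩

/-- The barycentre of a face. -/
noncomputable def bary (s : Finset (Fin 4)) : Vec := fun i => if i ∈ s then (s.card : ℝ)⁻¹ else 0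

theorem bary_mem {s : Finset (Fin 4)} (hs : s.Nonempty) :
    bary s ∈ PolyInt (faceFlat s) (faceCoords s) := by
  have hc : (0 : ℝ) < s.card := by exact_mod_cast hs.card_pos
  refine ⟨⟨?_, fun i hi => if_neg hi⟩, forall_faceCoords.2 fun i hi => ?_⟩
  · simp only [bary, Finset.sum_ite_mem, Finset.univ_inter, Finset.sum_const, nsmul_eq_mul]
    exact mul_inv_cancel₀ hc.ne'
  · have : bary s i = (s.card : ℝ)⁻¹ := if_pos hi
    simp [this, hc]

/-- The gauge of a face with respect to its barycentre. -/
noncomputable def faceGauge (s : Finset (Fin 4)) (x : Vec) : ℝ :=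
  ⨆ i, if i ∈ s then max (1 - s.card * x i) 0 else 0

/-- The supremum refers to no order of the vertices, unlike the list behind `polyGauge`, and this
makes naturality under relabelling (`faceGauge_map`) immediate. The two gauges agree because they
have the same sublevel sets. -/
theorem faceGauge_eq {s : Finset (Fin 4)} : faceGauge s = polyGauge (faceCoords s) (bary s) := by
  have key : ∀ x, ∀ r : ℝ, 0 ≤ r → (faceGauge s x ≤ r ↔ polyGauge (faceCoords s) (bary s) x ≤ r) := by
    intro x r hr
    rw [polyGauge_le_iff hr, forall_faceCoords, faceGauge, ciSup_le_iff (Set.finite_range _).bddAbove]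
    refine forall_congr' fun i => ?_
    by_cases hi : i ∈ s
    · have : bary s i = (s.card : ℝ)⁻¹ := if_pos hi
      simp [hi, this, hr, mul_comm]
    · simp [hi, hr]
  have h0 : ∀ x, 0 ≤ faceGauge s x := fun x => by
    refine Real.iSup_nonneg fun i => ?_
    split_ifs
    exacts [le_max_right _ _, le_rfl]
  funext x
  exact le_antisymm ((key x _ (polyGauge_nonneg x)).2 le_rfl) ((key x _ (h0 x)).1 le_rfl)

theorem isBounded_face (s : Finset (Fin 4)) :
    Bornology.IsBounded (Polytope (faceFlat s) (faceCoords s)) := by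
  rw [← face_eq_polytope]; exact (isCompact_face s).isBounded

theorem isConeGauge_face {s : Finset (Fin 4)} (hs : s.Nonempty) :
    IsConeGauge (faceFlat s) (bary s) (faceGauge s) := by
  rw [faceGauge_eq]
  exact isConeGauge_poly (isFlat_faceFlat s) (bary_mem hs) (isBounded_face s)

theorem face_eq_gauge {s : Finset (Fin 4)} (hs : s.Nonempty) :
    face s = {x | x ∈ faceFlat s ∧ faceGauge s x ≤ 1} := by
  rw [face_eq_polytope, poly_eq_gauge (bary_mem hs).2, faceGauge_eq]

theorem faceBd_eq_gauge {s : Finset (Fin 4)} (hs : s.Nonempty) :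
    faceBd s = {x | x ∈ faceFlat s ∧ faceGauge s x = 1} := by
  rw [faceBd_eq_polyBd, polyBd_eq_gauge (bary_mem hs).2, faceGauge_eq]

theorem isClosed_faceBd (s : Finset (Fin 4)) : IsClosed (faceBd s) := by
  rw [faceBd_eq_polyBd]; exact PolyBd.isClosed (isFlat_faceFlat s).closed

theorem supp_nonempty {x : Vec} (hx : x ∈ simplex) : (supp x).Nonempty := by
  by_contra h
  rw [Finset.not_nonempty_iff_eq_empty] at h
  have : ∀ i, x i = 0 := fun i => by
    by_contra h0
    have := mem_supp.2 h0
    simp [h] at this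
  have h1 := hx.2
  simp [this] at h1

theorem isCompact_simplex : IsCompact simplex := isCompact_stdSimplex ℝ (Fin 4)

theorem face_univ : face Finset.univ = simplex := by ext; simp [face]

theorem skel_four : skel 4 = simplex := by
  ext x
  simp only [skel, mem_ofPred_eq, and_iff_left_iff_imp]
  exact fun _ => (Finset.card_le_univ _).trans (by simp)

theorem face_inter_skel {s : Finset (Fin 4)} {k : ℕ} (hs : s.card = k + 1) :
    skel k ∩ {x | supp x ⊆ s} = faceBd s := by
  ext x
  simp only [skel, faceBd, mem_inter_iff, mem_ofPred_eq, and_assoc]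
  refine and_congr_right fun _ => ⟨fun h => h.2.ssubset_of_ne ?_, fun h => ⟨?_, h.subset⟩⟩
  · rintro e; rw [e] at h; omega
  · have := Finset.card_lt_card h; omega

theorem faceBd_univ : faceBd Finset.univ = skel 3 := by
  rw [← face_inter_skel (k := 3) (by simp)]
  ext; simp

/-- `g` preserves the smallest face that contains a point of `K`. -/
def SuppPres (g : Vec → Vec) (K : Set Vec) : Prop := ∀ x ∈ K, supp (g x) = supp x

/-! ### The Alexander isotopy -/

/-- The gauge of the prism over a face, with respect to the barycentre of its bottom. -/
noncomputable def prismGauge (s : Finset (Fin 4)) (z : ℝ × Vec) : ℝ := max z.1 (faceGauge s z.2)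

/-- The apex lies on the bottom of the prism, so the level set of gauge one consists of the top and
the sides; the bottom is swept out by rays that stay in it. -/
theorem isConeGauge_prism {s : Finset (Fin 4)} (hs : s.Nonempty) :
    IsConeGauge {z : ℝ × Vec | 0 ≤ z.1 ∧ z.2 ∈ faceFlat s} (0, bary s) (prismGauge s) where
  cone z hz μ hμ := by
    refine ⟨?_, (isConeGauge_face hs).cone _ hz.2 μ hμ⟩
    simpa using mul_nonneg hμ hz.1
  cont := continuous_fst.max ((isConeGauge_face hs).cont.comp continuous_snd)
  homog z hz μ hμ := by
    have := (isConeGauge_face hs).homog _ hz.2 μ hμ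
    simp only [prismGauge]
    rw [mul_max_of_nonneg _ _ hμ]
    congr 1
    · simp
  pos z hz hne := by
    by_cases h : z.2 = bary s
    · refine lt_max_of_lt_left (lt_of_le_of_ne hz.1 fun h0 => hne ?_)
      exact Prod.ext h0.symm h
    · exact lt_max_of_lt_right ((isConeGauge_face hs).pos _ hz.2 h)

/-- The isotopy from the identity to `h`, constructed on the faces of dimension less than `k` by
coning from the barycentres of the bottoms of the prisms over these faces. -/
noncomputable def alexander (h : Vec → Vec) : ℕ → ℝ × Vec → ℝ × Vec
  | 0, z => z
  | k + 1, z =>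
    if (supp z.2).card ≤ k then alexander h k z
    else coneExt (0, bary (supp z.2)) (prismGauge (supp z.2))
      (fun w => if w.1 = 1 then (1, h w.2) else alexander h k w) z

def prism : Set (ℝ × Vec) := {z | z.1 ∈ Icc (0 : ℝ) 1 ∧ z.2 ∈ simplex}

theorem isClosed_prism_face (s : Finset (Fin 4)) :
    IsClosed {z : ℝ × Vec | z ∈ prism ∧ supp z.2 ⊆ s} := by
  have : {z : ℝ × Vec | z ∈ prism ∧ supp z.2 ⊆ s} = Icc (0 : ℝ) 1 ×ˢ face s := by
    ext z; simp only [prism, face, mem_ofPred_eq, mem_prod, and_assoc]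
  rw [this]
  exact isClosed_Icc.prod (isClosed_face s)

/-- Heights are preserved because they are preserved on the level set and the rays start at height
zero. The bottom is fixed because a ray at height zero ends on a side of the prism at height zero,
where the map is already the identity. -/
theorem alexander_spec {h : Vec → Vec} (hh : HomeoOn h simplex) (hs : SuppPres h simplex) (k : ℕ)
    (hk : k ≤ 4) :
    HomeoOn (alexander h k) {z | z ∈ prism ∧ (supp z.2).card ≤ k} ∧
      ∀ z ∈ prism, (supp z.2).card ≤ k → supp (alexander h k z).2 = supp z.2 ∧
        (alexander h k z).1 = z.1 ∧ (z.1 = 0 → alexander h k z = z) ∧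
        (z.1 = 1 → alexander h k z = (1, h z.2)) := by
  induction k with
  | zero =>
    have he : {z : ℝ × Vec | z ∈ prism ∧ (supp z.2).card ≤ 0} = ∅ := by
      ext z
      simp only [mem_ofPred_eq, mem_empty_iff_false, iff_false, not_and, not_le]
      exact fun hz => (supp_nonempty hz.2).card_pos
    refine ⟨he ▸ HomeoOn.id _, fun z hz hc => ?_⟩
    exact absurd hc (supp_nonempty hz.2).card_pos.not_ge
  | succ k ih =>
    obtain ⟨ih1, ih2⟩ := ih (by omega)
    set w : ℝ × Vec → ℝ × Vec := fun w => if w.1 = 1 then (1, h w.2) else alexander h k w with hw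
    set γ : Finset (Fin 4) → ℝ × Vec → ℝ × Vec := fun s => coneExt (0, bary s) (prismGauge s) w
      with hγdef
    set B : Finset (Fin 4) → Set (ℝ × Vec) := fun s =>
      {z | z ∈ {z : ℝ × Vec | 0 ≤ z.1 ∧ z.2 ∈ faceFlat s} ∧ prismGauge s z = 1} with hB
    have hsne : ∀ {s : Finset (Fin 4)}, s.card = k + 1 → s.Nonempty := fun hs =>
      Finset.card_pos.1 (by omega)
    have hBe : ∀ s : Finset (Fin 4), s.card = k + 1 →
        B s = {z | z.1 = 1 ∧ z.2 ∈ face s} ∪ {z | z.1 ∈ Icc (0 : ℝ) 1 ∧ z.2 ∈ faceBd s} := by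
      intro s hsc
      have hne := hsne hsc
      ext z
      simp only [hB, prismGauge, face_eq_gauge hne, faceBd_eq_gauge hne, mem_ofPred_eq, mem_union,
        mem_Icc]
      constructor
      · rintro ⟨⟨h0, h1⟩, h2⟩
        rcases max_choice z.1 (faceGauge s z.2) with e | e
        · left; rw [e] at h2; exact ⟨h2, h1, by rw [← e.trans h2]; exact le_max_right _ _⟩
        · right; rw [e] at h2; exact ⟨⟨h0, by rw [← e.trans h2]; exact le_max_left _ _⟩, h1, h2⟩
      · rintro (⟨h0, h1, h2⟩ | ⟨⟨h0, h1⟩, h2, h3⟩)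
        · exact ⟨⟨by rw [h0]; exact zero_le_one, h1⟩, by rw [h0]; exact max_eq_left h2⟩
        · exact ⟨⟨h0, h2⟩, by rw [h3]; exact max_eq_right h1⟩
    have hface : ∀ s : Finset (Fin 4), s.card = k + 1 →
        {z : ℝ × Vec | z ∈ prism ∧ supp z.2 ⊆ s} =
          {z | z ∈ {z : ℝ × Vec | 0 ≤ z.1 ∧ z.2 ∈ faceFlat s} ∧ prismGauge s z ≤ 1} := by
      intro s hsc
      have h1 := face_eq_gauge (hsne hsc)
      ext z
      have h2 : z.2 ∈ face s ↔ z.2 ∈ faceFlat s ∧ faceGauge s z.2 ≤ 1 := by rw [h1]; rfl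
      simp only [prismGauge, prism, mem_ofPred_eq, mem_Icc, max_le_iff]
      have h3 : z.2 ∈ face s ↔ z.2 ∈ simplex ∧ supp z.2 ⊆ s := Iff.rfl
      tauto
    have hhs : ∀ s, HomeoOn h (face s) := fun s => hh.restrict_sub (fun x hx => hx.1) fun x hx => by
      simp only [face, mem_ofPred_eq, hs x hx, hh.mem hx, hx]
    have hbd : ∀ s : Finset (Fin 4), s.card = k + 1 → ∀ z : ℝ × Vec, z.1 ∈ Icc (0 : ℝ) 1 →
        z.2 ∈ faceBd s → z ∈ prism ∧ (supp z.2).card ≤ k := by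
      intro s hsc z h1 h2
      rw [← face_inter_skel hsc] at h2
      exact ⟨⟨h1, h2.1.1⟩, h2.1.2⟩
    have wtop : ∀ z : ℝ × Vec, z.1 = 1 → w z = (1, h z.2) := fun z hz => if_pos hz
    have wbd : ∀ s : Finset (Fin 4), s.card = k + 1 → ∀ z : ℝ × Vec, z.1 ∈ Icc (0 : ℝ) 1 →
        z.2 ∈ faceBd s → w z = alexander h k z := by
      intro s hsc z h1 h2
      obtain ⟨h3, h4⟩ := hbd s hsc z h1 h2
      by_cases h5 : z.1 = 1
      · rw [wtop z h5, ((ih2 z h3 h4).2.2.2 h5)]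
      · exact if_neg h5
    have hwB : ∀ s : Finset (Fin 4), s.card = k + 1 → HomeoOn w (B s) := by
      intro s hsc
      rw [hBe s hsc]
      have t1 : HomeoOn (fun z : ℝ × Vec => ((1 : ℝ), h z.2)) {z | z.1 = 1 ∧ z.2 ∈ face s} := by
        refine ⟨?_, ?_, ?_, ?_⟩
        · exact continuousOn_const.prodMk ((hhs s).cont.comp continuousOn_snd fun z hz => hz.2)
        · exact fun z hz => ⟨rfl, (hhs s).mem hz.2⟩
        · rintro ⟨a, x⟩ hx ⟨b, y⟩ hy e
          obtain rfl : a = 1 := hx.1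
          obtain rfl : b = 1 := hy.1
          exact congrArg (Prod.mk 1) ((hhs s).inj hx.2 hy.2 (Prod.ext_iff.1 e).2)
        · rintro ⟨b, y⟩ hy
          obtain rfl : b = 1 := hy.1
          obtain ⟨x, hx, e⟩ := (hhs s).surj hy.2
          exact ⟨(1, x), ⟨rfl, hx⟩, congrArg (Prod.mk 1) e⟩
      have t2 : HomeoOn (alexander h k) {z | z.1 ∈ Icc (0 : ℝ) 1 ∧ z.2 ∈ faceBd s} := by
        refine ih1.restrict_sub (fun z hz => hbd s hsc z hz.1 hz.2) fun z hz => ?_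
        obtain ⟨e1, e2, -⟩ := ih2 z hz.1 hz.2
        simp only [mem_ofPred_eq, faceBd, e1, e2, (ih1.mem hz).1.2, hz.1.2]
      refine t1.union t2 ?_ ?_ ?_ ?_ (fun z hz => wtop z hz.1) fun z hz => wbd s hsc z hz.1 hz.2
      · exact (isClosed_eq continuous_fst continuous_const).inter
          ((isClosed_face s).preimage continuous_snd)
      · exact (isClosed_Icc.preimage continuous_fst).inter
          ((isClosed_faceBd s).preimage continuous_snd)
      · rintro z ⟨h1, h2⟩
        show (1, h z.2) = alexander h k z
        rw [← wtop z h1.1, wbd s hsc z h2.1 h2.2]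
      · rintro ⟨b, y⟩ ⟨h1, h2⟩
        obtain rfl : b = 1 := h1.1
        obtain ⟨x, hx, rfl⟩ := (hhs s).surj h1.2
        refine ⟨(1, x), ⟨⟨rfl, hx⟩, h2.1, hx.1, ?_⟩, rfl⟩
        have := h2.2.2
        rwa [hs x hx.1] at this
    have hγ : ∀ s : Finset (Fin 4), s.card = k + 1 →
        HomeoOn (γ s) {z : ℝ × Vec | z ∈ prism ∧ supp z.2 ⊆ s} := by
      intro s hsc
      have H := isConeGauge_prism (hsne hsc)
      rw [hface s hsc]
      refine H.homeoOn ?_ (hwB s hsc)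
      refine (((isCompact_Icc (a := (0 : ℝ)) (b := 1)).prod (isCompact_face s)).isBounded).subset ?_
      intro z hz
      rw [show {z | z ∈ {z : ℝ × Vec | 0 ≤ z.1 ∧ z.2 ∈ faceFlat s} ∧ prismGauge s z = 1} = B s from rfl,
        hBe s hsc] at hz
      rcases hz with hz | hz
      · exact ⟨by rw [hz.1]; simp, hz.2⟩
      · exact ⟨hz.1, hz.2.1, hz.2.2.subset⟩
    have hwfst : ∀ s : Finset (Fin 4), s.card = k + 1 → ∀ z ∈ B s, (w z).1 = z.1 := by
      intro s hsc z hz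
      rw [hBe s hsc] at hz
      rcases hz with hz | hz
      · rw [wtop z hz.1, hz.1]
      · obtain ⟨h3, h4⟩ := hbd s hsc z hz.1 hz.2
        rw [wbd s hsc z hz.1 hz.2, (ih2 z h3 h4).2.1]
    have hγtop : ∀ s : Finset (Fin 4), s.card = k + 1 → ∀ z ∈ prism, supp z.2 ⊆ s → z.1 = 1 →
        γ s z = (1, h z.2) := by
      intro s hsc z hz hzs h1
      have : z ∈ B s := by rw [hBe s hsc]; exact Or.inl ⟨h1, hz.2, hzs⟩
      rw [← wtop z h1]
      exact IsConeGauge.coneExt_eq z this.2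
    have hγray : ∀ s : Finset (Fin 4), s.card = k + 1 → ∀ z ∈ prism, supp z.2 ⊆ s →
        γ s z = z ∨ ∃ y ∈ B s, ∃ r : ℝ, 0 < r ∧ r ≤ 1 ∧ (r = 1 → z = y) ∧
          z = (0, bary s) + r • (y - (0, bary s)) ∧ γ s z = (0, bary s) + r • (w y - (0, bary s)) := by
      intro s hsc z hz hzs
      have H := isConeGauge_prism (hsne hsc)
      have hz' : z ∈ {z : ℝ × Vec | z ∈ prism ∧ supp z.2 ⊆ s} := ⟨hz, hzs⟩
      rw [hface s hsc] at hz'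
      by_cases hc : z = (0, bary s)
      · left; rw [hc]; exact H.coneExt_apex hz'.1
      · obtain ⟨y, hy, hy1, hp, e1, e2⟩ := H.exists_ray hz'.1 hc
        refine Or.inr ⟨y, ⟨hy, hy1⟩, _, hp, hz'.2, fun h1 => ?_, e1, e2 w⟩
        rw [h1] at e1
        rw [e1]; simp
    have hγfst : ∀ s : Finset (Fin 4), s.card = k + 1 → ∀ z ∈ prism, supp z.2 ⊆ s →
        (γ s z).1 = z.1 := by
      intro s hsc z hz hzs
      rcases hγray s hsc z hz hzs with e | ⟨y, hy, r, hr, -, -, e1, e2⟩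
      · rw [e]
      · rw [e2, e1]
        simp [hwfst s hsc y hy]
    have hγzero : ∀ s : Finset (Fin 4), s.card = k + 1 → ∀ z ∈ prism, supp z.2 ⊆ s → z.1 = 0 →
        γ s z = z := by
      intro s hsc z hz hzs h0
      rcases hγray s hsc z hz hzs with e | ⟨y, hy, r, hr, -, -, e1, e2⟩
      · exact e
      · have hy0 : y.1 = 0 := by
          have := congrArg Prod.fst e1
          simp only [h0, Prod.fst_add, Prod.smul_fst, Prod.fst_sub, sub_zero, zero_add,
            smul_eq_mul] at this
          exact (mul_eq_zero.1 this.symm).resolve_left hr.ne'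
        have hy' := hy
        rw [hBe s hsc] at hy'
        rcases hy' with hy' | hy'
        · exact absurd (hy'.1.symm.trans hy0) one_ne_zero
        · obtain ⟨h3, h4⟩ := hbd s hsc y hy'.1 hy'.2
          rw [e2, wbd s hsc y hy'.1 hy'.2, (ih2 y h3 h4).2.2.1 hy0, ← e1]
    have hγbd : ∀ s : Finset (Fin 4), s.card = k + 1 → ∀ z ∈ prism, supp z.2 ⊂ s →
        γ s z = alexander h k z := by
      intro s hsc z hz hzs
      rw [← wbd s hsc z hz.1 ⟨hz.2, hzs⟩]
      have : z ∈ B s := by rw [hBe s hsc]; exact Or.inr ⟨hz.1, hz.2, hzs⟩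
      exact IsConeGauge.coneExt_eq z this.2
    have hγσ : ∀ s : Finset (Fin 4), s.card = k + 1 → ∀ z ∈ prism, supp z.2 ⊆ s →
        supp (γ s z).2 = supp z.2 := by
      intro s hsc z hz hzs
      rcases hzs.eq_or_ssubset with hzs' | hzs'
      · by_cases h1 : z.1 = 1
        · rw [hγtop s hsc z hz hzs h1]; exact hs _ hz.2
        · have hm := ((hγ s hsc).mem ⟨hz, hzs⟩)
          rw [hzs']
          refine hm.2.antisymm ?_
          rcases hγray s hsc z hz hzs with e | ⟨y, hy, r, hr, hr1, hr2, e1, e2⟩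
          · rw [e, hzs']
          · rcases hr1.eq_or_lt with hr1 | hr1
            · have hzB : z ∈ B s := by rw [hr2 hr1]; exact hy
              rw [hBe s hsc] at hzB
              rcases hzB with hzB | hzB
              · exact absurd hzB.1 h1
              · exact absurd hzs' hzB.2.2.ne
            -- Strictly before the end of the ray, the barycentre contributes a positive amount to
            -- every coordinate in `s`.
            · intro i hi
              rw [mem_supp, e2]
              have hwy := ((hwB s hsc).mem hy)
              rw [hBe s hsc] at hwy
              have h0 : 0 ≤ (w y).2 i := by
                rcases hwy with hwy | hwy
                · exact hwy.2.1.1 i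
                · exact hwy.2.1.1 i
              have hb : 0 < bary s i := forall_faceCoords.1 (bary_mem (hsne hsc)).2 i hi
              have : 0 < bary s i + r * ((w y).2 i - bary s i) := by nlinarith
              simpa using this.ne'
      · rw [hγbd s hsc z hz hzs']
        have := Finset.card_lt_card hzs'
        exact (ih2 z hz (by omega)).1
    obtain ⟨r1, r2, -⟩ := HomeoOn.skeleton_ext (σ := fun z : ℝ × Vec => supp z.2) (Z := prism)
      (k := k) (by omega) isClosed_prism_face (G := alexander h (k + 1)) ih1
      (fun z hz hc => (ih2 z hz hc).1) hγ hγσ hγbd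
      (fun z hz hc => by simp only [alexander, if_pos hc])
      (fun z hz hc => by
        rw [alexander, if_neg (by omega)])
    refine ⟨r1, fun z hz hc => ⟨r2 z hz hc, ?_⟩⟩
    rcases Nat.le_succ_iff.1 hc with hc' | hc'
    · rw [show alexander h (k + 1) z = alexander h k z by simp only [alexander, if_pos hc']]
      exact (ih2 z hz hc').2
    · rw [show alexander h (k + 1) z = γ (supp z.2) z by rw [alexander, if_neg (by omega)]]
      exact ⟨hγfst _ hc' z hz subset_rfl, hγzero _ hc' z hz subset_rfl,
        hγtop _ hc' z hz subset_rfl⟩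

/-! ### Naturality under relabelling of the vertices -/

/-- Relabelling of the vertices. -/
def relabel (p : Equiv.Perm (Fin 4)) (x : Vec) : Vec := fun i => x (p.symm i)

theorem relabel_apply (p : Equiv.Perm (Fin 4)) (x : Vec) (v : Fin 4) : relabel p x (p v) = x v := by
  simp [relabel]

theorem relabel_symm_relabel (p : Equiv.Perm (Fin 4)) (x : Vec) :
    relabel p.symm (relabel p x) = x := by
  funext i; simp [relabel]

theorem relabel_relabel_symm (p : Equiv.Perm (Fin 4)) (x : Vec) :
    relabel p (relabel p.symm x) = x := by
  funext i; simp [relabel]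

theorem continuous_relabel (p : Equiv.Perm (Fin 4)) : Continuous (relabel p) :=
  continuous_pi fun _ => continuous_apply _

theorem relabel_mem_simplex {p : Equiv.Perm (Fin 4)} {x : Vec} (hx : x ∈ simplex) :
    relabel p x ∈ simplex :=
  ⟨fun _ => hx.1 _, (Equiv.sum_comp p.symm x).trans hx.2⟩

theorem supp_relabel (p : Equiv.Perm (Fin 4)) (x : Vec) :
    supp (relabel p x) = (supp x).map p.toEmbedding := by
  ext i
  simp only [mem_supp, Finset.mem_map_equiv, relabel]

theorem bary_map (p : Equiv.Perm (Fin 4)) (s : Finset (Fin 4)) :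
    bary (s.map p.toEmbedding) = relabel p (bary s) := by
  funext i
  simp only [bary, relabel, Finset.mem_map_equiv, Finset.card_map]

theorem faceGauge_map (p : Equiv.Perm (Fin 4)) (s : Finset (Fin 4)) (x : Vec) :
    faceGauge (s.map p.toEmbedding) (relabel p x) = faceGauge s x := by
  unfold faceGauge
  rw [← Equiv.iSup_comp (g := fun i => if i ∈ s.map p.toEmbedding then
    max (1 - (s.map p.toEmbedding).card * relabel p x i) 0 else 0) p]
  simp only [relabel_apply, Finset.card_map, Finset.mem_map_equiv, Equiv.symm_apply_apply]

/-- The barycentres and gauges used for coning are invariant under relabelling. It suffices to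
compare `h` and `h'` on the face opposite `f`, because the recursion at a point never leaves the
smallest face that contains it. -/
theorem alexander_relabel {h h' : Vec → Vec} {p : Equiv.Perm (Fin 4)} {f : Fin 4}
    (hhh : ∀ x ∈ simplex, x f = 0 → h' (relabel p x) = relabel p (h x))
    (k : ℕ) (hk : k ≤ 4) : ∀ t ∈ Icc (0 : ℝ) 1, ∀ x ∈ simplex, x f = 0 → (supp x).card ≤ k →
      alexander h' k (t, relabel p x) =
        ((alexander h k (t, x)).1, relabel p (alexander h k (t, x)).2) := by
  induction k with
  | zero => intros; rfl
  | succ k ih =>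
    intro t ht x hx hxf hc
    have hcard : (supp (relabel p x)).card = (supp x).card := by rw [supp_relabel, Finset.card_map]
    rcases Nat.le_succ_iff.1 hc with hc' | hc'
    · simp only [alexander, hcard, if_pos hc']
      exact ih (by omega) t ht x hx hxf hc'
    · simp only [alexander, hcard, if_neg (by omega : ¬ (supp x).card ≤ k)]
      have hne := supp_nonempty hx
      have H := isConeGauge_prism hne
      have hz : ((t, x) : ℝ × Vec) ∈ {z : ℝ × Vec | 0 ≤ z.1 ∧ z.2 ∈ faceFlat (supp x)} :=
        ⟨ht.1, hx.2, fun i hi => by simpa [mem_supp] using hi⟩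
      have hg : prismGauge (supp (relabel p x)) (t, relabel p x) = prismGauge (supp x) (t, x) := by
        rw [supp_relabel]
        simp only [prismGauge, faceGauge_map]
      simp only [coneExt, hg]
      have hb : bary (supp (relabel p x)) = relabel p (bary (supp x)) := by
        rw [supp_relabel, bary_map]
      rw [hb]
      set r := prismGauge (supp x) (t, x) with hr
      set b := bary (supp x)
      by_cases hc : ((t, x) : ℝ × Vec) = (0, b)
      · have hr0 : r = 0 := by rw [hr, hc]; exact H.self hz
        simp [hr0]
      obtain ⟨y, hy, hy1, hp, -, -⟩ := H.exists_ray hz hc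
      have hyd : ((0, b) : ℝ × Vec) + r⁻¹ • ((t, x) - (0, b)) =
          (r⁻¹ * t, b + r⁻¹ • (x - b)) := by
        ext <;> simp
      have hyd' : ((0, relabel p b) : ℝ × Vec) + r⁻¹ • ((t, relabel p x) - (0, relabel p b)) =
          (r⁻¹ * t, relabel p (b + r⁻¹ • (x - b))) := by
        ext <;> simp [relabel]
      have hmemB : (r⁻¹ * t, b + r⁻¹ • (x - b)) ∈ {z : ℝ × Vec | 0 ≤ z.1 ∧ z.2 ∈ faceFlat (supp x)} ∧
          prismGauge (supp x) (r⁻¹ * t, b + r⁻¹ • (x - b)) = 1 := by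
        rw [← hyd]
        refine ⟨H.cone _ hz _ (inv_pos.2 hp).le, ?_⟩
        rw [H.homog _ hz _ (inv_pos.2 hp).le]
        exact inv_mul_cancel₀ hp.ne'
      set y' := b + r⁻¹ • (x - b)
      set t' := r⁻¹ * t
      have hf : ∀ i ∉ supp x, y' i = 0 := hmemB.1.2.2
      have hyf : y' f = 0 := hf f (by simp [mem_supp, hxf])
      have hgl : faceGauge (supp x) y' ≤ 1 := by rw [← hmemB.2]; exact le_max_right _ _
      have hyface : y' ∈ face (supp x) := by rw [face_eq_gauge hne]; exact ⟨hmemB.1.2, hgl⟩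
      have ht'1 : t' ≤ 1 := by rw [← hmemB.2]; exact le_max_left _ _
      have key : (if t' = 1 then ((1 : ℝ), h' (relabel p y')) else alexander h' k (t', relabel p y')) =
          ((if t' = 1 then ((1 : ℝ), h y') else alexander h k (t', y')).1,
            relabel p (if t' = 1 then ((1 : ℝ), h y') else alexander h k (t', y')).2) := by
        by_cases h1 : t' = 1
        · simp only [if_pos h1, hhh y' hyface.1 hyf]
        · simp only [if_neg h1]
          refine ih (by omega) t' ⟨hmemB.1.1, ht'1⟩ y' hyface.1 hyf ?_
          -- A point of the level set that is not on the top lies on a side, hence over a face with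
          -- fewer vertices.
          have hg1 : faceGauge (supp x) y' = 1 := by
            rcases max_choice t' (faceGauge (supp x) y') with e | e
            · exact absurd (e.symm.trans hmemB.2) h1
            · exact e.symm.trans hmemB.2
          have : y' ∈ faceBd (supp x) := by rw [faceBd_eq_gauge hne]; exact ⟨hmemB.1.2, hg1⟩
          have := Finset.card_lt_card this.2
          omega
      rw [hyd, hyd']
      rw [key]
      ext <;> simp [relabel]

/-! ### Homeomorphisms of the tetrahedron -/

theorem HomeoOn.exists_tetra {h : Vec → Vec} (hh : HomeoOn h simplex) :
    ∃ e : Tetra ≃ₜ Tetra, ∀ x, (e x).1 = h x.1 := by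
  let f : Tetra → Tetra := fun x => ⟨h x.1, hh.mem x.2⟩
  have hf : Continuous f :=
    Continuous.subtype_mk (continuousOn_iff_continuous_domRestrict.1 hh.cont) _
  have hb : Function.Bijective f := by
    constructor
    · intro x y e
      exact Subtype.ext (hh.inj x.2 y.2 (congrArg Subtype.val e))
    · intro y
      obtain ⟨x, hx, e⟩ := hh.surj y.2
      exact ⟨⟨x, hx⟩, Subtype.ext e⟩
  have : CompactSpace Tetra := isCompact_iff_compactSpace.1 isCompact_simplex
  exact ⟨Continuous.homeoOfEquivCompactToT2 (f := Equiv.ofBijective f hb) hf, fun x => rfl⟩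

theorem Homeomorph.exists_homeoOn (e : Tetra ≃ₜ Tetra) :
    ∃ h : Vec → Vec, HomeoOn h simplex ∧ ∀ x : Tetra, h x.1 = (e x).1 := by
  classical
  refine ⟨fun x => if hx : x ∈ simplex then (e ⟨x, hx⟩).1 else x, ?_, fun x => dif_pos x.2⟩
  have key : ∀ x (hx : x ∈ simplex), (if hx : x ∈ simplex then (e ⟨x, hx⟩).1 else x) = (e ⟨x, hx⟩).1 :=
    fun x hx => dif_pos hx
  refine ⟨?_, ?_, ?_, ?_⟩
  · rw [continuousOn_iff_continuous_domRestrict]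
    have : simplex.domRestrict (fun x => if hx : x ∈ simplex then (e ⟨x, hx⟩).1 else x) =
        fun x => (e x).1 := by
      funext x; exact key x.1 x.2
    rw [this]
    exact continuous_subtype_val.comp e.continuous
  · intro x hx; simp only [key x hx]; exact (e ⟨x, hx⟩).2
  · intro x hx y hy hxy
    simp only [key x hx, key y hy] at hxy
    exact congrArg Subtype.val (e.injective (Subtype.ext hxy))
  · intro y hy
    refine ⟨(e.symm ⟨y, hy⟩).1, (e.symm ⟨y, hy⟩).2, ?_⟩
    simp only [key _ (e.symm ⟨y, hy⟩).2]
    simp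

theorem facePreserving_iff {e : Tetra ≃ₜ Tetra} {h : Vec → Vec} (he : ∀ x, (e x).1 = h x.1) :
    FacePreserving e ↔ SuppPres h simplex := by
  constructor
  · intro H x hx
    refine supp_eq_supp.2 fun i => ?_
    rw [← he ⟨x, hx⟩]; exact H ⟨x, hx⟩ i
  · intro H x i
    have := supp_eq_supp.1 (H x.1 x.2) i
    rwa [← he] at this

theorem FacePreserving.symm {e : Tetra ≃ₜ Tetra} (h : FacePreserving e) : FacePreserving e.symm :=
  fun x f => by rw [← h (e.symm x) f, e.apply_symm_apply]

theorem FacePreserving.trans {e e' : Tetra ≃ₜ Tetra} (h : FacePreserving e)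
    (h' : FacePreserving e') : FacePreserving (e.trans e') :=
  fun x f => (h' (e x) f).trans (h x f)

/-! ### Homeomorphisms of a triangulation -/

namespace Triangulation

variable {n : ℕ} (T : Triangulation n)

/-- A family of maps of the tetrahedra that is compatible with the face gluings. -/
def Compat (h : Fin n → Vec → Vec) : Prop :=
  ∀ t f u p, T.glue t f = some (u, p) → ∀ x ∈ simplex, x f = 0 →
    h u (relabel p x) = relabel p (h t x)

variable {T}

theorem glueRel_iff {P Q : Fin n × Tetra} : T.GlueRel P Q ↔ ∃ f p, T.glue P.1 f = some (Q.1, p) ∧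
    P.2.1 f = 0 ∧ Q.2.1 = relabel p P.2.1 := by
  refine exists_congr fun f => exists_congr fun p => and_congr_right fun _ => and_congr_right fun _ => ?_
  constructor
  · intro h
    funext i
    have := h (p.symm i)
    rw [p.apply_symm_apply] at this
    exact this
  · intro h v
    show Q.2.1 (p v) = _
    rw [h, relabel_apply]; rfl

theorem glueRel_symm {P Q : Fin n × Tetra} (h : T.GlueRel P Q) : T.GlueRel Q P := by
  rw [glueRel_iff] at h ⊢
  obtain ⟨f, p, h1, h2, h3⟩ := h
  exact ⟨p f, p.symm, T.glue_symm _ _ _ _ h1, by rw [h3, relabel_apply, h2],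
    by rw [h3, relabel_symm_relabel]⟩

theorem char_eq_of_glue {t u : Fin n} {f : Fin 4} {p : Equiv.Perm (Fin 4)}
    (h : T.glue t f = some (u, p)) (x y : Tetra) (hx : x.1 f = 0) (hy : y.1 = relabel p x.1) :
    T.char t x = T.char u y :=
  Quot.sound (glueRel_iff.2 ⟨f, p, h, hx, hy⟩)

theorem exists_space_homeo (e : Fin n → Tetra ≃ₜ Tetra)
    (h1 : ∀ P Q, T.GlueRel P Q → T.GlueRel (P.1, e P.1 P.2) (Q.1, e Q.1 Q.2))
    (h2 : ∀ P Q, T.GlueRel P Q → T.GlueRel (P.1, (e P.1).symm P.2) (Q.1, (e Q.1).symm Q.2)) :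
    ∃ φ : T.Space ≃ₜ T.Space, ∀ t x, φ (T.char t x) = T.char t (e t x) := by
  have hc : ∀ e : Fin n → Tetra ≃ₜ Tetra, Continuous fun P : Fin n × Tetra => (P.1, e P.1 P.2) := by
    intro e
    exact continuous_prod_of_discrete_left.2 fun t =>
      continuous_const.prodMk (e t).continuous
  refine ⟨{
    toFun := Quot.map (fun P => (P.1, e P.1 P.2)) h1
    invFun := Quot.map (fun P => (P.1, (e P.1).symm P.2)) h2
    left_inv := ?_
    right_inv := ?_
    continuous_toFun := ?_
    continuous_invFun := ?_ }, fun t x => rfl⟩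
  · rintro ⟨P⟩
    simp [Quot.map]
  · rintro ⟨P⟩
    simp [Quot.map]
  · exact continuous_quot_lift _ (continuous_quot_mk.comp (hc e))
  · exact continuous_quot_lift _ (continuous_quot_mk.comp (hc fun t => (e t).symm))

theorem Compat.glueRel {h : Fin n → Vec → Vec} (hc : T.Compat h)
    (hs : ∀ t, SuppPres (h t) simplex) {e : Fin n → Tetra ≃ₜ Tetra}
    (he : ∀ t x, (e t x).1 = h t x.1) :
    (∀ P Q, T.GlueRel P Q → T.GlueRel (P.1, e P.1 P.2) (Q.1, e Q.1 Q.2)) ∧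
      ∀ P Q, T.GlueRel P Q → T.GlueRel (P.1, (e P.1).symm P.2) (Q.1, (e Q.1).symm Q.2) := by
  have hfp : ∀ t, FacePreserving (e t) := fun t => (facePreserving_iff (he t)).2 (hs t)
  constructor
  · rintro P Q h
    rw [glueRel_iff] at h ⊢
    obtain ⟨f, p, h1, h2, h3⟩ := h
    refine ⟨f, p, h1, (hfp _ _ _).2 h2, ?_⟩
    simp only [he]
    rw [h3, hc _ _ _ _ h1 _ P.2.2 h2]
  · rintro P Q h
    rw [glueRel_iff] at h ⊢
    obtain ⟨f, p, h1, h2, h3⟩ := h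
    have h4 : ((e P.1).symm P.2).1 f = 0 := ((hfp _).symm _ _).2 h2
    refine ⟨f, p, h1, h4, ?_⟩
    have h5 := hc _ _ _ _ h1 _ ((e P.1).symm P.2).2 h4
    rw [← he P.1, Homeomorph.apply_symm_apply, ← h3] at h5
    have h6 : e Q.1 ⟨relabel p ((e P.1).symm P.2).1, relabel_mem_simplex ((e P.1).symm P.2).2⟩ = Q.2 :=
      Subtype.ext ((he _ _).trans h5)
    simp only
    rw [← h6, Homeomorph.symm_apply_apply]

theorem Compat.alexander {h : Fin n → Vec → Vec} (hc : T.Compat h) {t : ℝ} (ht : t ∈ Icc (0 : ℝ) 1) :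
    T.Compat fun i x => (alexander (h i) 4 (t, x)).2 := by
  intro i f u p hg x hx hxf
  simp only
  rw [alexander_relabel (fun y hy hyf => hc i f u p hg y hy hyf) 4 le_rfl t ht x hx hxf
    ((Finset.card_le_univ _).trans (by simp))]

/-- Because the map of the prism preserves height, each of its horizontal slices is a homeomorphism.
-/
theorem alexander_slice {h : Vec → Vec} (hh : HomeoOn h simplex) (hs : SuppPres h simplex) {t : ℝ}
    (ht : t ∈ Icc (0 : ℝ) 1) : HomeoOn (fun x => (_root_.alexander h 4 (t, x)).2) simplex ∧
      SuppPres (fun x => (_root_.alexander h 4 (t, x)).2) simplex := by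
  obtain ⟨h1, h2⟩ := alexander_spec hh hs 4 le_rfl
  have h4 : ∀ x : Vec, (supp x).card ≤ 4 := fun x => (Finset.card_le_univ _).trans (by simp)
  have hm : ∀ x ∈ simplex, (t, x) ∈ {z : ℝ × Vec | z ∈ prism ∧ (supp z.2).card ≤ 4} := fun x hx =>
    ⟨⟨ht, hx⟩, h4 x⟩
  refine ⟨⟨?_, ?_, ?_, ?_⟩, fun x hx => (h2 (t, x) ⟨ht, hx⟩ (h4 x)).1⟩
  · exact continuous_snd.comp_continuousOn (h1.cont.comp (by fun_prop) hm)
  · exact fun x hx => (h1.mem (hm x hx)).1.2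
  · intro x hx y hy e
    have : _root_.alexander h 4 (t, x) = _root_.alexander h 4 (t, y) := by
      refine Prod.ext ?_ e
      rw [(h2 (t, x) ⟨ht, hx⟩ (h4 x)).2.1, (h2 (t, y) ⟨ht, hy⟩ (h4 y)).2.1]
    exact congrArg Prod.snd (h1.inj (hm x hx) (hm y hy) this)
  · intro y hy
    obtain ⟨⟨t', x⟩, hx, e⟩ := h1.surj (hm y hy)
    have h3 := (h2 (t', x) hx.1 hx.2).2.1
    rw [e] at h3
    obtain rfl : t = t' := h3
    exact ⟨x, hx.1.2, by simp only [e]⟩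

/-- The Alexander isotopy joins each `h t` to the identity. By naturality these isotopies agree on
glued faces at every time, so they descend to the quotient space. -/
theorem normalIsotopic_of_compat {h : Fin n → Vec → Vec} (hh : ∀ t, HomeoOn (h t) simplex)
    (hs : ∀ t, SuppPres (h t) simplex) (hc : T.Compat h) {S S' : Set T.Space}
    (hS : ∀ t, ∀ x y : Tetra, y.1 = h t x.1 → (T.char t x ∈ S ↔ T.char t y ∈ S')) :
    T.NormalIsotopic S S' := by
  have hsl : ∀ (s : unitInterval) (t : Fin n), _ := fun s t =>
    alexander_slice (hh t) (hs t) (t := s.1) s.2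
  choose e he using fun (s : unitInterval) (t : Fin n) => (hsl s t).1.exists_tetra
  have hgl := fun s : unitInterval =>
    (hc.alexander (t := s.1) s.2).glueRel (fun t => (hsl s t).2) (he s)
  choose H hH using fun s : unitInterval => exists_space_homeo (e s) (hgl s).1 (hgl s).2
  have h4 : ∀ x : Vec, (supp x).card ≤ 4 := fun x => (Finset.card_le_univ _).trans (by simp)
  have hF : Continuous fun P : (Fin n × Tetra) × unitInterval => H P.2 (Quot.mk _ P.1) := by
    have h1 : Continuous fun P : Fin n × (Tetra × unitInterval) => (P.1, e P.2.2 P.1 P.2.1) := by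
      refine continuous_prod_of_discrete_left.2 fun t => ?_
      refine continuous_const.prodMk (Continuous.subtype_mk (f := fun Q : Tetra × unitInterval =>
        (e Q.2 t Q.1).1) ?_ _)
      simp only [he]
      refine continuous_snd.comp ((alexander_spec (hh t) (hs t) 4 le_rfl).1.cont.comp_continuous
        (by fun_prop) fun Q => ⟨⟨Q.2.2, Q.1.2⟩, h4 _⟩)
    have h2 : Continuous fun P : (Fin n × Tetra) × unitInterval =>
        (Quot.mk T.GlueRel (P.1.1, e P.2 P.1.1 P.1.2) : T.Space) :=
      continuous_quot_mk.comp (h1.comp (g := fun P : Fin n × (Tetra × unitInterval) => (P.1, e P.2.2 P.1 P.2.1))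
        (f := fun P : (Fin n × Tetra) × unitInterval => (P.1.1, (P.1.2, P.2))) (by fun_prop))
    exact h2.congr fun P => (hH P.2 P.1.1 P.1.2).symm
  refine ⟨H, ?_, ?_, ?_, ?_⟩
  -- Joint continuity is obtained by currying: the map into the space of paths descends to the
  -- quotient, and evaluation of paths is continuous because the interval is locally compact.
  · let G : T.Space → C(unitInterval, T.Space) := Quot.lift
      (fun P => ⟨fun s => H s (Quot.mk _ P), hF.comp (by fun_prop : Continuous fun s => (P, s))⟩)
      (fun P Q hPQ => by ext s; exact congrArg (H s) (Quot.sound hPQ))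
    have hG : Continuous G := by
      refine continuous_quot_lift _ ?_
      exact (ContinuousMap.curry ⟨_, hF⟩).continuous
    have hGe : ∀ P : unitInterval × T.Space, G P.2 P.1 = H P.1 P.2 := by
      rintro ⟨s, ⟨P⟩⟩; rfl
    refine Continuous.congr ?_ hGe
    exact (hG.comp continuous_snd).eval continuous_fst
  · intro s t
    exact ⟨e s t, (facePreserving_iff (he s t)).2 (hsl s t).2, hH s t⟩
  · ext x
    obtain ⟨⟨t, x⟩⟩ := x
    show H 0 (T.char t x) = _
    rw [hH]
    have : e 0 t x = x := by
      refine Subtype.ext ?_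
      rw [he]
      have := ((alexander_spec (hh t) (hs t) 4 le_rfl).2 (0, x.1) ⟨by simp, x.2⟩ (h4 _)).2.2.1 rfl
      exact congrArg Prod.snd this
    rw [this]; rfl
  · have key : ∀ t x, T.char t x ∈ S ↔ H 1 (T.char t x) ∈ S' := by
      intro t x
      rw [hH]
      refine hS t x _ ?_
      rw [he]
      have := ((alexander_spec (hh t) (hs t) 4 le_rfl).2 (1, x.1) ⟨by simp, x.2⟩ (h4 _)).2.2.2 rfl
      exact congrArg Prod.snd this
    ext y
    constructor
    · rintro ⟨⟨⟨t, x⟩⟩, hx, rfl⟩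
      exact (key t x).1 hx
    · intro hy
      obtain ⟨⟨⟨t, x⟩⟩, rfl⟩ := (H 1).surjective y
      exact ⟨T.char t x, (key t x).2 hy, rfl⟩

end Triangulation

/-! ### Extension over the faces of the tetrahedron -/

theorem signPres_of_suppPres {g : Vec → Vec} {K : Set Vec} (hK : K ⊆ simplex)
    (hm : MapsTo g K simplex) (hs : SuppPres g K) (i : Fin 4) : SignPres (coord i) g K := by
  intro x hx
  have h1 := supp_eq_supp.1 (hs x hx) i
  have h2 := (hm hx).1 i
  have h3 := (hK hx).1 i
  simp only [coord, ContinuousLinearMap.proj_apply]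
  by_cases h : x i = 0
  · rw [h, h1.2 h]
  · rw [sign_pos (lt_of_le_of_ne h3 (Ne.symm h)),
      sign_pos (lt_of_le_of_ne h2 (Ne.symm fun h' => h (h1.1 h')))]

theorem suppPres_of_signPres {g : Vec → Vec} {K : Set Vec} {s : Finset (Fin 4)} (hK : K ⊆ face s)
    (hm : MapsTo g K (face s)) (h : ∀ ℓ ∈ faceCoords s, SignPres ℓ g K) : SuppPres g K := by
  intro x hx
  refine supp_eq_supp.2 fun i => ?_
  by_cases hi : i ∈ s
  · exact (forall_faceCoords.1 h i hi).eq_zero_iff hx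
  · rw [supp_subset.1 (hK hx).2 i hi, supp_subset.1 (hm hx).2 i hi]

theorem faceBd_subset_face (s : Finset (Fin 4)) : faceBd s ⊆ face s := fun _ hx => ⟨hx.1, hx.2.subset⟩

theorem exists_face_sign_ext {s : Finset (Fin 4)} (hs : s.Nonempty) (C : List (Vec →L[ℝ] ℝ))
    {g : Vec → Vec} (hg : HomeoOn g (faceBd s)) (hgs : SuppPres g (faceBd s))
    (hC : ∀ ℓ ∈ C, SignPres ℓ g (faceBd s)) :
    ∃ G, HomeoOn G (face s) ∧ EqOn G g (faceBd s) ∧ SuppPres G (face s) ∧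
      ∀ ℓ ∈ C, SignPres ℓ G (face s) := by
  have hL : ∀ ℓ ∈ faceCoords s, SignPres ℓ g (faceBd s) := forall_faceCoords.2 fun i _ =>
    signPres_of_suppPres (fun x hx => hx.1) (fun x hx => (hg.mem hx).1) hgs i
  rw [faceBd_eq_polyBd] at hg hC hL
  obtain ⟨G, h1, h2, h3, h4⟩ := HomeoOn.exists_sign_ext C _ _ g (isFlat_faceFlat s) (isBounded_face s)
    ⟨_, bary_mem hs⟩ hg hL hC
  rw [← face_eq_polytope] at h1 h3 h4
  rw [← faceBd_eq_polyBd] at h2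
  exact ⟨G, h1, h2, suppPres_of_signPres subset_rfl h1.bij.mapsTo h3, h4⟩

theorem exists_face_ext_eqOn {s : Finset (Fin 4)} (hs : s.Nonempty) {C : List (Vec →L[ℝ] ℝ)}
    {D : Set Vec} {g k : Vec → Vec} (hD : IsClosed D) (hDs : D ⊆ face s)
    (hg : HomeoOn g (faceBd s)) (hgs : SuppPres g (faceBd s))
    (hC : ∀ ℓ ∈ C, SignPres ℓ g (faceBd s)) (hk : HomeoOn k (face s)) (hkg : EqOn k g (faceBd s))
    (h1 : ∀ ℓ ∈ C, ∀ x ∈ D, 0 < ℓ x) (h2 : ∀ ℓ ∈ C, ∀ x ∈ D, 0 < ℓ (k x)) :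
    ∃ G, HomeoOn G (face s) ∧ EqOn G g (faceBd s) ∧ EqOn G k D ∧ SuppPres G (face s) ∧
      ∀ ℓ ∈ C, SignPres ℓ G (face s) := by
  have hL : ∀ ℓ ∈ faceCoords s, SignPres ℓ g (faceBd s) := forall_faceCoords.2 fun i _ =>
    signPres_of_suppPres (fun x hx => hx.1) (fun x hx => (hg.mem hx).1) hgs i
  have hc := isCompact_face s
  rw [faceBd_eq_polyBd] at hg hC hL hkg
  rw [face_eq_polytope] at hDs hk hc
  obtain ⟨G, r1, r2, r3, r4, r5⟩ := HomeoOn.exists_ext_eqOn (isFlat_faceFlat s) hc ⟨_, bary_mem hs⟩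
    hD hDs hg hL hC hk hkg h1 h2
  rw [← face_eq_polytope] at r1 r4 r5
  rw [← faceBd_eq_polyBd] at r2
  exact ⟨G, r1, r2, r3, suppPres_of_signPres subset_rfl r1.bij.mapsTo r4, r5⟩

/-- The `i`-th vertex. -/
noncomputable def vert (i : Fin 4) : Vec := Pi.single i 1

theorem vert_mem (i : Fin 4) : vert i ∈ simplex := single_mem_stdSimplex ℝ i

theorem supp_vert (i : Fin 4) : supp (vert i) = {i} := by
  ext j
  simp [mem_supp, vert, Pi.single_apply]

theorem eq_vert_of_supp {x : Vec} {i : Fin 4} (hx : x ∈ simplex) (h : supp x ⊆ {i}) : x = vert i := by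
  have h0 : ∀ j, j ≠ i → x j = 0 := fun j hj => supp_subset.1 h j (by simpa using hj)
  have h1 := hx.2
  rw [Finset.sum_eq_single i (fun j _ hj => h0 j hj) (by simp)] at h1
  funext j
  by_cases hj : j = i
  · subst hj; simp [vert, h1]
  · simp [vert, hj, h0 j hj]

theorem SuppPres.fix_vert {g : Vec → Vec} {K : Set Vec} (hs : SuppPres g K)
    (hm : MapsTo g K simplex) {i : Fin 4} (hi : vert i ∈ K) : g (vert i) = vert i :=
  eq_vert_of_supp (hm hi) (by rw [hs _ hi, supp_vert])

theorem skel_one_eq {x : Vec} (hx : x ∈ skel 1) : ∃ i, x = vert i := by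
  have h1 : (supp x).card = 1 := le_antisymm hx.2 (supp_nonempty hx.1).card_pos
  obtain ⟨i, hi⟩ := Finset.card_eq_one.1 h1
  exact ⟨i, eq_vert_of_supp hx.1 hi.subset⟩

/-- A map that fixes the vertices and preserves the zero set of `f` preserves the sign of `f` at
every point that can be joined to a vertex in the complement of the zero set. -/
theorem signPres_of_zero {g : Vec → Vec} {K : Set Vec} {f : Vec → ℝ} (hg : ContinuousOn g K)
    (hs : SuppPres g K) (hm : MapsTo g K K) (hK : K ⊆ simplex) (hf : Continuous f)
    (hz : ∀ x ∈ K, f (g x) = 0 ↔ f x = 0)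
    (hseg : ∀ x ∈ K, f x ≠ 0 → ∃ i, ∀ t ∈ Icc (0 : ℝ) 1,
      x + t • (vert i - x) ∈ K ∧ f (x + t • (vert i - x)) ≠ 0) : SignPres f g K := by
  have key : ∀ φ : ℝ → ℝ, ContinuousOn φ (Icc 0 1) → (∀ t ∈ Icc (0 : ℝ) 1, φ t ≠ 0) →
      SignType.sign (φ 0) = SignType.sign (φ 1) := by
    intro φ hφ h0
    have hp := isPreconnected_Icc.image φ hφ
    have m0 : φ 0 ∈ φ '' Icc 0 1 := ⟨0, by simp, rfl⟩
    have m1 : φ 1 ∈ φ '' Icc 0 1 := ⟨1, by simp, rfl⟩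
    have n0 : (0 : ℝ) ∉ φ '' Icc 0 1 := by rintro ⟨t, ht, e⟩; exact h0 t ht e
    rcases lt_or_gt_of_ne (h0 0 (by simp)) with a | a <;>
      rcases lt_or_gt_of_ne (h0 1 (by simp)) with b | b
    · rw [sign_neg a, sign_neg b]
    · exact absurd (hp.Icc_subset m0 m1 ⟨a.le, b.le⟩) n0
    · exact absurd (hp.Icc_subset m1 m0 ⟨b.le, a.le⟩) n0
    · rw [sign_pos a, sign_pos b]
  intro x hx
  by_cases h : f x = 0
  · rw [h, (hz x hx).2 h]
  -- Neither `f` nor its composite with `g` vanishes along the segment to the vertex. As `g` fixes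
  -- the vertex, both signs at `x` equal the sign there.
  · obtain ⟨i, hi⟩ := hseg x hx h
    have hc : Continuous fun t : ℝ => x + t • (vert i - x) := by fun_prop
    have e1 := key (fun t => f (x + t • (vert i - x))) (hf.comp hc).continuousOn fun t ht => (hi t ht).2
    have e2 := key (fun t => f (g (x + t • (vert i - x))))
      (hf.comp_continuousOn (hg.comp hc.continuousOn fun t ht => (hi t ht).1))
      fun t ht h' => (hi t ht).2 ((hz _ (hi t ht).1).1 h')
    have hv := (hi 1 (by simp)).1
    simp only [one_smul, add_sub_cancel] at hv
    simp only [zero_smul, add_zero, one_smul, add_sub_cancel,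
      hs.fix_vert (hm.mono_right hK) hv] at e1 e2
    rw [e2, e1]

theorem sum_smul_vert (x : Vec) : ∑ i, x i • vert i = x := by
  funext j
  simp [vert, Finset.sum_apply, Pi.single_apply]

/-- If a linear functional is negative at `x`, it is negative at some vertex of the smallest face
containing `x`, and so along the segment to that vertex; likewise for positive values. -/
theorem signPres_of_zero_linear {g : Vec → Vec} {K : Set Vec} {f : Vec →L[ℝ] ℝ}
    (hg : ContinuousOn g K) (hs : SuppPres g K) (hm : MapsTo g K K) (hK : K ⊆ simplex)
    (hfc : ∀ x ∈ K, face (supp x) ⊆ K) (hz : ∀ x ∈ K, f (g x) = 0 ↔ f x = 0) : SignPres f g K := by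
  refine signPres_of_zero hg hs hm hK f.continuous hz fun x hx hx0 => ?_
  have hxs : f x = ∑ i, x i * f (vert i) := by
    conv_lhs => rw [← sum_smul_vert x]
    simp
  have hseg : ∀ i ∈ supp x, ∀ t ∈ Icc (0 : ℝ) 1, x + t • (vert i - x) ∈ K := by
    intro i hi t ht
    refine hfc x hx ((convex_face _).add_smul_sub_mem ⟨hK hx, subset_rfl⟩ ⟨vert_mem i, ?_⟩ ht)
    rw [supp_vert]; simpa using hi
  rcases lt_or_gt_of_ne hx0 with h | h
  · obtain ⟨i, -, hi⟩ : ∃ i ∈ Finset.univ, x i * f (vert i) < 0 := by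
      by_contra hcon
      push Not at hcon
      exact absurd (Finset.sum_nonneg hcon) (by rw [← hxs]; exact not_le.2 h)
    have hxi := (hK hx).1 i
    have hi' : f (vert i) < 0 := by
      by_contra hcon
      exact absurd (mul_nonneg hxi (not_lt.1 hcon)) (not_le.2 hi)
    have his : i ∈ supp x := mem_supp.2 fun h0 => by rw [h0, zero_mul] at hi; exact lt_irrefl _ hi
    refine ⟨i, fun t ht => ⟨hseg i his t ht, ?_⟩⟩
    rw [map_line]
    have h1 := ht.1; have h2 := ht.2
    refine ne_of_lt ?_
    rcases h1.eq_or_lt with h1 | h1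
    · subst h1; simpa using h
    · nlinarith
  · obtain ⟨i, -, hi⟩ : ∃ i ∈ Finset.univ, 0 < x i * f (vert i) := by
      by_contra hcon
      push Not at hcon
      exact absurd (Finset.sum_nonpos hcon) (by rw [← hxs]; exact not_le.2 h)
    have hxi := (hK hx).1 i
    have hi' : 0 < f (vert i) := by
      by_contra hcon
      exact absurd (mul_nonpos_of_nonneg_of_nonpos hxi (not_lt.1 hcon)) (not_le.2 hi)
    have his : i ∈ supp x := mem_supp.2 fun h0 => by rw [h0, zero_mul] at hi; exact lt_irrefl _ hi
    refine ⟨i, fun t ht => ⟨hseg i his t ht, ?_⟩⟩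
    rw [map_line]
    have h1 := ht.1; have h2 := ht.2
    refine ne_of_gt ?_
    rcases h1.eq_or_lt with h1 | h1
    · subst h1; simpa using h
    · nlinarith

theorem HomeoOn.face {k : Vec → Vec} {K : Set Vec} (hk : HomeoOn k K) (hks : SuppPres k K)
    (hK : K ⊆ simplex) {P : Finset (Fin 4) → Prop} (hP : ∀ x ∈ simplex, P (supp x) → x ∈ K) :
    HomeoOn k {x | x ∈ simplex ∧ P (supp x)} :=
  hk.restrict_sub (fun x hx => hP x hx.1 hx.2) fun x hx => by
    simp only [mem_ofPred_eq, hks x hx, hK hx, hK (hk.mem hx)]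

theorem isCompact_faceBd (s : Finset (Fin 4)) : IsCompact (faceBd s) :=
  isCompact_simplex.of_isClosed_subset (isClosed_faceBd s) fun _ hx => hx.1

/-! ### Homeomorphisms with prescribed signs, built skeleton by skeleton. -/

/-- Gluing extensions over the `k`-dimensional faces. -/
theorem exists_skel_ext {k : ℕ} (hk : k < 4) {g : Vec → Vec} (hg : HomeoOn g (skel k))
    (hgs : SuppPres g (skel k)) {γ : Finset (Fin 4) → Vec → Vec}
    (hγ : ∀ s, s.card = k + 1 → HomeoOn (γ s) (face s) ∧ SuppPres (γ s) (face s) ∧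
      EqOn (γ s) g (faceBd s)) :
    ∃ G, HomeoOn G (skel (k + 1)) ∧ SuppPres G (skel (k + 1)) ∧ EqOn G g (skel k) ∧
      ∀ s, s.card = k + 1 → EqOn G (γ s) (face s) := by
  classical
  have h0 : ∀ x ∈ simplex, (supp x).card ≤ k →
      (if (supp x).card ≤ k then g x else γ (supp x) x) = g x := fun x _ hx => if_pos hx
  obtain ⟨h1, h2, h3⟩ := HomeoOn.skeleton_ext (σ := supp) (Z := simplex) (γ := γ) (g := g)
    (G := fun x => if (supp x).card ≤ k then g x else γ (supp x) x) hk isClosed_face hg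
    (fun x hx hc => hgs x ⟨hx, hc⟩) (fun s hs => (hγ s hs).1)
    (fun s hs x hx hxs => (hγ s hs).2.1 x ⟨hx, hxs⟩)
    (fun s hs x hx hxs => (hγ s hs).2.2 ⟨hx, hxs⟩) h0
    (fun x hx hc => if_neg (by omega))
  exact ⟨_, h1, fun x hx => h2 x hx.1 hx.2, fun x hx => h0 x hx.1 hx.2, h3⟩

/-- Every point of the `(k+1)`-skeleton lies on a face with `k+1` vertices. -/
theorem exists_face_of_skel {k : ℕ} (hk : k < 4) {x : Vec} (hx : x ∈ skel (k + 1)) :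
    ∃ s : Finset (Fin 4), s.card = k + 1 ∧ x ∈ face s := by
  obtain ⟨s, hs, hcard⟩ := Finset.exists_superset_card_eq hx.2 (by simpa using hk)
  exact ⟨s, hcard, hx.1, hs⟩

theorem faceBd_subset_skel {s : Finset (Fin 4)} {k : ℕ} (hs : s.card = k + 1) : faceBd s ⊆ skel k := by
  rw [← face_inter_skel hs]; exact inter_subset_left

theorem face_subset_skel {s : Finset (Fin 4)} {k : ℕ} (hs : s.card = k) : face s ⊆ skel k :=
  fun _ hx => ⟨hx.1, hs ▸ Finset.card_le_card hx.2⟩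

/-- One step of `exists_place`: extension over the faces with `k + 1` vertices. -/
theorem exists_place_step {k : ℕ} (hk4 : k < 4) {C : List (Vec →L[ℝ] ℝ)} {D D' : Set Vec}
    {κ g : Vec → Vec} (hD : IsClosed D)
    (hκ : HomeoOn κ simplex) (hκs : SuppPres κ simplex) (hκD : ∀ x ∈ simplex, κ x ∈ D' ↔ x ∈ D)
    (h1 : ∀ ℓ ∈ C, ∀ x ∈ D, 0 < ℓ x) (h2 : ∀ ℓ ∈ C, ∀ x ∈ D', 0 < ℓ x)
    (hg : HomeoOn g (skel k)) (hgs : SuppPres g (skel k)) (hgC : ∀ ℓ ∈ C, SignPres ℓ g (skel k))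
    {m : Finset (Fin 4) → Vec → Vec} (hm1 : ∀ s, s.card = k + 1 → HomeoOn (m s) (face s))
    (hm3 : ∀ s, s.card = k + 1 → ∀ x ∈ face s, m s x ∈ D' ↔ x ∈ D')
    (hm4 : ∀ s, s.card = k + 1 → ∀ x ∈ faceBd s, m s (κ x) = g x) :
    ∃ G, HomeoOn G (skel (k + 1)) ∧ SuppPres G (skel (k + 1)) ∧ EqOn G g (skel k) ∧
      (∀ ℓ ∈ C, SignPres ℓ G (skel (k + 1))) ∧ (∀ x ∈ skel (k + 1), G x ∈ D' ↔ x ∈ D) ∧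
      ∀ s : Finset (Fin 4), s.card = k + 1 → ∀ x ∈ face s, x ∈ D → G x = m s (κ x) := by
  classical
  have hbd : ∀ s : Finset (Fin 4), s.card = k + 1 → HomeoOn g (faceBd s) := fun s hs =>
    hg.face hgs (fun x hx => hx.1) (P := fun r => r ⊂ s) fun x hx hxs => faceBd_subset_skel hs ⟨hx, hxs⟩
  have hκf : ∀ s, HomeoOn κ (face s) := fun s =>
    hκ.face hκs subset_rfl (P := fun r => r ⊆ s) fun x hx _ => hx
  -- The map `κ` has the right image of `D` but the wrong boundary values. The correction `m s`,
  -- which preserves `D'`, makes the composite agree with `g` on the boundary of the face.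
  have ex : ∀ s : Finset (Fin 4), s.card = k + 1 → ∃ G, HomeoOn G (face s) ∧ EqOn G g (faceBd s) ∧
      EqOn G (fun x => m s (κ x)) (D ∩ face s) ∧ SuppPres G (face s) ∧
      ∀ ℓ ∈ C, SignPres ℓ G (face s) := by
    intro s hs
    refine exists_face_ext_eqOn (Finset.card_pos.1 (by omega)) (hD.inter (isClosed_face s))
      inter_subset_right (hbd s hs) (fun x hx => hgs x (faceBd_subset_skel hs hx))
      (fun ℓ hℓ => (hgC ℓ hℓ).mono (faceBd_subset_skel hs)) ((hm1 s hs).comp (hκf s)) (hm4 s hs)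
      (fun ℓ hℓ x hx => h1 ℓ hℓ x hx.1) fun ℓ hℓ x hx => ?_
    exact h2 ℓ hℓ _ ((hm3 s hs _ ((hκf s).mem hx.2)).2 ((hκD x hx.2.1).2 hx.1))
  choose! γ g1 g2 g3 g4 g5 using ex
  obtain ⟨G, r1, r2, r3, r4⟩ := exists_skel_ext hk4 hg hgs (γ := γ) fun s hs =>
    ⟨g1 s hs, g4 s hs, g2 s hs⟩
  refine ⟨G, r1, r2, r3, ?_, ?_, fun s hs => ?_⟩
  · intro ℓ hℓ x hx
    obtain ⟨s, hs, hxs⟩ := exists_face_of_skel hk4 hx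
    rw [r4 s hs hxs]; exact g5 s hs ℓ hℓ x hxs
  · intro x hx
    obtain ⟨s, hs, hxs⟩ := exists_face_of_skel hk4 hx
    rw [r4 s hs hxs]
    have fwd : ∀ y ∈ face s, y ∈ D → γ s y ∈ D' := fun y hy hyD => by
      rw [g3 s hs ⟨hyD, hy⟩]
      exact (hm3 s hs _ ((hκf s).mem hy)).2 ((hκD y hy.1).2 hyD)
    refine ⟨fun h => ?_, fwd x hxs⟩
    -- The image point in `D'` is also the image under `m s ∘ κ` of some `y` in `D`. Both maps agree
    -- at `y`, so injectivity of `γ s` identifies `y` with `x`.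
    obtain ⟨z, hz, ez⟩ := (hm1 s hs).surj ((g1 s hs).mem hxs)
    obtain ⟨y, hy, ey⟩ := (hκf s).surj hz
    have hyD : y ∈ D := by
      rw [← hκD y hy.1, ey, ← hm3 s hs z hz, ez]; exact h
    have : γ s y = γ s x := by
      rw [g3 s hs ⟨hyD, hy⟩]; simp only [ey, ez]
    rw [← (g1 s hs).inj hy hxs this]
    exact hyD
  · intro x hx hxD
    rw [r4 s hs hx, g3 s hs ⟨hxD, hx⟩]

/-- If `κ` carries `D` to `D'`, then some homeomorphism that also preserves the signs of the
functionals in `C` does so, provided that these are positive on `D` and `D'`. -/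
theorem exists_place {C : List (Vec →L[ℝ] ℝ)} {D D' : Set Vec} {κ : Vec → Vec}
    (hD : IsClosed D)
    (hκ : HomeoOn κ simplex) (hκs : SuppPres κ simplex) (hκD : ∀ x ∈ simplex, κ x ∈ D' ↔ x ∈ D)
    (h1 : ∀ ℓ ∈ C, ∀ x ∈ D, 0 < ℓ x) (h2 : ∀ ℓ ∈ C, ∀ x ∈ D', 0 < ℓ x)
    {F : Finset (Fin 4) → List (Vec →L[ℝ] ℝ)}
    (hF : ∀ s : Finset (Fin 4), s.card = 3 → ∀ x ∈ face s, x ∈ D' ↔ ∃ ℓ ∈ F s, ℓ x = 0)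
    (h3 : ∀ β : Vec → Vec, HomeoOn β (skel 3) → SuppPres β (skel 3) →
      (∀ x ∈ skel 3, β x ∈ D' ↔ x ∈ D') → ∃ m, HomeoOn m simplex ∧ SuppPres m simplex ∧
        EqOn m β (skel 3) ∧ ∀ x ∈ simplex, m x ∈ D' ↔ x ∈ D') :
    ∃ G, HomeoOn G simplex ∧ SuppPres G simplex ∧ (∀ ℓ ∈ C, SignPres ℓ G simplex) ∧
      ∀ x ∈ simplex, G x ∈ D' ↔ x ∈ D := by
  have hv : ∀ x ∈ skel 1, κ x = x := by
    intro x hx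
    obtain ⟨i, rfl⟩ := skel_one_eq hx
    exact hκs.fix_vert hκ.bij.mapsTo hx.1
  obtain ⟨κ', hκ', inv1, inv2⟩ := hκ.exists_inv isCompact_simplex
  have hκ's : SuppPres κ' simplex := fun x hx => by rw [← hκs _ (hκ'.mem hx), inv2 x hx]
  have cl : ∀ s, HomeoOn κ' (faceBd s) := fun s =>
    hκ'.face hκ's subset_rfl (P := fun r => r ⊂ s) fun x hx _ => hx
  have cl' : ∀ s, HomeoOn κ (faceBd s) := fun s =>
    hκ.face hκs subset_rfl (P := fun r => r ⊂ s) fun x hx _ => hx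
  -- On edges no correction is needed, because `κ` already fixes the vertices.
  obtain ⟨g₂, a1, a2, a3, a4, a5, a6⟩ := exists_place_step (k := 1) (by norm_num) (g := fun x => x)
    (m := fun _ x => x) hD hκ hκs hκD h1 h2 (HomeoOn.id _) (fun x _ => rfl) (fun ℓ _ x _ => rfl)
    (fun s hs => HomeoOn.id _) (fun s hs x _ => Iff.rfl)
    (fun s hs x hx => hv x (faceBd_subset_skel hs hx))
  -- On a triangular face the correction must extend the boundary map `g₂ ∘ κ⁻¹`. This map fixes the
  -- points of `D'`, since `g₂` and `κ` agree on `D`; so it respects the zero sets of the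
  -- functionals that cut out `D'`, and it extends with their signs.
  have ex : ∀ s : Finset (Fin 4), s.card = 2 + 1 → ∃ m, HomeoOn m (face s) ∧
      (∀ x ∈ face s, m x ∈ D' ↔ x ∈ D') ∧ ∀ x ∈ faceBd s, m (κ x) = g₂ x := by
    intro s hs
    have hsub : faceBd s ⊆ skel 2 := faceBd_subset_skel hs
    have hg₂ : HomeoOn g₂ (faceBd s) :=
      a1.face a2 (fun x hx => hx.1) (P := fun r => r ⊂ s) fun x hx hxs => hsub ⟨hx, hxs⟩
    have hβ : HomeoOn (fun x => g₂ (κ' x)) (faceBd s) := hg₂.comp (cl s)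
    have hβs : SuppPres (fun x => g₂ (κ' x)) (faceBd s) := fun x hx => by
      rw [← hκ's x hx.1]; exact a2 _ (hsub ((cl s).mem hx))
    have hβD : ∀ x ∈ faceBd s, x ∈ D' → g₂ (κ' x) = x := by
      intro x hx hxD
      have hy := (cl s).mem hx
      have hyD : κ' x ∈ D := by rw [← hκD _ hy.1, inv2 x hx.1]; exact hxD
      obtain ⟨r, hr, hyr⟩ := exists_face_of_skel (by norm_num) (hsub hy)
      rw [a6 r hr _ hyr hyD, inv2 x hx.1]
    have hz : ∀ ℓ ∈ F s, ∀ x ∈ faceBd s, ℓ (g₂ (κ' x)) = 0 ↔ ℓ x = 0 := by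
      intro ℓ hℓ x hx
      constructor
      · intro h
        have hm := hβ.mem hx
        have hD' : g₂ (κ' x) ∈ D' := (hF s hs _ (faceBd_subset_face s hm)).2 ⟨ℓ, hℓ, h⟩
        have := hβ.inj hm hx (hβD _ hm hD')
        rwa [this] at h
      · intro h
        rw [hβD x hx ((hF s hs _ (faceBd_subset_face s hx)).2 ⟨ℓ, hℓ, h⟩)]
        exact h
    obtain ⟨m, b1, b2, b3, b4⟩ := exists_face_sign_ext (Finset.card_pos.1 (by omega)) (F s) hβ hβs
      fun ℓ hℓ => signPres_of_zero_linear hβ.cont hβs hβ.bij.mapsTo (fun x hx => hx.1)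
        (fun x hx y hy => ⟨hy.1, hy.2.trans_ssubset hx.2⟩) (hz ℓ hℓ)
    refine ⟨m, b1, fun x hx => ?_, fun x hx => ?_⟩
    · rw [hF s hs _ (b1.mem hx), hF s hs _ hx]
      exact exists_congr fun ℓ => and_congr_right fun hℓ => (b4 ℓ hℓ).eq_zero_iff hx
    · rw [b2 ((cl' s).mem hx)]
      simp only [inv1 x hx.1]
  choose! m m1 m3 m4 using ex
  obtain ⟨g₃, c1, c2, c3, c4, c5, c6⟩ := exists_place_step (k := 2) (by norm_num)
    hD hκ hκs hκD h1 h2 a1 a2 a4 m1 m3 m4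
  have s3 : faceBd Finset.univ = skel 3 := faceBd_univ
  -- Over the whole tetrahedron the disc `D'` need not be cut out by functionals, so the correction
  -- comes from `h3`.
  obtain ⟨M, M1, M2, M3, M4⟩ := h3 (fun x => g₃ (κ' x)) (c1.comp (s3 ▸ cl _))
    (fun x hx => by
      rw [← hκ's x hx.1]; exact c2 _ ((s3 ▸ cl Finset.univ : HomeoOn κ' (skel 3)).mem hx))
    (fun x hx => by
      have hy := (s3 ▸ cl Finset.univ : HomeoOn κ' (skel 3)).mem hx
      rw [c5 _ hy, ← hκD _ hy.1, inv2 x hx.1])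
  have huniv : ∀ s : Finset (Fin 4), s.card = 3 + 1 → s = Finset.univ := fun s hs =>
    (Finset.card_eq_iff_eq_univ s).1 (by simpa using hs)
  obtain ⟨G, d1, d2, d3, d4, d5, d6⟩ := exists_place_step (k := 3) (by norm_num) (m := fun _ => M)
    hD hκ hκs hκD h1 h2 c1 c2 c4
    (fun s hs => by rw [huniv s hs, face_univ]; exact M1)
    (fun s hs x hx => M4 x hx.1)
    (fun s hs x hx => by
      rw [huniv s hs] at hx
      have := (cl' Finset.univ).mem hx
      rw [s3] at this
      rw [M3 this]; simp only [inv1 x hx.1])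
  rw [show 3 + 1 = 4 from rfl, skel_four] at d1 d2 d4 d5
  exact ⟨G, d1, d2, d4, d5⟩

/-! ### Normal discs as zero sets -/

namespace DiscType

/-- The vertices on one side of a triangle or quadrilateral. -/
def side : DiscType → Finset (Fin 4)
  | .tri v => {v}
  | .quad i => ![{2, 3}, {1, 3}, {0, 3}] i
  | .oct _ => ∅

/-- Triangles and quadrilaterals. -/
def IsFlat : DiscType → Prop
  | .oct _ => False
  | _ => True

end DiscType

/-- The function that vanishes on the model octagon. -/
def octFun (a b c d : Fin 4) (x : Vec) : ℝ :=
  (x a + x b) - (x c + x d) - (2 * |x a - x b| - 2 * |x c - x d|)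

/-- The function that vanishes on the model disc. -/
noncomputable def DiscType.fn : DiscType → Vec → ℝ
  | .tri v => fun x => ∑ i ∈ (DiscType.tri v).side, x i - 1 / 2
  | .quad j => fun x => ∑ i ∈ (DiscType.quad j).side, x i - 1 / 2
  | .oct i => ![octFun 0 1 2 3, octFun 0 2 1 3, octFun 0 3 1 2] i

theorem DiscType.fn_of_flat {τ : DiscType} (h : τ.IsFlat) (x : Vec) :
    τ.fn x = ∑ i ∈ τ.side, x i - 1 / 2 := by
  cases τ with
  | tri v => rfl
  | quad i => rfl
  | oct i => exact h.elim

theorem DiscType.mem_model (τ : DiscType) (x : Tetra) : x ∈ τ.model ↔ τ.fn x.1 = 0 := by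
  have h1 := x.2.2
  rw [Fin.sum_univ_four] at h1
  cases τ with
  | tri v =>
    simp only [model, triModel, fn, side, mem_ofPred_eq, Finset.sum_singleton, sub_eq_zero]
    rfl
  | quad i =>
    fin_cases i
    all_goals
      simp [model, quadModel, fn, side]
      constructor <;> intro h <;> (simp only [DFunLike.coe] at h ⊢; linarith)
  | oct i =>
    fin_cases i
    all_goals
      simp [model, octModel, fn, octFun, sub_eq_zero]
      rfl

/-- `D` is a normal disc of type `τ`, as a subset of `Vec`. -/
def IsDiscVec (τ : DiscType) (D : Set Vec) : Prop :=
  D ⊆ simplex ∧ ∃ k, HomeoOn k simplex ∧ SuppPres k simplex ∧ ∀ x ∈ simplex, x ∈ D ↔ τ.fn (k x) = 0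

theorem IsDisc.vec {τ : DiscType} {D : Set Tetra} (h : IsDisc τ D) :
    IsDiscVec τ (Subtype.val '' D) := by
  obtain ⟨e, he, rfl⟩ := h
  obtain ⟨k, hk, hke⟩ := e.symm.exists_homeoOn
  refine ⟨by rintro _ ⟨x, -, rfl⟩; exact x.2, k, hk,
    (facePreserving_iff fun x => (hke x).symm).1 he.symm, fun x hx => ?_⟩
  rw [hke ⟨x, hx⟩, ← DiscType.mem_model]
  constructor
  · rintro ⟨_, ⟨y, hy, rfl⟩, rfl⟩
    simpa using hy
  · intro h
    exact ⟨⟨x, hx⟩, ⟨_, h, e.apply_symm_apply _⟩, rfl⟩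

theorem continuous_fn (τ : DiscType) : Continuous τ.fn := by
  have h1 : ∀ s : Finset (Fin 4), Continuous fun x : Vec => ∑ i ∈ s, x i - 1 / 2 := fun s => by fun_prop
  have h2 : ∀ a b c d, Continuous (octFun a b c d) := fun a b c d => by unfold octFun; fun_prop
  cases τ with
  | tri v => exact h1 _
  | quad i => exact h1 _
  | oct i => fin_cases i <;> exact h2 _ _ _ _

theorem IsDiscVec.isClosed {τ : DiscType} {D : Set Vec} (h : IsDiscVec τ D) : IsClosed D := by
  obtain ⟨hD, k, hk, -, hkD⟩ := h
  have : D = simplex ∩ (fun x => τ.fn (k x)) ⁻¹' {0} := by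
    ext x
    constructor
    · exact fun hx => ⟨hD hx, (hkD x (hD hx)).1 hx⟩
    · exact fun hx => (hkD x hx.1).2 hx.2
  rw [this]
  exact ContinuousOn.preimage_isClosed_of_isClosed ((continuous_fn τ).comp_continuousOn hk.cont)
    isCompact_simplex.isClosed isClosed_singleton

/-- A homeomorphism respecting the faces transports discs. -/
theorem IsDiscVec.image {τ : DiscType} {D : Set Vec} (h : IsDiscVec τ D) {g : Vec → Vec}
    (hg : HomeoOn g simplex) (hs : SuppPres g simplex) : IsDiscVec τ (g '' D) := by
  obtain ⟨hD, k, hk, hks, hkD⟩ := h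
  obtain ⟨g', hg', i1, i2⟩ := hg.exists_inv isCompact_simplex
  refine ⟨by rintro _ ⟨x, hx, rfl⟩; exact hg.mem (hD hx), _, hk.comp hg', fun x hx => ?_, fun x hx => ?_⟩
  · rw [hks _ (hg'.mem hx), ← hs _ (hg'.mem hx), i2 x hx]
  · rw [← hkD _ (hg'.mem hx)]
    constructor
    · rintro ⟨y, hy, rfl⟩; rwa [i1 y (hD hy)]
    · exact fun h => ⟨_, h, i2 x hx⟩

/-! ### Points of discs on edges -/

theorem edge_point_mem (p q : Fin 4) {t : ℝ} (ht : t ∈ Icc (0 : ℝ) 1) :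
    t • vert p + (1 - t) • vert q ∈ face {p, q} :=
  convex_face _ ⟨vert_mem p, by rw [supp_vert]; simp⟩ ⟨vert_mem q, by rw [supp_vert]; simp⟩
    ht.1 (by linarith [ht.2]) (by ring)

theorem exists_oct_edge (i : Fin 3) (p q : Fin 4) (hpq : p ≠ q) :
    ∃ t ∈ Icc (0 : ℝ) 1, (DiscType.oct i).fn (t • vert p + (1 - t) • vert q) = 0 := by
  have h1 : (1 / 2 : ℝ) ∈ Icc (0 : ℝ) 1 := by norm_num
  have h2 : (3 / 4 : ℝ) ∈ Icc (0 : ℝ) 1 := by norm_num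
  -- The midpoint serves for the four edges met once, and the point with coordinate 3/4 for the two
  -- edges met twice.
  fin_cases i <;> fin_cases p <;> fin_cases q <;>
  first
    | exact absurd rfl hpq
    | (refine ⟨1 / 2, h1, ?_⟩; simp [DiscType.fn, octFun, vert, abs_of_pos]; norm_num; done)
    | (refine ⟨3 / 4, h2, ?_⟩; simp [DiscType.fn, octFun, vert, abs_of_pos]; norm_num [abs_of_pos, abs_of_neg])

theorem sum_edge_point {s : Finset (Fin 4)} {p q : Fin 4} (hp : p ∈ s) (hq : q ∉ s) (t : ℝ) :
    ∑ i ∈ s, (t • vert p + (1 - t) • vert q) i = t := by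
  simp [vert, Finset.sum_add_distrib, Pi.single_apply, hp, hq]

theorem IsDiscVec.exists_mem_edge {τ : DiscType} {D : Set Vec} (h : IsDiscVec τ D) {p q : Fin 4}
    (hpq : p ≠ q) (hτ : τ.IsFlat → p ∈ τ.side ∧ q ∉ τ.side) : ∃ x ∈ D, x ∈ face {p, q} := by
  obtain ⟨hD, k, hk, hks, hkD⟩ := h
  obtain ⟨t, ht, e⟩ : ∃ t ∈ Icc (0 : ℝ) 1, τ.fn (t • vert p + (1 - t) • vert q) = 0 := by
    by_cases hf : τ.IsFlat
    · refine ⟨1 / 2, by norm_num, ?_⟩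
      rw [DiscType.fn_of_flat hf, sum_edge_point (hτ hf).1 (hτ hf).2, sub_self]
    · cases τ with
      | tri v => exact (hf trivial).elim
      | quad i => exact (hf trivial).elim
      | oct i => exact exists_oct_edge i p q hpq
  obtain ⟨x, hx, ex⟩ := (hk.face hks subset_rfl (P := fun r => r ⊆ {p, q}) fun x hx _ => hx).surj
    (edge_point_mem p q ht)
  exact ⟨x, (hkD x hx.1).2 (by rw [ex, e]), hx⟩

theorem mem_edge_eq {p q : Fin 4} (hpq : p ≠ q) {x : Vec} (hx : x ∈ face {p, q}) :
    x = x p • vert p + (1 - x p) • vert q := by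
  have h0 : ∀ i, i ≠ p → i ≠ q → x i = 0 := fun i h1 h2 => supp_subset.1 hx.2 i (by simp [h1, h2])
  have h1 := hx.1.2
  rw [← Finset.sum_subset (Finset.subset_univ {p, q}) (fun i _ hi => h0 i (by rintro rfl; simp at hi)
    (by rintro rfl; simp at hi)), Finset.sum_pair hpq] at h1
  funext i
  by_cases hip : i = p
  · subst hip; simp [vert, hpq]
  · by_cases hiq : i = q
    · subst hiq
      simp [vert, hip]; linarith
    · simp [vert, hip, hiq, h0 i hip hiq]

/-- A flat disc meets an edge at most once. -/
theorem IsDiscVec.subsingleton_edge {τ : DiscType} {D : Set Vec} (h : IsDiscVec τ D)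
    (hτ : τ.IsFlat) {p q : Fin 4} (hp : p ∈ τ.side) (hq : q ∉ τ.side) {x y : Vec} (hx : x ∈ D)
    (hy : y ∈ D) (hxe : x ∈ face {p, q}) (hye : y ∈ face {p, q}) : x = y := by
  obtain ⟨hD, k, hk, hks, hkD⟩ := h
  have hpq : p ≠ q := by rintro rfl; exact hq hp
  have hke := hk.face hks subset_rfl (P := fun r => r ⊆ {p, q}) fun x hx _ => hx
  have key : ∀ z ∈ D, z ∈ face {p, q} → (k z) p = 1 / 2 := by
    intro z hz hze
    have h1 := (hkD z (hD hz)).1 hz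
    rw [DiscType.fn_of_flat hτ, mem_edge_eq hpq (hke.mem hze), sum_edge_point hp hq] at h1
    linarith
  refine hke.inj hxe hye ?_
  rw [mem_edge_eq hpq (hke.mem hxe), mem_edge_eq hpq (hke.mem hye), key x hx hxe, key y hy hye]

/-- A flat disc misses the edges that join vertices on the same side. -/
theorem IsDiscVec.not_mem_edge {τ : DiscType} {D : Set Vec} (h : IsDiscVec τ D)
    (hτ : τ.IsFlat) {p q : Fin 4} (hpq : p ∈ τ.side ↔ q ∈ τ.side) {x : Vec} (hx : x ∈ D) :
    x ∉ face {p, q} := by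
  intro hxe
  obtain ⟨hD, k, hk, hks, hkD⟩ := h
  have hke := hk.face hks subset_rfl (P := fun r => r ⊆ {p, q}) fun x hx _ => hx
  have h1 := (hkD x (hD hx)).1 hx
  rw [DiscType.fn_of_flat hτ] at h1
  have hm := hke.mem hxe
  by_cases hp : p ∈ τ.side
  · have hsub : {p, q} ⊆ τ.side := by
      intro i hi
      simp only [Finset.mem_insert, Finset.mem_singleton] at hi
      rcases hi with rfl | rfl
      exacts [hp, hpq.1 hp]
    have : ∑ i ∈ τ.side, k x i = 1 := by
      rw [← hm.1.2]
      refine Finset.sum_subset (Finset.subset_univ _) fun i _ hi => ?_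
      exact supp_subset.1 hm.2 i fun h => hi (hsub h)
    rw [this] at h1
    norm_num at h1
  · have : ∑ i ∈ τ.side, k x i = 0 := by
      refine Finset.sum_eq_zero fun i hi => supp_subset.1 hm.2 i ?_
      simp only [Finset.mem_insert, Finset.mem_singleton]
      rintro (rfl | rfl)
      exacts [hp hi, hp (hpq.2 hi)]
    rw [this] at h1
    norm_num at h1

/-! ### Moving a flat disc to another level -/

/-- The projective transformation that scales the coordinates in `s` by `α`. -/
noncomputable def weigh (s : Finset (Fin 4)) (α : ℝ) (x : Vec) : Vec := fun i =>
  (if i ∈ s then α * x i else x i) / (α * ∑ j ∈ s, x j + (1 - ∑ j ∈ s, x j))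

theorem sum_side_mem {s : Finset (Fin 4)} {x : Vec} (hx : x ∈ simplex) :
    ∑ j ∈ s, x j ∈ Icc (0 : ℝ) 1 :=
  ⟨Finset.sum_nonneg fun i _ => hx.1 i, by
    rw [← hx.2]
    exact Finset.sum_le_sum_of_subset_of_nonneg (Finset.subset_univ _) fun i _ _ => hx.1 i⟩

theorem weigh_pos {s : Finset (Fin 4)} {α : ℝ} (hα : 0 < α) {x : Vec} (hx : x ∈ simplex) :
    0 < α * ∑ j ∈ s, x j + (1 - ∑ j ∈ s, x j) := by
  obtain ⟨h0, h1⟩ := sum_side_mem (s := s) hx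
  rcases h0.eq_or_lt with h | h
  · rw [← h]; norm_num
  · have := mul_pos hα h; linarith

theorem sum_weigh (s : Finset (Fin 4)) (α : ℝ) (x : Vec) : ∑ i ∈ s, weigh s α x i =
    α * (∑ j ∈ s, x j) / (α * ∑ j ∈ s, x j + (1 - ∑ j ∈ s, x j)) := by
  simp only [weigh]
  rw [← Finset.sum_div, Finset.sum_congr rfl fun i hi => if_pos hi, Finset.mul_sum]

theorem weigh_mem {s : Finset (Fin 4)} {α : ℝ} (hα : 0 < α) {x : Vec} (hx : x ∈ simplex) :
    weigh s α x ∈ simplex := by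
  have hp := weigh_pos (s := s) hα hx
  refine ⟨fun i => div_nonneg ?_ hp.le, ?_⟩
  · split_ifs
    exacts [mul_nonneg hα.le (hx.1 i), hx.1 i]
  · simp only [weigh]
    rw [← Finset.sum_div, div_eq_one_iff_eq hp.ne', ← Finset.sum_add_sum_compl s,
      Finset.sum_congr rfl fun i hi => if_pos hi,
      Finset.sum_congr (s₁ := sᶜ) rfl fun i hi => if_neg (Finset.mem_compl.1 hi), ← Finset.mul_sum,
      ← hx.2, ← Finset.sum_add_sum_compl s x]
    ring

theorem weigh_weigh {s : Finset (Fin 4)} {α β : ℝ} (hα : 0 < α) (hβ : β * α = 1) {x : Vec}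
    (hx : x ∈ simplex) : weigh s β (weigh s α x) = x := by
  have hp := weigh_pos (s := s) hα hx
  funext i
  have h1 : β * ∑ j ∈ s, weigh s α x j + (1 - ∑ j ∈ s, weigh s α x j) =
      (α * ∑ j ∈ s, x j + (1 - ∑ j ∈ s, x j))⁻¹ := by
    rw [sum_weigh]
    field_simp
    linear_combination (∑ j ∈ s, x j) * hβ
  rw [weigh, h1]
  simp only [weigh]
  split_ifs
  · rw [← mul_div_assoc, ← mul_assoc, hβ, one_mul, div_inv_eq_mul, div_mul_cancel₀ _ hp.ne']
  · rw [div_inv_eq_mul, div_mul_cancel₀ _ hp.ne']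

theorem homeoOn_weigh {s : Finset (Fin 4)} {α : ℝ} (hα : 0 < α) :
    HomeoOn (weigh s α) simplex ∧ SuppPres (weigh s α) simplex := by
  refine ⟨⟨?_, ?_⟩, ?_⟩
  · refine continuousOn_pi.2 fun i => ContinuousOn.div ?_ (by fun_prop) fun x hx => (weigh_pos hα hx).ne'
    split_ifs <;> fun_prop
  · refine InvOn.bijOn (f' := weigh s α⁻¹) ⟨fun x hx => ?_, fun x hx => ?_⟩
      (fun x hx => weigh_mem hα hx) (fun x hx => weigh_mem (inv_pos.2 hα) hx)
    · exact weigh_weigh hα (inv_mul_cancel₀ hα.ne') hx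
    · exact weigh_weigh (inv_pos.2 hα) (mul_inv_cancel₀ hα.ne') hx
  · intro x hx
    refine supp_eq_supp.2 fun i => ?_
    have hp := weigh_pos (s := s) hα hx
    simp only [weigh, div_eq_zero_iff, hp.ne', or_false]
    split_ifs
    · simp [hα.ne']
    · rfl

theorem IsDiscVec.exists_level {τ : DiscType} {D : Set Vec} (h : IsDiscVec τ D) (hτ : τ.IsFlat)
    {lv : ℝ} (h0 : 0 < lv) (h1 : lv < 1) : ∃ k, HomeoOn k simplex ∧ SuppPres k simplex ∧
      ∀ x ∈ simplex, ∑ i ∈ τ.side, k x i = lv ↔ x ∈ D := by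
  obtain ⟨hD, k, hk, hks, hkD⟩ := h
  have h1' : 0 < 1 - lv := by linarith
  -- This weight carries the level 1/2 of the model disc to the level `lv`.
  obtain ⟨w1, w2⟩ := homeoOn_weigh (s := τ.side) (div_pos h0 h1')
  refine ⟨_, w1.comp hk, fun x hx => by rw [w2 _ (hk.mem hx), hks x hx], fun x hx => ?_⟩
  have hp := weigh_pos (s := τ.side) (div_pos h0 h1') (hk.mem hx)
  rw [hkD x hx, DiscType.fn_of_flat hτ, sum_weigh, div_eq_iff hp.ne']
  have e : lv / (1 - lv) * (1 - lv) = lv := div_mul_cancel₀ _ h1'.ne'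
  set S := ∑ j ∈ τ.side, k x j
  set α := lv / (1 - lv)
  constructor
  · intro h
    have h2 : lv * (2 * S - 1) = 0 := by linear_combination h - S * e
    have := (mul_eq_zero.1 h2).resolve_left h0.ne'
    linarith
  · intro h
    have : S = 1 / 2 := by linarith
    rw [this]
    linear_combination 1 / 2 * e

/-! ### Placing a disc -/

/-- The functional that vanishes where the coordinates in `s` sum to `a`. -/
noncomputable def cutter (s : Finset (Fin 4)) (a : ℝ) : Vec →L[ℝ] ℝ :=
  ∑ i ∈ s, coord i - a • ∑ i, coord i

/-- The multiple of the full coordinate sum homogenises an affine function, so that results about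
linear functionals apply to the discs. -/
theorem cutter_apply {s : Finset (Fin 4)} {a : ℝ} {x : Vec} (hx : x ∈ simplex) :
    cutter s a x = ∑ i ∈ s, x i - a := by
  have : ∑ i, x i = 1 := hx.2
  simp [cutter, coord, this]

/-- Lets `exists_place` assume that all functionals are positive on the discs; preservation of signs
is not affected by negation. -/
theorem exists_orient {C : List (Vec →L[ℝ] ℝ)} {P : (Vec →L[ℝ] ℝ) → Prop}
    (h : ∀ ℓ ∈ C, P ℓ ∨ P (-ℓ)) : ∃ C' : List (Vec →L[ℝ] ℝ), (∀ ℓ ∈ C', P ℓ) ∧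
      ∀ ℓ ∈ C, ℓ ∈ C' ∨ -ℓ ∈ C' := by
  induction C with
  | nil => exact ⟨[], by simp, by simp⟩
  | cons ℓ C ih =>
    rw [List.forall_mem_cons] at h
    obtain ⟨C', h1, h2⟩ := ih h.2
    rcases h.1 with h3 | h3
    · exact ⟨ℓ :: C', List.forall_mem_cons.2 ⟨h3, h1⟩, List.forall_mem_cons.2 ⟨by simp, fun m hm =>
        (h2 m hm).imp (List.mem_cons_of_mem _) (List.mem_cons_of_mem _)⟩⟩
    · exact ⟨-ℓ :: C', List.forall_mem_cons.2 ⟨h3, h1⟩, List.forall_mem_cons.2 ⟨by simp, fun m hm =>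
        (h2 m hm).imp (List.mem_cons_of_mem _) (List.mem_cons_of_mem _)⟩⟩

theorem exists_place' {C : List (Vec →L[ℝ] ℝ)} {D D' : Set Vec} {κ : Vec → Vec}
    (hD : IsClosed D)
    (hκ : HomeoOn κ simplex) (hκs : SuppPres κ simplex) (hκD : ∀ x ∈ simplex, κ x ∈ D' ↔ x ∈ D)
    (hC : ∀ ℓ ∈ C, (∀ x ∈ D ∪ D', 0 < ℓ x) ∨ ∀ x ∈ D ∪ D', ℓ x < 0)
    {F : Finset (Fin 4) → List (Vec →L[ℝ] ℝ)}
    (hF : ∀ s : Finset (Fin 4), s.card = 3 → ∀ x ∈ face s, x ∈ D' ↔ ∃ ℓ ∈ F s, ℓ x = 0)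
    (h3 : ∀ β : Vec → Vec, HomeoOn β (skel 3) → SuppPres β (skel 3) →
      (∀ x ∈ skel 3, β x ∈ D' ↔ x ∈ D') → ∃ m, HomeoOn m simplex ∧ SuppPres m simplex ∧
        EqOn m β (skel 3) ∧ ∀ x ∈ simplex, m x ∈ D' ↔ x ∈ D') :
    ∃ G, HomeoOn G simplex ∧ SuppPres G simplex ∧ (∀ ℓ ∈ C, SignPres ℓ G simplex) ∧
      ∀ x ∈ simplex, G x ∈ D' ↔ x ∈ D := by
  obtain ⟨C', hC', hCC⟩ := exists_orient (C := C) (P := fun ℓ => ∀ x ∈ D ∪ D', 0 < ℓ x)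
    fun ℓ hℓ => (hC ℓ hℓ).imp_right fun h x hx => by simpa using h x hx
  obtain ⟨G, h1, h2, h4, h5⟩ := exists_place (C := C') hD hκ hκs hκD
    (fun ℓ hℓ x hx => hC' ℓ hℓ x (Or.inl hx)) (fun ℓ hℓ x hx => hC' ℓ hℓ x (Or.inr hx)) hF h3
  refine ⟨G, h1, h2, fun ℓ hℓ => ?_, h5⟩
  rcases hCC ℓ hℓ with h | h
  · exact h4 ℓ h
  · have := (h4 _ h).neg
    rwa [neg_neg] at this

theorem exists_simplex_sign_ext (C : List (Vec →L[ℝ] ℝ)) {β : Vec → Vec} (hβ : HomeoOn β (skel 3))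
    (hβs : SuppPres β (skel 3)) (hC : ∀ ℓ ∈ C, SignPres ℓ β (skel 3)) :
    ∃ m, HomeoOn m simplex ∧ EqOn m β (skel 3) ∧ SuppPres m simplex ∧
      ∀ ℓ ∈ C, SignPres ℓ m simplex := by
  rw [← faceBd_univ] at hβ hβs hC ⊢
  rw [← face_univ]
  exact exists_face_sign_ext Finset.univ_nonempty C hβ hβs hC

theorem face_subset_of_mem_skel {k : ℕ} {x : Vec} (hx : x ∈ skel k) : face (supp x) ⊆ skel k :=
  fun _ hy => ⟨hy.1, (Finset.card_le_card hy.2).trans hx.2⟩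

theorem skel_subset (k : ℕ) : skel k ⊆ simplex := fun _ hx => hx.1

/-- The target disc is one hyperplane section, so the correction over the tetrahedron is the
sign-preserving extension for a single functional. -/
theorem exists_place_flat {C : List (Vec →L[ℝ] ℝ)} {D : Set Vec} {τ : DiscType}
    (h : IsDiscVec τ D) (hτ : τ.IsFlat) {lv : ℝ} (h0 : 0 < lv) (h1 : lv < 1)
    (hC : ∀ ℓ ∈ C, (∀ x ∈ D ∪ {x | x ∈ simplex ∧ cutter τ.side lv x = 0}, 0 < ℓ x) ∨
      ∀ x ∈ D ∪ {x | x ∈ simplex ∧ cutter τ.side lv x = 0}, ℓ x < 0) :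
    ∃ G, HomeoOn G simplex ∧ SuppPres G simplex ∧ (∀ ℓ ∈ C, SignPres ℓ G simplex) ∧
      ∀ x ∈ simplex, cutter τ.side lv (G x) = 0 ↔ x ∈ D := by
  obtain ⟨κ, hκ, hκs, hκD⟩ := h.exists_level hτ h0 h1
  obtain ⟨G, g1, g2, g3, g4⟩ := exists_place' (C := C)
    (D' := {x | x ∈ simplex ∧ cutter τ.side lv x = 0}) (F := fun _ => [cutter τ.side lv])
    h.isClosed hκ hκs
    (fun x hx => by
      rw [← hκD x hx, mem_ofPred_eq, cutter_apply (hκ.mem hx), sub_eq_zero, and_iff_right (hκ.mem hx)])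
    hC
    (fun s _ x hx => by simp [hx.1])
    (fun β hβ hβs hβD => by
      obtain ⟨m, m1, m2, m3, m4⟩ := exists_simplex_sign_ext [cutter τ.side lv] hβ hβs
        (by
          simp only [List.mem_singleton, forall_eq]
          refine signPres_of_zero_linear hβ.cont hβs hβ.bij.mapsTo (skel_subset 3)
            (fun x hx => face_subset_of_mem_skel hx) fun x hx => ?_
          have := hβD x hx
          simpa only [mem_ofPred_eq, hx.1, (hβ.mem hx).1, true_and] using this)
      refine ⟨m, m1, m3, m2, fun x hx => ?_⟩
      simp only [mem_ofPred_eq, hx, m1.mem hx, true_and]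
      exact (m4 _ List.mem_cons_self).eq_zero_iff hx)
  refine ⟨G, g1, g2, g3, fun x hx => ?_⟩
  rw [← g4 x hx, mem_ofPred_eq, and_iff_right (g1.mem hx)]

/-! ### The octagon -/

section Octagon

variable {a b c d : Fin 4}

theorem octFun_swap_cd (a b c d : Fin 4) (x : Vec) : octFun a b d c x = octFun a b c d x := by
  simp only [octFun, abs_sub_comm (x d) (x c)]; ring

theorem octFun_swap_pairs (a b c d : Fin 4) (x : Vec) : octFun c d a b x = -octFun a b c d x := by
  simp only [octFun]; ring

/-- The four vertices of the tetrahedron in some order. -/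
def IsOrdering (a b c d : Fin 4) : Prop :=
  (∀ i, i = a ∨ i = b ∨ i = c ∨ i = d) ∧ ∀ x : Vec, ∑ i, x i = x a + x b + x c + x d

theorem IsOrdering.swap_cd (h : IsOrdering a b c d) : IsOrdering a b d c :=
  ⟨fun i => by have := h.1 i; tauto, fun x => by rw [h.2]; ring⟩

theorem IsOrdering.swap_pairs (h : IsOrdering a b c d) : IsOrdering c d a b :=
  ⟨fun i => by have := h.1 i; tauto, fun x => by rw [h.2]; ring⟩

theorem IsOrdering.octFun_of_zero (h : IsOrdering a b c d) {x : Vec} (hx : x ∈ simplex)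
    (hd : x d = 0) : octFun a b c d x = 1 - 2 * |x a - x b| := by
  have h1 := hx.2
  rw [h.2, hd] at h1
  rw [octFun, hd, sub_zero, abs_of_nonneg (hx.1 c)]
  linarith

theorem vert_self (i : Fin 4) : vert i i = 1 := by simp [vert]

theorem vert_ne {i j : Fin 4} (h : j ≠ i) : vert i j = 0 := by simp [vert, h]

theorem IsOrdering.ne (h : IsOrdering a b c d) : a ≠ b ∧ a ≠ c ∧ a ≠ d ∧ b ≠ c ∧ b ≠ d ∧ c ≠ d := by
  have key : ∀ i, (1 : ℝ) = vert i a + vert i b + vert i c + vert i d := fun i => by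
    rw [← h.2, (vert_mem i).2]
  have hn : ∀ i j, 0 ≤ vert i j := fun i j => (vert_mem i).1 j
  have hk : ∀ i j, i = j → vert i j = 1 := fun i j e => e ▸ vert_self i
  refine ⟨?_, ?_, ?_, ?_, ?_, ?_⟩ <;> intro e
  · linarith [key a, vert_self a, hk a b e, hn a c, hn a d]
  · linarith [key a, vert_self a, hk a c e, hn a b, hn a d]
  · linarith [key a, vert_self a, hk a d e, hn a b, hn a c]
  · linarith [key b, vert_self b, hk b c e, hn b a, hn b d]
  · linarith [key b, vert_self b, hk b d e, hn b a, hn b c]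
  · linarith [key c, vert_self c, hk c d e, hn c a, hn c b]

/-- In the face opposite `d` the octagon consists of two arcs, and the complement has three regions:
those cut off around `a` and `b`, and the middle one, which contains `c`. Each point is joined
straight to the vertex of its region. -/
theorem IsOrdering.exists_segment (h : IsOrdering a b c d) {x : Vec} (hx : x ∈ simplex)
    (hd : x d = 0) (h0 : octFun a b c d x ≠ 0) : ∃ i, ∀ t ∈ Icc (0 : ℝ) 1,
      x + t • (vert i - x) ∈ skel 3 ∧ octFun a b c d (x + t • (vert i - x)) ≠ 0 := by
  obtain ⟨hab, hac, had, hbc, hbd, hcd⟩ := h.ne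
  have hmem : ∀ i, i ≠ d → ∀ t ∈ Icc (0 : ℝ) 1,
      x + t • (vert i - x) ∈ simplex ∧ (x + t • (vert i - x)) d = 0 := by
    intro i hi t ht
    refine ⟨(convex_stdSimplex ℝ (Fin 4)).add_smul_sub_mem hx (vert_mem i) ht, ?_⟩
    simp [hd, vert_ne hi.symm]
  have hsk : ∀ y : Vec, y ∈ simplex → y d = 0 → y ∈ skel 3 := by
    intro y hy hyd
    refine ⟨hy, ?_⟩
    have : supp y ⊂ Finset.univ := Finset.ssubset_univ_iff.2 fun e => by
      have := e ▸ Finset.mem_univ d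
      exact mem_supp.1 this hyd
    have := Finset.card_lt_card this
    simp only [Finset.card_univ, Fintype.card_fin] at this
    omega
  rw [h.octFun_of_zero hx hd] at h0
  rcases lt_or_gt_of_ne h0 with hlt | hgt
  · have habs : 1 / 2 < |x a - x b| := by linarith
    rcases lt_abs.1 habs with h1 | h1
    · refine ⟨a, fun t ht => ⟨hsk _ (hmem a had t ht).1 (hmem a had t ht).2, ?_⟩⟩
      rw [h.octFun_of_zero (hmem a had t ht).1 (hmem a had t ht).2]
      have e : (x + t • (vert a - x)) a - (x + t • (vert a - x)) b = (x a - x b) + t * (1 - (x a - x b)) := by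
        simp [vert_self, vert_ne hab.symm]; ring
      rw [e]
      have h2 : x a - x b ≤ 1 := by
        have := hx.2
        rw [h.2] at this
        linarith [hx.1 b, hx.1 c, hx.1 d]
      have := le_abs_self ((x a - x b) + t * (1 - (x a - x b)))
      have := mul_nonneg ht.1 (by linarith : 0 ≤ 1 - (x a - x b))
      intro h3
      linarith
    · refine ⟨b, fun t ht => ⟨hsk _ (hmem b hbd t ht).1 (hmem b hbd t ht).2, ?_⟩⟩
      rw [h.octFun_of_zero (hmem b hbd t ht).1 (hmem b hbd t ht).2]
      have e : (x + t • (vert b - x)) a - (x + t • (vert b - x)) b =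
          -((x b - x a) + t * (1 - (x b - x a))) := by
        simp [vert_self, vert_ne hab]; ring
      rw [e, abs_neg]
      have h2 : x b - x a ≤ 1 := by
        have := hx.2
        rw [h.2] at this
        linarith [hx.1 a, hx.1 c, hx.1 d]
      have := le_abs_self ((x b - x a) + t * (1 - (x b - x a)))
      have := mul_nonneg ht.1 (by linarith : 0 ≤ 1 - (x b - x a))
      intro h3
      linarith
  · refine ⟨c, fun t ht => ⟨hsk _ (hmem c hcd t ht).1 (hmem c hcd t ht).2, ?_⟩⟩
    rw [h.octFun_of_zero (hmem c hcd t ht).1 (hmem c hcd t ht).2]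
    have e : (x + t • (vert c - x)) a - (x + t • (vert c - x)) b = (1 - t) * (x a - x b) := by
      simp [vert_ne hac, vert_ne hbc]; ring
    rw [e, abs_mul, abs_of_nonneg (by linarith [ht.2] : 0 ≤ 1 - t)]
    have := mul_le_of_le_one_left (abs_nonneg (x a - x b)) (by linarith [ht.1] : 1 - t ≤ 1)
    intro h3
    linarith

theorem exists_zero_of_mem_skel {x : Vec} (hx : x ∈ skel 3) : ∃ i, x i = 0 := by
  by_contra h
  push Not at h
  have : supp x = Finset.univ := by ext i; simp [mem_supp, h]
  have h2 := hx.2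
  rw [this] at h2
  simp at h2

/-- The symmetries of `octFun`, up to sign, reduce every face to the one opposite `d`. -/
theorem IsOrdering.exists_segment' (h : IsOrdering a b c d) {x : Vec} (hx : x ∈ skel 3)
    (h0 : octFun a b c d x ≠ 0) : ∃ i, ∀ t ∈ Icc (0 : ℝ) 1,
      x + t • (vert i - x) ∈ skel 3 ∧ octFun a b c d (x + t • (vert i - x)) ≠ 0 := by
  have e1 : octFun a b d c = octFun a b c d := funext (octFun_swap_cd a b c d)
  have e2 : octFun c d a b = fun y => -octFun a b c d y := funext (octFun_swap_pairs a b c d)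
  have e3 : octFun c d b a = fun y => -octFun a b c d y := by
    rw [← e2]; exact funext (octFun_swap_cd c d a b)
  obtain ⟨i, hi⟩ := exists_zero_of_mem_skel hx
  rcases h.1 i with rfl | rfl | rfl | rfl
  · have := h.swap_pairs.swap_cd.exists_segment hx.1 hi
    simpa only [e3, neg_ne_zero, ne_eq, neg_eq_zero] using this (by simpa only [e3, neg_ne_zero])
  · have := h.swap_pairs.exists_segment hx.1 hi
    simpa only [e2, neg_ne_zero, ne_eq, neg_eq_zero] using this (by simpa only [e2, neg_ne_zero])
  · have := h.swap_cd.exists_segment hx.1 hi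
    simpa only [e1] using this (by simpa only [e1])
  · exact h.exists_segment hx.1 hi h0

/-- Two functionals whose zero sets on the faces opposite `c` and `d` form the octagon. -/
noncomputable def octCutters (a b : Fin 4) : List (Vec →L[ℝ] ℝ) :=
  [coord a - coord b - (1 / 2 : ℝ) • ∑ i, coord i, coord b - coord a - (1 / 2 : ℝ) • ∑ i, coord i]

theorem exists_octCutters {x : Vec} (hx : x ∈ simplex) (a b : Fin 4) :
    (∃ ℓ ∈ octCutters a b, ℓ x = 0) ↔ 1 - 2 * |x a - x b| = 0 := by
  have : ∑ i, x i = 1 := hx.2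
  simp only [octCutters, List.mem_cons, List.not_mem_nil, or_false, exists_eq_or_imp,
    exists_eq_left, sub_apply, ContinuousLinearMap.proj_apply, smul_apply,
    sum_apply, this, smul_eq_mul, mul_one]
  rw [show (1 - 2 * |x a - x b| = 0) ↔ |x a - x b| = 1 / 2 by
    constructor <;> intro h <;> linarith, abs_eq (by norm_num)]
  constructor <;> rintro (h | h) <;> [left; right; left; right] <;> linarith

/-- A face contains exactly one of the edges `ab` and `cd`. On it the octagon is the pair of lines
where the coordinates at the ends of that edge differ by 1/2. -/
theorem IsOrdering.octFun_face (h : IsOrdering a b c d) {s : Finset (Fin 4)} (hs : s.card = 3)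
    {x : Vec} (hx : x ∈ face s) : octFun a b c d x = 0 ↔
      ∃ ℓ ∈ (if a ∈ s ∧ b ∈ s then octCutters a b else octCutters c d), ℓ x = 0 := by
  obtain ⟨hab, hac, had, hbc, hbd, hcd⟩ := h.ne
  obtain ⟨i, hi⟩ : ∃ i, i ∉ s := by
    by_contra hcon
    push Not at hcon
    rw [Finset.eq_univ_iff_forall.2 hcon] at hs
    simp at hs
  have hi0 := supp_subset.1 hx.2 i hi
  have hother : ∀ j, j ≠ i → j ∈ s := by
    intro j hj
    by_contra hjs
    have h1 : s ⊆ Finset.univ \ {i, j} := fun k hk => by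
      simp only [Finset.mem_sdiff, Finset.mem_univ, Finset.mem_insert, Finset.mem_singleton, true_and]
      rintro (rfl | rfl)
      exacts [hi hk, hjs hk]
    have h2 := Finset.card_le_card h1
    rw [Finset.card_sdiff_of_subset (Finset.subset_univ _), Finset.card_pair hj.symm, hs] at h2
    simp at h2
  have e3 : octFun c d b a x = -octFun a b c d x := by
    rw [octFun_swap_cd, octFun_swap_pairs]
  rcases h.1 i with rfl | rfl | rfl | rfl
  · rw [if_neg fun h' => hi h'.1, exists_octCutters hx.1,
      ← h.swap_pairs.swap_cd.octFun_of_zero hx.1 hi0, e3, neg_eq_zero]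
  · rw [if_neg fun h' => hi h'.2, exists_octCutters hx.1,
      ← h.swap_pairs.octFun_of_zero hx.1 hi0, octFun_swap_pairs, neg_eq_zero]
  · rw [if_pos ⟨hother _ hac, hother _ hbc⟩, exists_octCutters hx.1,
      ← h.swap_cd.octFun_of_zero hx.1 hi0, octFun_swap_cd]
  · rw [if_pos ⟨hother _ had, hother _ hbd⟩, exists_octCutters hx.1, ← h.octFun_of_zero hx.1 hi0]

/-- All coordinates of the barycentre are equal, so every term of `octFun` vanishes there and scales
linearly along rays. This is why coning from the barycentre preserves the octagon. -/
theorem octFun_conical (a b c d : Fin 4) (x : Vec) {r : ℝ} (hr : 0 < r) :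
    octFun a b c d (bary Finset.univ + r • (x - bary Finset.univ)) = r * octFun a b c d x := by
  have hb : ∀ i, bary Finset.univ i = 1 / 4 := fun i => by simp [bary]
  simp only [octFun, Pi.add_apply, Pi.smul_apply, Pi.sub_apply, hb, smul_eq_mul]
  have e : ∀ u v : ℝ, |(1 / 4 + r * (u - 1 / 4)) - (1 / 4 + r * (v - 1 / 4))| = r * |u - v| := by
    intro u v
    rw [← abs_of_pos hr, ← abs_mul, abs_of_pos hr]
    congr 1; ring
  rw [e, e]; ring

end Octagon

theorem exists_ordering (i : Fin 3) :
    ∃ a b c d, IsOrdering a b c d ∧ (DiscType.oct i).fn = octFun a b c d := by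
  fin_cases i
  · exact ⟨0, 1, 2, 3, ⟨by decide, fun x => by rw [Fin.sum_univ_four]⟩, rfl⟩
  · exact ⟨0, 2, 1, 3, ⟨by decide, fun x => by rw [Fin.sum_univ_four]; ring⟩, rfl⟩
  · exact ⟨0, 3, 1, 2, ⟨by decide, fun x => by rw [Fin.sum_univ_four]; ring⟩, rfl⟩

theorem signPres_oct {i : Fin 3} {β : Vec → Vec} (hβ : HomeoOn β (skel 3))
    (hβs : SuppPres β (skel 3))
    (hz : ∀ x ∈ skel 3, (DiscType.oct i).fn (β x) = 0 ↔ (DiscType.oct i).fn x = 0) :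
    SignPres (DiscType.oct i).fn β (skel 3) := by
  obtain ⟨a, b, c, d, ho, e⟩ := exists_ordering i
  refine signPres_of_zero hβ.cont hβs hβ.bij.mapsTo (skel_subset 3) (continuous_fn _) hz
    fun x hx hx0 => ?_
  rw [e] at hx0 ⊢
  exact ho.exists_segment' hx hx0

theorem sign_oct_conical (i : Fin 3) (x : Vec) {r : ℝ} (hr : 0 < r) :
    SignType.sign ((DiscType.oct i).fn (bary Finset.univ + r • (x - bary Finset.univ))) =
      SignType.sign ((DiscType.oct i).fn x) := by
  obtain ⟨a, b, c, d, ho, e⟩ := exists_ordering i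
  rw [e, octFun_conical a b c d x hr, sign_mul, sign_pos hr, one_mul]

theorem exists_oct_ext {i : Fin 3} {β : Vec → Vec} (hβ : HomeoOn β (skel 3))
    (hβs : SuppPres β (skel 3))
    (hz : ∀ x ∈ skel 3, (DiscType.oct i).fn (β x) = 0 ↔ (DiscType.oct i).fn x = 0) :
    ∃ m, HomeoOn m simplex ∧ SuppPres m simplex ∧ EqOn m β (skel 3) ∧
      SignPres (DiscType.oct i).fn m simplex := by
  have hsp := signPres_oct hβ hβs hz
  have e1 : PolyBd (faceFlat Finset.univ) (faceCoords Finset.univ) = skel 3 := by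
    rw [← faceBd_eq_polyBd, faceBd_univ]
  have e2 : Polytope (faceFlat Finset.univ) (faceCoords Finset.univ) = simplex := by
    rw [← face_eq_polytope, face_univ]
  obtain ⟨m, m1, m2, m3, m4⟩ := HomeoOn.exists_cone_ext (isFlat_faceFlat Finset.univ)
    (bary_mem Finset.univ_nonempty) (isBounded_face _) (e1 ▸ hβ)
  rw [e1] at m2 m4
  rw [e2] at m1 m4
  refine ⟨m, m1, fun x hx => ?_, m2, m4 _ (fun x _ r hr _ => sign_oct_conical i x hr) hsp⟩
  rw [← e2] at hx
  rcases poly_cases hx with h | h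
  · rw [e1] at h; rw [m2 h]; exact hβs x h
  · rw [(mem_faceInt.1 h).2, (mem_faceInt.1 (m3 x h)).2]

theorem exists_place_oct {C : List (Vec →L[ℝ] ℝ)} {D : Set Vec} {i : Fin 3}
    (h : IsDiscVec (.oct i) D)
    (hC : ∀ ℓ ∈ C, (∀ x ∈ D ∪ {x | x ∈ simplex ∧ (DiscType.oct i).fn x = 0}, 0 < ℓ x) ∨
      ∀ x ∈ D ∪ {x | x ∈ simplex ∧ (DiscType.oct i).fn x = 0}, ℓ x < 0) :
    ∃ G, HomeoOn G simplex ∧ SuppPres G simplex ∧ (∀ ℓ ∈ C, SignPres ℓ G simplex) ∧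
      ∀ x ∈ simplex, (DiscType.oct i).fn (G x) = 0 ↔ x ∈ D := by
  obtain ⟨a, b, c, d, ho, e⟩ := exists_ordering i
  have hcl := h.isClosed
  obtain ⟨hD, κ, hκ, hκs, hκD⟩ := h
  obtain ⟨G, g1, g2, g3, g4⟩ := exists_place' (C := C)
    (D' := {x | x ∈ simplex ∧ (DiscType.oct i).fn x = 0})
    (F := fun s => if a ∈ s ∧ b ∈ s then octCutters a b else octCutters c d) hcl hκ hκs
    (fun x hx => by rw [hκD x hx, mem_ofPred_eq, and_iff_right (hκ.mem hx)])
    hC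
    (fun s hs x hx => by
      rw [mem_ofPred_eq, and_iff_right hx.1, e, ho.octFun_face hs hx])
    (fun β hβ hβs hβD => by
      obtain ⟨m, m1, m2, m3, m4⟩ := exists_oct_ext (i := i) hβ hβs fun x hx => by
        have := hβD x hx
        simpa only [mem_ofPred_eq, hx.1, (hβ.mem hx).1, true_and] using this
      refine ⟨m, m1, m2, m3, fun x hx => ?_⟩
      simp only [mem_ofPred_eq, hx, m1.mem hx, true_and]
      exact m4.eq_zero_iff hx)
  refine ⟨G, g1, g2, g3, fun x hx => ?_⟩
  rw [← g4 x hx, mem_ofPred_eq, and_iff_right (g1.mem hx)]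

/-! ### Standard positions -/

namespace DiscType

instance : Finite DiscType :=
  Finite.of_surjective
    (fun s : Fin 4 ⊕ Fin 3 ⊕ Fin 3 => Sum.elim tri (Sum.elim quad oct) s) fun τ => by
      cases τ with
      | tri v => exact ⟨.inl v, rfl⟩
      | quad i => exact ⟨.inr (.inl i), rfl⟩
      | oct i => exact ⟨.inr (.inr i), rfl⟩

/-- The level of the `j`-th standard disc. -/
noncomputable def level : DiscType → ℕ → ℝ
  | .tri _, j => 1 - 1 / (j + 5)
  | _, j => 1 / 2 - 1 / (j + 5)

/-- The function that vanishes on the `j`-th standard disc. -/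
noncomputable def stdFn : DiscType → ℕ → Vec → ℝ
  | .oct i, _ => (DiscType.oct i).fn
  | τ, j => fun x => ∑ i ∈ τ.side, x i - τ.level j

theorem stdFn_of_flat {τ : DiscType} (h : τ.IsFlat) (j : ℕ) (x : Vec) :
    τ.stdFn j x = ∑ i ∈ τ.side, x i - τ.level j := by
  cases τ with
  | tri v => rfl
  | quad i => rfl
  | oct i => exact h.elim

theorem one_div_add_five (j : ℕ) : 0 < (1 : ℝ) / (j + 5) ∧ (1 : ℝ) / (j + 5) ≤ 1 / 5 :=
  ⟨by positivity, one_div_le_one_div_of_le (by norm_num) (by linarith [j.cast_nonneg (α := ℝ)])⟩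

/-- The offset 5 in the levels keeps triangles at height at least 4/5. This is above the octagons,
whose coordinates are at most 3/4, and above the quadrilaterals, whose coordinates are at most 7/10.
-/
theorem level_tri (v : Fin 4) (j : ℕ) : 4 / 5 ≤ (tri v).level j ∧ (tri v).level j < 1 := by
  have := one_div_add_five j
  simp only [level]
  constructor <;> linarith

theorem level_quad (i : Fin 3) (j : ℕ) : 3 / 10 ≤ (quad i).level j ∧ (quad i).level j < 1 / 2 := by
  have := one_div_add_five j
  simp only [level]
  constructor <;> linarith

theorem level_mem (τ : DiscType) (j : ℕ) : 0 < τ.level j ∧ τ.level j < 1 := by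
  have := one_div_add_five j
  cases τ <;> simp only [level] <;> constructor <;> linarith

theorem level_strictMono (τ : DiscType) : StrictMono τ.level := by
  intro i j h
  have : (1 : ℝ) / (j + 5) < 1 / (i + 5) :=
    one_div_lt_one_div_of_lt (by positivity) (by have : (i : ℝ) < j := by exact_mod_cast h
                                                 linarith)
  cases τ <;> simp only [level] <;> linarith

/-- The `j`-th standard disc of a type. -/
def stdDisc (τ : DiscType) (j : ℕ) : Set Vec := {x | x ∈ simplex ∧ τ.stdFn j x = 0}

/-- Discs of type `τ` meet the edge `pq`. -/
def Meets (τ : DiscType) (p q : Fin 4) : Prop := p ≠ q ∧ (τ.IsFlat → p ∈ τ.side ∧ q ∉ τ.side)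

theorem le_of_oct {i : Fin 3} {x : Vec} (hx : x ∈ simplex) (h : (oct i).fn x = 0) (v : Fin 4) :
    x v ≤ 3 / 4 := by
  have h1 := hx.2
  rw [Fin.sum_univ_four] at h1
  have hn := hx.1
  have h0 := hn 0
  have h1' := hn 1
  have h2 := hn 2
  have h3 := hn 3
  have key : ∀ a b c d : Fin 4, octFun a b c d x = 0 → x a + x b + x c + x d = 1 →
      x a ≤ 3 / 4 ∧ x b ≤ 3 / 4 ∧ x c ≤ 3 / 4 ∧ x d ≤ 3 / 4 := by
    intro a b c d h hs
    have ha := hn a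
    have hb := hn b
    have hc := hn c
    have hd := hn d
    simp only [octFun] at h
    rcases abs_cases (x a - x b) with ⟨e1, -⟩ | ⟨e1, -⟩ <;>
      rcases abs_cases (x c - x d) with ⟨e2, -⟩ | ⟨e2, -⟩ <;> rw [e1, e2] at h <;>
      refine ⟨?_, ?_, ?_, ?_⟩ <;> linarith
  have fin : ∀ a b c d : Fin 4, (∀ v, v = a ∨ v = b ∨ v = c ∨ v = d) →
      octFun a b c d x = 0 → x a + x b + x c + x d = 1 → x v ≤ 3 / 4 := by
    intro a b c d hv h hs
    obtain ⟨e1, e2, e3, e4⟩ := key a b c d h hs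
    rcases hv v with rfl | rfl | rfl | rfl <;> assumption
  obtain ⟨a, b, c, d, ho, e⟩ := exists_ordering i
  refine fin a b c d ho.1 (e ▸ h) ?_
  rw [← ho.2, hx.2]

/-- A triangle at `v` misses the edges of the opposite face, whereas discs of any other type meet
one of them. This separates such discs from the triangles at `v`. -/
theorem exists_meets_tri (τ : DiscType) (v : Fin 4) (h : DiscType.tri v ≠ τ) :
    ∃ p q, τ.Meets p q ∧ p ≠ v ∧ q ≠ v := by
  have h3 : ∀ v w : Fin 4, v ≠ w → ∃ q, w ≠ q ∧ q ≠ v := by decide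
  have h4 : ∀ v : Fin 4, ∀ i : Fin 3, ∃ p q : Fin 4, p ≠ q ∧
    (p ∈ (quad i).side ∧ q ∉ (quad i).side) ∧ p ≠ v ∧ q ≠ v := by decide
  cases τ with
  | tri w =>
    have hvw : v ≠ w := fun e => h (by rw [e])
    obtain ⟨q, h1, h2⟩ := h3 v w hvw
    exact ⟨w, q, ⟨h1, fun _ => by simp [side, h1.symm]⟩, hvw.symm, h2⟩
  | quad i =>
    obtain ⟨p, q, h1, h2, h3⟩ := h4 v i
    exact ⟨p, q, ⟨h1, fun _ => h2⟩, h3⟩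
  | oct i =>
    obtain ⟨p, q, h1, h2, h3⟩ := h4 v i
    exact ⟨p, q, ⟨h1, fun h => h.elim⟩, h3⟩

theorem mem_stdDisc_tri {v : Fin 4} {j : ℕ} {x : Vec} :
    x ∈ (tri v).stdDisc j ↔ x ∈ simplex ∧ x v = (tri v).level j := by
  simp [stdDisc, stdFn, side, sub_eq_zero]

theorem lt_of_mem_stdDisc {τ : DiscType} {v : Fin 4} (h : DiscType.tri v ≠ τ) {k : ℕ} {x : Vec}
    (hx : x ∈ τ.stdDisc k) : x v < 4 / 5 := by
  cases τ with
  | tri w =>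
    rw [mem_stdDisc_tri] at hx
    have hvw : v ≠ w := fun e => h (by rw [e])
    have : x v + x w ≤ 1 := by
      rw [← hx.1.2, ← Finset.sum_pair hvw]
      exact Finset.sum_le_sum_of_subset_of_nonneg (Finset.subset_univ _) fun i _ _ => hx.1.1 i
    linarith [level_tri w k, hx.2]
  | quad i =>
    have h1 := hx.2
    rw [stdFn_of_flat (τ := quad i) trivial] at h1
    have h2 := level_quad i k
    by_cases hv : v ∈ (quad i).side
    · have := Finset.single_le_sum (fun i _ => hx.1.1 i) hv
      linarith
    · have := Finset.sum_le_sum_of_subset_of_nonneg (Finset.subset_univ (insert v (quad i).side))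
        fun i _ _ => hx.1.1 i
      rw [Finset.sum_insert hv, hx.1.2] at this
      linarith
  | oct i => linarith [le_of_oct hx.1 hx.2 v]

/-- Other quadrilaterals and octagons meet edges on both sides of a quadrilateral. -/
theorem exists_meets_quad {i : Fin 3} {τ : DiscType} (h : DiscType.quad i ≠ τ)
    (hτ : ∀ v, τ ≠ .tri v) :
    (∃ p q, τ.Meets p q ∧ p ∈ (quad i).side ∧ q ∈ (quad i).side) ∧
      ∃ p q, τ.Meets p q ∧ p ∉ (quad i).side ∧ q ∉ (quad i).side := by
  have hq : ∀ i : Fin 3, (∃ p q : Fin 4, p ≠ q ∧ p ∈ (quad i).side ∧ q ∈ (quad i).side) ∧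
    ∃ p q : Fin 4, p ≠ q ∧ p ∉ (quad i).side ∧ q ∉ (quad i).side := by decide
  have hqq : ∀ i k : Fin 3, i ≠ k →
    (∃ p q : Fin 4, p ≠ q ∧ (p ∈ (quad k).side ∧ q ∉ (quad k).side) ∧ p ∈ (quad i).side ∧
      q ∈ (quad i).side) ∧
    ∃ p q : Fin 4, p ≠ q ∧ (p ∈ (quad k).side ∧ q ∉ (quad k).side) ∧ p ∉ (quad i).side ∧
      q ∉ (quad i).side := by decide
  cases τ with
  | tri v => exact (hτ v rfl).elim
  | quad k =>
    obtain ⟨⟨p, q, h1, h2, h3⟩, ⟨p', q', h1', h2', h3'⟩⟩ := hqq i k fun e => h (by rw [e])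
    exact ⟨⟨p, q, ⟨h1, fun _ => h2⟩, h3⟩, ⟨p', q', ⟨h1', fun _ => h2'⟩, h3'⟩⟩
  | oct k =>
    obtain ⟨⟨p, q, h1, h3⟩, ⟨p', q', h1', h3'⟩⟩ := hq i
    exact ⟨⟨p, q, ⟨h1, fun h => h.elim⟩, h3⟩, ⟨p', q', ⟨h1', fun h => h.elim⟩, h3'⟩⟩

/-- The position of a standard disc relative to a standard triangle or quadrilateral of another
type. -/
theorem std_side {σ τ : DiscType} (hσ : σ.IsFlat) (h : σ ≠ τ) (j k : ℕ) :
    (∃ p q, τ.Meets p q ∧ p ∈ σ.side ∧ q ∈ σ.side) ∧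
        (∃ p q, τ.Meets p q ∧ p ∉ σ.side ∧ q ∉ σ.side) ∨
      (∃ p q, τ.Meets p q ∧ p ∈ σ.side ∧ q ∈ σ.side) ∧ (∀ x ∈ τ.stdDisc k, 0 < σ.stdFn j x) ∨
      (∃ p q, τ.Meets p q ∧ p ∉ σ.side ∧ q ∉ σ.side) ∧ ∀ x ∈ τ.stdDisc k, σ.stdFn j x < 0 := by
  cases σ with
  | tri v =>
    obtain ⟨p, q, h1, h2, h3⟩ := exists_meets_tri τ v h
    refine Or.inr (Or.inr ⟨⟨p, q, h1, by simpa [side] using h2, by simpa [side] using h3⟩, fun x hx => ?_⟩)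
    simp only [stdFn, side, Finset.sum_singleton]
    linarith [lt_of_mem_stdDisc h hx, level_tri v j]
  | quad i =>
    have ht : ∀ i : Fin 3, ∀ v : Fin 4, (v ∈ (quad i).side → ∃ q, v ≠ q ∧ q ∈ (quad i).side) ∧
      (v ∉ (quad i).side → ∃ q, v ≠ q ∧ q ∉ (quad i).side) := by decide
    cases τ with
    | tri v =>
      by_cases hv : v ∈ (quad i).side
      · obtain ⟨q, h1, h2⟩ := (ht i v).1 hv
        refine Or.inr (Or.inl ⟨⟨v, q, ⟨h1, fun _ => by simp [side, h1.symm]⟩, hv, h2⟩, fun x hx => ?_⟩)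
        rw [mem_stdDisc_tri] at hx
        rw [stdFn_of_flat hσ]
        have := Finset.single_le_sum (fun i _ => hx.1.1 i) hv
        linarith [level_tri v k, level_quad i j]
      · obtain ⟨q, h1, h2⟩ := (ht i v).2 hv
        refine Or.inr (Or.inr ⟨⟨v, q, ⟨h1, fun _ => by simp [side, h1.symm]⟩, hv, h2⟩, fun x hx => ?_⟩)
        rw [mem_stdDisc_tri] at hx
        rw [stdFn_of_flat hσ]
        have := Finset.sum_le_sum_of_subset_of_nonneg (Finset.subset_univ (insert v (quad i).side))
          fun i _ _ => hx.1.1 i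
        rw [Finset.sum_insert hv, hx.1.2] at this
        linarith [level_tri v k, level_quad i j]
    | quad k => exact Or.inl (exists_meets_quad h (by simp))
    | oct k => exact Or.inl (exists_meets_quad h (by simp))
  | oct i => exact hσ.elim

end DiscType

open DiscType

theorem pos_of_preconnected {f : Vec → ℝ} (hf : Continuous f) {D : Set Vec} (hD : IsPreconnected D)
    (h0 : ∀ x ∈ D, f x ≠ 0) {y : Vec} (hy : y ∈ D) (hpos : 0 < f y) : ∀ x ∈ D, 0 < f x := by
  intro x hx
  by_contra h
  obtain ⟨z, hz, e⟩ := hD.intermediate_value hx hy hf.continuousOn ⟨not_lt.1 h, hpos.le⟩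
  exact h0 z hz e

theorem neg_of_preconnected {f : Vec → ℝ} (hf : Continuous f) {D : Set Vec} (hD : IsPreconnected D)
    (h0 : ∀ x ∈ D, f x ≠ 0) {y : Vec} (hy : y ∈ D) (hneg : f y < 0) : ∀ x ∈ D, f x < 0 := by
  have := pos_of_preconnected (f := fun x => -f x) hf.neg hD (fun x hx => neg_ne_zero.2 (h0 x hx)) hy
    (neg_pos.2 hneg)
  exact fun x hx => neg_pos.1 (this x hx)

theorem DiscType.continuous_stdFn (τ : DiscType) (j : ℕ) : Continuous (τ.stdFn j) := by
  cases τ with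
  | tri v => simp only [stdFn]; fun_prop
  | quad v => simp only [stdFn]; fun_prop
  | oct i => exact continuous_fn (.oct i)

theorem sum_eq_one_of_supp {s r : Finset (Fin 4)} {x : Vec} (hx : x ∈ face r) (h : r ⊆ s) :
    ∑ i ∈ s, x i = 1 := by
  rw [← hx.1.2]
  exact Finset.sum_subset (Finset.subset_univ _) fun i _ hi => supp_subset.1 hx.2 i fun h' => hi (h h')

theorem sum_eq_zero_of_supp {s r : Finset (Fin 4)} {x : Vec} (hx : x ∈ face r) (h : ∀ i ∈ r, i ∉ s) :
    ∑ i ∈ s, x i = 0 :=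
  Finset.sum_eq_zero fun i hi => supp_subset.1 hx.2 i fun h' => h i h' hi

theorem IsDiscVec.exists_stdFn_pos {σ τ : DiscType} {D : Set Vec} (h : IsDiscVec τ D)
    (hσ : σ.IsFlat) (j : ℕ) (hpq : ∃ p q, τ.Meets p q ∧ p ∈ σ.side ∧ q ∈ σ.side) :
    ∃ x ∈ D, 0 < σ.stdFn j x := by
  obtain ⟨p, q, hm, hp, hq⟩ := hpq
  obtain ⟨x, hx, hxe⟩ := h.exists_mem_edge hm.1 hm.2
  refine ⟨x, hx, ?_⟩
  rw [stdFn_of_flat hσ, sum_eq_one_of_supp hxe (by simp [Finset.insert_subset_iff, hp, hq])]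
  linarith [σ.level_mem j]

theorem IsDiscVec.exists_stdFn_neg {σ τ : DiscType} {D : Set Vec} (h : IsDiscVec τ D)
    (hσ : σ.IsFlat) (j : ℕ) (hpq : ∃ p q, τ.Meets p q ∧ p ∉ σ.side ∧ q ∉ σ.side) :
    ∃ x ∈ D, σ.stdFn j x < 0 := by
  obtain ⟨p, q, hm, hp, hq⟩ := hpq
  obtain ⟨x, hx, hxe⟩ := h.exists_mem_edge hm.1 hm.2
  refine ⟨x, hx, ?_⟩
  rw [stdFn_of_flat hσ, sum_eq_zero_of_supp hxe (by simp [hp, hq])]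
  linarith [σ.level_mem j]

/-- A disc that misses a standard disc of another type lies on the same side of it as the standard
discs of its own type. -/
theorem IsDiscVec.same_side {σ τ : DiscType} {D : Set Vec} (h : IsDiscVec τ D)
    (hD : IsPreconnected D) (hσ : σ.IsFlat) (hne : σ ≠ τ) (j k : ℕ)
    (h0 : ∀ x ∈ D, σ.stdFn j x ≠ 0) :
    (∀ x ∈ D ∪ τ.stdDisc k, 0 < σ.stdFn j x) ∨ ∀ x ∈ D ∪ τ.stdDisc k, σ.stdFn j x < 0 := by
  have hc := σ.continuous_stdFn j
  -- A connected disc that misses the standard one lies on the same side as any of its points on an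
  -- edge. In the first case it has points on both sides, which is impossible.
  rcases std_side hσ hne j k with ⟨h1, h2⟩ | ⟨h1, h2⟩ | ⟨h1, h2⟩
  · obtain ⟨x, hx, hpos⟩ := h.exists_stdFn_pos hσ j h1
    obtain ⟨y, hy, hneg⟩ := h.exists_stdFn_neg hσ j h2
    exact absurd (pos_of_preconnected hc hD h0 hx hpos y hy) hneg.not_gt
  · obtain ⟨x, hx, hpos⟩ := h.exists_stdFn_pos hσ j h1
    exact Or.inl fun y hy => hy.elim (pos_of_preconnected hc hD h0 hx hpos y) (h2 y)
  · obtain ⟨x, hx, hneg⟩ := h.exists_stdFn_neg hσ j h1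
    exact Or.inr fun y hy => hy.elim (neg_of_preconnected hc hD h0 hx hneg y) (h2 y)

open DiscType

/-! ### Simultaneous standardisation of disjoint discs -/

theorem cutter_eq_stdFn {σ : DiscType} (hσ : σ.IsFlat) (j : ℕ) {x : Vec} (hx : x ∈ simplex) :
    cutter σ.side (σ.level j) x = σ.stdFn j x := by
  rw [cutter_apply hx, stdFn_of_flat hσ]

/-- The standard triangles and quadrilaterals with given numbers. -/
theorem exists_stdCutters (m : DiscType → ℕ) : ∃ C : List (Vec →L[ℝ] ℝ), ∀ ℓ, ℓ ∈ C ↔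
    ∃ σ : DiscType, σ.IsFlat ∧ ∃ j < m σ, ℓ = cutter σ.side (σ.level j) := by
  have hf : {ℓ : Vec →L[ℝ] ℝ |
      ∃ σ : DiscType, σ.IsFlat ∧ ∃ j < m σ, ℓ = cutter σ.side (σ.level j)}.Finite := by
    have : {ℓ : Vec →L[ℝ] ℝ | ∃ σ : DiscType, σ.IsFlat ∧ ∃ j < m σ, ℓ = cutter σ.side (σ.level j)} ⊆
        ⋃ σ : DiscType, (fun j => cutter σ.side (σ.level j)) '' Iio (m σ) := by
      rintro _ ⟨σ, -, j, hj, rfl⟩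
      exact mem_iUnion.2 ⟨σ, j, hj, rfl⟩
    exact (Set.finite_iUnion fun σ => (Set.finite_Iio _).image _).subset this
  exact ⟨hf.toFinset.toList, fun ℓ => by simp⟩

theorem signPres_cutter_iff {σ : DiscType} (hσ : σ.IsFlat) (j : ℕ) {g : Vec → Vec} {K : Set Vec}
    (hg : MapsTo g K simplex) (hK : K ⊆ simplex) :
    SignPres (cutter σ.side (σ.level j)) g K ↔ SignPres (σ.stdFn j) g K := by
  refine ⟨fun h x hx => ?_, fun h x hx => ?_⟩
  · rw [← cutter_eq_stdFn hσ j (hK hx), ← cutter_eq_stdFn hσ j (hg hx)]; exact h x hx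
  · rw [cutter_eq_stdFn hσ j (hK hx), cutter_eq_stdFn hσ j (hg hx)]; exact h x hx

open Classical in
/-- The number of discs of a type in a finite family. -/
noncomputable def typeCount {ι : Type} (R : Finset ι) (τ : ι → DiscType) (σ : DiscType) : ℕ :=
  (R.filter fun i => τ i = σ).card

open Classical in
theorem typeCount_erase {ι : Type} {R : Finset ι} {τ : ι → DiscType} {i : ι} (hi : i ∈ R)
    (σ : DiscType) :
    typeCount R τ σ = typeCount (R.erase i) τ σ + if σ = τ i then 1 else 0 := by
  rw [typeCount, typeCount, Finset.filter_erase]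
  split_ifs with h
  · rw [Finset.card_erase_add_one (by simp [hi, h])]
  · rw [Finset.erase_eq_of_notMem (by simp [Ne.symm h]), add_zero]

/-- Bookkeeping: once a disc of type `σ` is put at index `m σ`, the indices still to be filled for
this type start one later, and there is one fewer of them. -/
theorem placed_step_index (m c c' : DiscType → ℕ) (σ : DiscType) (e : DiscType → ℕ)
    (he : e σ = 1) (he' : ∀ τ ≠ σ, e τ = 0) (hc : ∀ τ, c τ = c' τ + e τ) (P : DiscType → ℕ → Prop) :
    (∃ τ j, m τ ≤ j ∧ j < m τ + c τ ∧ P τ j) ↔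
      P σ (m σ) ∨ ∃ τ j, m τ + e τ ≤ j ∧ j < m τ + e τ + c' τ ∧ P τ j := by
  constructor
  · rintro ⟨τ, j, h1, h2, h3⟩
    by_cases hτ : τ = σ
    · subst hτ
      rcases h1.eq_or_lt with rfl | h
      · exact Or.inl h3
      · exact Or.inr ⟨τ, j, by omega, by have := hc τ; omega, h3⟩
    · have := he' τ hτ
      have := hc τ
      exact Or.inr ⟨τ, j, by omega, by omega, h3⟩
  · rintro (h | ⟨τ, j, h1, h2, h3⟩)
    · exact ⟨σ, m σ, le_rfl, by have := hc σ; omega, h⟩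
    · exact ⟨τ, j, by omega, by have := hc τ; omega, h3⟩

theorem exists_side_pair {τ : DiscType} (h : τ.IsFlat) : ∃ p q, p ∈ τ.side ∧ q ∉ τ.side := by
  have h1 : ∀ v : Fin 4, ∃ q, q ≠ v := by decide
  have h2 : ∀ i : Fin 3, ∃ p q, p ∈ (quad i).side ∧ q ∉ (quad i).side := by decide
  cases τ with
  | tri v => obtain ⟨q, hq⟩ := h1 v; exact ⟨v, q, by simp [side], by simpa [side] using hq⟩
  | quad i => exact h2 i
  | oct i => exact h.elim

/-- Beyond a flat disc on an edge. -/
theorem stdFn_pos_of_beyond {τ : DiscType} (hτ : τ.IsFlat) {D₀ : Set Vec} (hD₀ : IsDiscVec τ D₀)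
    {j : ℕ} {G : Vec → Vec} (hG : HomeoOn G simplex) (hGs : SuppPres G simplex)
    (hGD : ∀ x ∈ simplex, τ.stdFn j (G x) = 0 ↔ x ∈ D₀) {p q : Fin 4} (hp : p ∈ τ.side)
    (hq : q ∉ τ.side) {x₀ y : Vec} (hx₀ : x₀ ∈ D₀) (hx₀e : x₀ ∈ face {p, q}) (hye : y ∈ face {p, q})
    (hlt : x₀ p < y p) : 0 < τ.stdFn j (G y) := by
  have hpq : p ≠ q := by rintro rfl; exact hq hp
  -- The part of the edge from `y` to the vertex `p` misses `D₀`, which meets the edge only in `x₀`.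
  -- The image of this part contains the fixed vertex `p`, where the function is positive.
  let seg : Set Vec := (fun t : ℝ => t • vert p + (1 - t) • vert q) '' Icc (y p) 1
  have hy0 : 0 ≤ y p := hye.1.1 p
  have hy1 : y p ≤ 1 := by
    have := Finset.single_le_sum (fun i _ => hye.1.1 i) (Finset.mem_univ p)
    rwa [hye.1.2] at this
  have hsub : seg ⊆ simplex := by
    rintro _ ⟨t, ht, rfl⟩
    exact (edge_point_mem p q ⟨hy0.trans ht.1, ht.2⟩).1
  have hseg : IsPreconnected (G '' seg) :=
    (isPreconnected_Icc.image _ (by fun_prop)).image _ (hG.cont.mono hsub)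
  refine pos_of_preconnected (τ.continuous_stdFn j) hseg ?_ (y := G (vert p)) ?_ ?_ _ ?_
  · rintro _ ⟨_, ⟨t, ht, rfl⟩, rfl⟩ h0
    have hm := edge_point_mem p q ⟨hy0.trans ht.1, ht.2⟩
    have := hD₀.subsingleton_edge hτ hp hq ((hGD _ hm.1).1 h0) hx₀ hm hx₀e
    have := congrFun this p
    simp [vert, hpq] at this
    linarith [ht.1]
  · exact ⟨_, ⟨1, ⟨hy1, le_rfl⟩, by simp⟩, rfl⟩
  · rw [hGs.fix_vert hG.bij.mapsTo (vert_mem p), stdFn_of_flat hτ]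
    have : ∑ i ∈ τ.side, vert p i = 1 := by simp [vert, Pi.single_apply, hp]
    rw [this]
    linarith [τ.level_mem j]
  · exact ⟨_, ⟨y p, ⟨le_rfl, hy1⟩, (mem_edge_eq hpq hye).symm⟩, rfl⟩

-- Discs are placed one at a time, flat ones first. `m σ` counts the standard discs of type `σ` that
-- are already occupied, and every later map preserves the sides of these. Among the remaining discs
-- of one flat type, the next is the one farthest from `p` along a fixed edge `pq` with `p` in
-- `side`; the others of that type then lie beyond it, matching the increase of the levels. For
-- discs of other types, `same_side` fixes the side. At the end at most an octagon is left.
open Classical in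
theorem exists_standardise_aux {ι : Type} (τ : ι → DiscType) (N : ℕ) :
    ∀ (R : Finset ι) (D : ι → Set Vec) (m : DiscType → ℕ), R.card = N →
    (∀ i ∈ R, IsDiscVec (τ i) (D i)) → (∀ i ∈ R, IsPreconnected (D i)) →
    (∀ i ∈ R, ∀ j ∈ R, i ≠ j → Disjoint (D i) (D j)) →
    (∀ i ∈ R, ∀ σ : DiscType, σ.IsFlat → ∀ j < m σ, ∀ x ∈ D i, σ.stdFn j x ≠ 0) →
    (∀ i ∈ R, (τ i).IsFlat → ∀ j < m (τ i), ∀ x ∈ D i, 0 < (τ i).stdFn j x) →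
    (∀ i ∈ R, ∀ j ∈ R, ¬ (τ i).IsFlat → ¬ (τ j).IsFlat → i = j) →
    ∃ G, HomeoOn G simplex ∧ SuppPres G simplex ∧
      (∀ σ : DiscType, σ.IsFlat → ∀ j < m σ, SignPres (σ.stdFn j) G simplex) ∧
      ∀ x ∈ simplex, (∃ i ∈ R, x ∈ D i) ↔
        ∃ σ j, m σ ≤ j ∧ j < m σ + typeCount R τ σ ∧ G x ∈ σ.stdDisc j := by
  induction N with
  | zero =>
    intro R D m hR _ _ _ _ _ _
    obtain rfl := Finset.card_eq_zero.1 hR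
    refine ⟨id, HomeoOn.id _, fun x _ => rfl, fun σ _ j _ x _ => rfl, fun x _ => ?_⟩
    simp only [Finset.notMem_empty, false_and, exists_false, false_iff]
    rintro ⟨σ, j, h1, h2, -⟩
    simp [typeCount] at h2
    omega
  | succ N ih =>
    intro R D m hR hdisc hconn hdisj havoid hside hoct
    obtain ⟨C, hC⟩ := exists_stdCutters m
    have hcut : ∀ i ∈ R, ∀ k, (∀ σ : DiscType, σ.IsFlat → ∀ j < m σ, σ = τ i →
        ∀ x ∈ (τ i).stdDisc k, 0 < (τ i).stdFn j x) → ∀ ℓ ∈ C,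
        (∀ x ∈ D i ∪ (τ i).stdDisc k, 0 < ℓ x) ∨ ∀ x ∈ D i ∪ (τ i).stdDisc k, ℓ x < 0 := by
      intro i hi k hk ℓ hℓ
      obtain ⟨σ, hσ, j, hj, rfl⟩ := (hC ℓ).1 hℓ
      have hs : D i ∪ (τ i).stdDisc k ⊆ simplex :=
        union_subset (hdisc i hi).1 fun x hx => hx.1
      have : (∀ x ∈ D i ∪ (τ i).stdDisc k, 0 < σ.stdFn j x) ∨
          ∀ x ∈ D i ∪ (τ i).stdDisc k, σ.stdFn j x < 0 := by
        by_cases e : σ = τ i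
        · have h2 := hk σ hσ j hj e
          subst e
          exact Or.inl fun x hx => hx.elim (hside i hi hσ j hj x) (h2 x)
        · exact (hdisc i hi).same_side (hconn i hi) hσ e j k (havoid i hi σ hσ j hj)
      refine this.imp (fun h x hx => ?_) fun h x hx => ?_
      · rw [cutter_eq_stdFn hσ j (hs hx)]; exact h x hx
      · rw [cutter_eq_stdFn hσ j (hs hx)]; exact h x hx
    by_cases hfl : ∃ i ∈ R, (τ i).IsFlat
    · obtain ⟨i₁, hi₁, hflat⟩ := hfl
      obtain ⟨p, q, hp, hq⟩ := exists_side_pair hflat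
      have hpq : p ≠ q := by rintro rfl; exact hq hp
      have hpt : ∀ i, ∃ y : Vec, i ∈ R → τ i = τ i₁ → y ∈ D i ∧ y ∈ face {p, q} := by
        intro i
        by_cases h : i ∈ R ∧ τ i = τ i₁
        · obtain ⟨y, hy⟩ := (hdisc i h.1).exists_mem_edge hpq fun _ => by rw [h.2]; exact ⟨hp, hq⟩
          exact ⟨y, fun _ _ => hy⟩
        · exact ⟨0, fun h1 h2 => (h ⟨h1, h2⟩).elim⟩
      choose y hy using hpt
      obtain ⟨i₀, hi₀, hmin⟩ := (R.filter fun i => τ i = τ i₁).exists_min_image (fun i => y i p)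
        ⟨i₁, by simp [hi₁]⟩
      obtain ⟨hi₀R, hi₀τ⟩ := Finset.mem_filter.1 hi₀
      rw [← hi₀τ] at hflat hp hq hmin
      obtain ⟨hy₀, hy₀e⟩ := hy i₀ hi₀R hi₀τ
      obtain ⟨G₀, g1, g2, g3, g4⟩ := exists_place_flat (C := C) (hdisc i₀ hi₀R) hflat
        ((τ i₀).level_mem (m (τ i₀))).1 ((τ i₀).level_mem (m (τ i₀))).2 (by
          have := hcut i₀ hi₀R (m (τ i₀)) fun σ hσ j hj e x hx => by
            subst e
            have h1 := hx.2
            rw [stdFn_of_flat hσ] at h1 ⊢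
            linarith [(τ i₀).level_strictMono hj]
          rwa [show {x | x ∈ simplex ∧ cutter (τ i₀).side ((τ i₀).level (m (τ i₀))) x = 0} =
            (τ i₀).stdDisc (m (τ i₀)) from Set.ext fun x => and_congr_right fun hx => by
              rw [cutter_eq_stdFn hflat _ hx]])
      have g3' : ∀ σ : DiscType, σ.IsFlat → ∀ j < m σ, SignPres (σ.stdFn j) G₀ simplex :=
        fun σ hσ j hj => (signPres_cutter_iff hσ j g1.bij.mapsTo subset_rfl).1
          (g3 _ ((hC _).2 ⟨σ, hσ, j, hj, rfl⟩))
      have g4' : ∀ x ∈ simplex, (τ i₀).stdFn (m (τ i₀)) (G₀ x) = 0 ↔ x ∈ D i₀ := fun x hx => by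
        rw [← g4 x hx, cutter_eq_stdFn hflat _ (g1.mem hx)]
      let e : DiscType → ℕ := fun σ => if σ = τ i₀ then 1 else 0
      have he : e (τ i₀) = 1 := if_pos rfl
      have he' : ∀ σ ≠ τ i₀, e σ = 0 := fun σ h => if_neg h
      have hD0 : ∀ i ∈ R.erase i₀, ∀ x ∈ D i, (τ i₀).stdFn (m (τ i₀)) (G₀ x) ≠ 0 := by
        intro i hi x hx h0
        obtain ⟨h1, h2⟩ := Finset.mem_erase.1 hi
        exact disjoint_left.1 (hdisj i h2 i₀ hi₀R h1) hx ((g4' x ((hdisc i h2).1 hx)).1 h0)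
      have hconn' : ∀ i ∈ R.erase i₀, IsPreconnected (G₀ '' D i) := fun i hi =>
        (hconn i (Finset.mem_of_mem_erase hi)).image _ (g1.cont.mono (hdisc i (Finset.mem_of_mem_erase hi)).1)
      have hlast : ∀ σ j, j < m σ + e σ → j < m σ ∨ σ = τ i₀ ∧ j = m (τ i₀) := by
        intro σ j hj
        by_cases h : σ = τ i₀
        · subst h; rw [he] at hj; rcases (Nat.lt_succ_iff.1 hj).eq_or_lt with h | h
          exacts [Or.inr ⟨rfl, h⟩, Or.inl h]
        · rw [he' σ h] at hj; exact Or.inl hj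
      -- The disc just placed now counts as a standard one, and the induction hypothesis is applied
      -- to the images of the others.
      obtain ⟨G₁, k1, k2, k3, k4⟩ := ih (R.erase i₀) (fun i => G₀ '' D i) (fun σ => m σ + e σ)
        (by rw [Finset.card_erase_of_mem hi₀R, hR]; rfl)
        (fun i hi => (hdisc i (Finset.mem_of_mem_erase hi)).image g1 g2)
        hconn'
        (fun i hi j hj hij => by
          have hi' := Finset.mem_of_mem_erase hi
          have hj' := Finset.mem_of_mem_erase hj
          rw [disjoint_left]
          rintro _ ⟨x, hx, rfl⟩ ⟨x', hx', e⟩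
          have := g1.inj ((hdisc j hj').1 hx') ((hdisc i hi').1 hx) e
          exact disjoint_left.1 (hdisj i hi' j hj' hij) hx (this ▸ hx'))
        (fun i hi σ hσ j hj => by
          rintro _ ⟨x, hx, rfl⟩
          have hi' := Finset.mem_of_mem_erase hi
          rcases hlast σ j hj with h | ⟨rfl, rfl⟩
          · rw [Ne, (g3' σ hσ j h).eq_zero_iff ((hdisc i hi').1 hx)]
            exact havoid i hi' σ hσ j h x hx
          · exact hD0 i hi x hx)
        (fun i hi hσ j hj => by
          have hi' := Finset.mem_of_mem_erase hi
          rcases hlast _ j hj with h | ⟨h, rfl⟩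
          · rintro _ ⟨x, hx, rfl⟩
            rw [(g3' _ hσ j h).pos_iff ((hdisc i hi').1 hx)]
            exact hside i hi' hσ j h x hx
          · obtain ⟨hyi, hyie⟩ := hy i hi' (h.trans hi₀τ)
            rw [h]
            refine pos_of_preconnected ((τ i₀).continuous_stdFn _) (hconn' i hi) ?_ ⟨_, hyi, rfl⟩
              (stdFn_pos_of_beyond hflat (hdisc i₀ hi₀R) g1 g2 g4' hp hq hy₀ hy₀e hyie ?_)
            · rintro _ ⟨x, hx, rfl⟩
              exact hD0 i hi x hx
            · refine (hmin i (Finset.mem_filter.2 ⟨hi', h⟩)).lt_of_ne fun e => ?_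
              have : y i₀ = y i := by rw [mem_edge_eq hpq hy₀e, mem_edge_eq hpq hyie, e]
              exact disjoint_left.1 (hdisj i hi' i₀ hi₀R (Finset.ne_of_mem_erase hi)) hyi (this ▸ hy₀))
        (fun i hi j hj => hoct i (Finset.mem_of_mem_erase hi) j (Finset.mem_of_mem_erase hj))
      refine ⟨G₁ ∘ G₀, k1.comp g1, fun x hx => by rw [Function.comp, k2 _ (g1.mem hx), g2 x hx],
        fun σ hσ j hj => ?_, fun x hx => ?_⟩
      · exact fun x hx => (k3 σ hσ j (hj.trans_le (Nat.le_add_right _ _)) _ (g1.mem hx)).trans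
          (g3' σ hσ j hj x hx)
      · rw [placed_step_index m _ _ (τ i₀) e he he' (typeCount_erase hi₀R)]
        have hx0 := g1.mem hx
        have h1 : (G₁ ∘ G₀) x ∈ (τ i₀).stdDisc (m (τ i₀)) ↔ x ∈ D i₀ := by
          rw [stdDisc, mem_ofPred_eq, Function.comp, and_iff_right (k1.mem hx0),
            (k3 _ hflat _ (by rw [he]; exact Nat.lt_succ_self _)).eq_zero_iff hx0, g4' x hx]
        rw [h1, Function.comp, ← k4 _ hx0]
        constructor
        · rintro ⟨i, hi, hxi⟩
          by_cases h : i = i₀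
          · exact Or.inl (h ▸ hxi)
          · exact Or.inr ⟨i, Finset.mem_erase.2 ⟨h, hi⟩, x, hxi, rfl⟩
        · rintro (h | ⟨i, hi, x', hx', e⟩)
          · exact ⟨i₀, hi₀R, h⟩
          · have hi' := Finset.mem_of_mem_erase hi
            exact ⟨i, hi', g1.inj ((hdisc i hi').1 hx') hx e ▸ hx'⟩
    · push Not at hfl
      obtain ⟨i, hi⟩ := Finset.card_pos.1 (by omega : 0 < R.card)
      have hRi : R = {i} := Finset.eq_singleton_iff_unique_mem.2
        ⟨hi, fun j hj => hoct j hj i hi (hfl j hj) (hfl i hi)⟩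
      obtain ⟨k, hk⟩ : ∃ k, τ i = .oct k := by
        have := hfl i hi
        cases h : τ i with
        | tri v => rw [h] at this; exact (this trivial).elim
        | quad v => rw [h] at this; exact (this trivial).elim
        | oct k => exact ⟨k, rfl⟩
      -- The index 0 is arbitrary, since an octagon type has only one standard disc.
      have hcut' := hcut i hi 0 fun σ hσ j _ e => by rw [e] at hσ; exact (hfl i hi hσ).elim
      have hd := hdisc i hi
      rw [hk] at hcut' hd
      obtain ⟨G, g1, g2, g3, g4⟩ := exists_place_oct hd (C := C) hcut'
      refine ⟨G, g1, g2, fun σ hσ j hj => (signPres_cutter_iff hσ j g1.bij.mapsTo subset_rfl).1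
          (g3 _ ((hC _).2 ⟨σ, hσ, j, hj, rfl⟩)), fun x hx => ?_⟩
      have hct : ∀ σ, typeCount R τ σ = if σ = .oct k then 1 else 0 := by
        intro σ
        rw [typeCount, hRi, Finset.filter_singleton, hk]
        by_cases h : σ = .oct k
        · simp [h]
        · simp [h, Ne.symm h]
      simp only [hct]
      rw [hRi]
      simp only [Finset.mem_singleton, exists_eq_left]
      rw [← g4 x hx]
      constructor
      · intro h
        exact ⟨.oct k, m (.oct k), le_rfl, by simp, g1.mem hx, h⟩
      · rintro ⟨σ, j, h1, h2, h3⟩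
        by_cases h : σ = .oct k
        · subst h; exact h3.2
        · rw [if_neg h] at h2; omega

/-- The union of the standard discs with given numbers. -/
def stdUnion (c : DiscType → ℕ) : Set Vec := {x | ∃ σ : DiscType, ∃ j < c σ, x ∈ σ.stdDisc j}

/-- A finite disjoint family of discs with at most one octagon can be moved to standard position. -/
theorem exists_standardise {ι : Type} {τ : ι → DiscType} {R : Finset ι} {D : ι → Set Vec}
    (h1 : ∀ i ∈ R, IsDiscVec (τ i) (D i)) (h2 : ∀ i ∈ R, IsPreconnected (D i))
    (h3 : ∀ i ∈ R, ∀ j ∈ R, i ≠ j → Disjoint (D i) (D j))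
    (h4 : ∀ i ∈ R, ∀ j ∈ R, ¬ (τ i).IsFlat → ¬ (τ j).IsFlat → i = j) :
    ∃ G, HomeoOn G simplex ∧ SuppPres G simplex ∧
      ∀ x ∈ simplex, (∃ i ∈ R, x ∈ D i) ↔ G x ∈ stdUnion (typeCount R τ) := by
  obtain ⟨G, g1, g2, -, g4⟩ := exists_standardise_aux τ R.card R D 0 rfl h1 h2 h3
    (fun i _ σ _ j hj => (Nat.not_lt_zero j hj).elim) (fun i _ _ j hj => (Nat.not_lt_zero j hj).elim) h4
  refine ⟨G, g1, g2, fun x hx => (g4 x hx).trans ?_⟩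
  simp [stdUnion]

open DiscType

/-! ### Monotone maps of edges -/

/-- The point of the edge `pq` with coordinate `r` at `p`. -/
noncomputable def edgePt (p q : Fin 4) (r : ℝ) : Vec := r • vert p + (1 - r) • vert q

theorem edgePt_swap (p q : Fin 4) (r : ℝ) : edgePt p q (1 - r) = edgePt q p r := by
  simp [edgePt, add_comm]

theorem edgePt_apply {p q : Fin 4} (h : p ≠ q) (r : ℝ) : edgePt p q r p = r := by
  simp [edgePt, vert, h]

theorem continuous_edgePt (p q : Fin 4) : Continuous (edgePt p q) := by
  unfold edgePt; fun_prop

theorem relabel_edgePt (π : Equiv.Perm (Fin 4)) (p q : Fin 4) (r : ℝ) :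
    relabel π (edgePt p q r) = edgePt (π p) (π q) r := by
  funext i
  simp [relabel, edgePt, vert, Pi.single_apply, Equiv.symm_apply_eq]

/-- The positions in which a set meets an edge. -/
def edgePts (Z : Set Vec) (p q : Fin 4) : Set ℝ := {r | r ∈ Icc (0 : ℝ) 1 ∧ edgePt p q r ∈ Z}

/-- Reversal of the unit interval. -/
def flip' (F : Set ℝ) : Set ℝ := {r | 1 - r ∈ F}

theorem flip'_flip' (F : Set ℝ) : flip' (flip' F) = F := by
  ext r; simp [flip']

theorem one_sub_mem_Icc {r : ℝ} : 1 - r ∈ Icc (0 : ℝ) 1 ↔ r ∈ Icc (0 : ℝ) 1 := by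
  simp only [mem_Icc]; constructor <;> rintro ⟨h1, h2⟩ <;> constructor <;> linarith

theorem flip'_edgePts (Z : Set Vec) (p q : Fin 4) : flip' (edgePts Z p q) = edgePts Z q p := by
  ext r
  simp only [flip', edgePts, mem_ofPred_eq, edgePt_swap, one_sub_mem_Icc]

/-- An increasing homeomorphism of the unit interval that carries `F` to `F'`. -/
structure EdgeMap (F F' : Set ℝ) (e : ℝ → ℝ) : Prop where
  cont : ContinuousOn e (Icc 0 1)
  mono : StrictMonoOn e (Icc 0 1)
  zero : e 0 = 0
  one : e 1 = 1
  iff : ∀ r ∈ Icc (0 : ℝ) 1, e r ∈ F' ↔ r ∈ F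

namespace EdgeMap

variable {F F' : Set ℝ} {e e' : ℝ → ℝ}

theorem mem (h : EdgeMap F F' e) {r : ℝ} (hr : r ∈ Icc (0 : ℝ) 1) : e r ∈ Icc (0 : ℝ) 1 := by
  constructor
  · rw [← h.zero]; exact h.mono.monotoneOn (by simp) hr hr.1
  · rw [← h.one]; exact h.mono.monotoneOn hr (by simp) hr.2

theorem surj (h : EdgeMap F F' e) {s : ℝ} (hs : s ∈ Icc (0 : ℝ) 1) : ∃ r ∈ Icc (0 : ℝ) 1, e r = s := by
  have := intermediate_value_Icc (zero_le_one' ℝ) h.cont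
  rw [h.zero, h.one] at this
  exact this hs

theorem ncard_lt (h : EdgeMap F F' e) (hF : F ⊆ Icc 0 1) {r : ℝ} (hr : r ∈ F) :
    {s | s ∈ F' ∧ s ∈ Icc (0 : ℝ) 1 ∧ s < e r}.ncard = {s | s ∈ F ∧ s < r}.ncard := by
  have : {s | s ∈ F' ∧ s ∈ Icc (0 : ℝ) 1 ∧ s < e r} = e '' {s | s ∈ F ∧ s < r} := by
    ext s
    constructor
    · rintro ⟨h1, h2, h3⟩
      obtain ⟨x, hx, rfl⟩ := h.surj h2
      exact ⟨x, ⟨(h.iff x hx).1 h1, (h.mono.lt_iff_lt hx (hF hr)).1 h3⟩, rfl⟩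
    · rintro ⟨x, ⟨h1, h2⟩, rfl⟩
      exact ⟨(h.iff x (hF h1)).2 h1, h.mem (hF h1), h.mono (hF h1) (hF hr) h2⟩
  rw [this, (h.mono.injOn.mono fun s hs => hF hs.1).ncard_image]

theorem finite_image (h : EdgeMap F F' e) (hfin : F.Finite) :
    {s | s ∈ F' ∧ s ∈ Icc (0 : ℝ) 1}.Finite := by
  refine (hfin.image e).subset ?_
  rintro s ⟨h1, h2⟩
  obtain ⟨x, hx, rfl⟩ := h.surj h2
  exact ⟨x, (h.iff x hx).1 h1, rfl⟩

/-- An increasing bijection preserves the number of marked points below a marked point, so two of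
them cannot send the same marked point to different places. -/
theorem le_of_finite (h : EdgeMap F F' e) (h' : EdgeMap F F' e') (hF : F ⊆ Icc 0 1)
    (hfin : F.Finite) {r : ℝ} (hr : r ∈ F) : e' r ≤ e r := by
  by_contra hlt
  push Not at hlt
  have h1 := h.ncard_lt hF hr
  rw [← h'.ncard_lt hF hr] at h1
  refine h1.not_lt (ncard_lt_ncard ?_ ((h.finite_image hfin).subset fun s hs => ⟨hs.1, hs.2.1⟩))
  refine ⟨fun s hs => ⟨hs.1, hs.2.1, hs.2.2.trans hlt⟩, fun hs => ?_⟩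
  exact lt_irrefl _ (hs ⟨(h.iff r (hF hr)).2 hr, h.mem (hF hr), hlt⟩).2.2

/-- Two increasing homeomorphisms with the same effect on a finite set agree on it. -/
theorem eqOn (h : EdgeMap F F' e) (h' : EdgeMap F F' e') (hF : F ⊆ Icc 0 1)
    (hfin : F.Finite) : EqOn e e' F := fun _ hr =>
  le_antisymm (h'.le_of_finite h hF hfin hr) (h.le_of_finite h' hF hfin hr)

theorem flip (h : EdgeMap F F' e) : EdgeMap (flip' F) (flip' F') fun r => 1 - e (1 - r) where
  cont := continuousOn_const.sub (h.cont.comp (by fun_prop) fun r hr => one_sub_mem_Icc.2 hr)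
  mono := fun x hx y hy hxy => sub_lt_sub_left
    (h.mono (one_sub_mem_Icc.2 hy) (one_sub_mem_Icc.2 hx) (by linarith)) _
  zero := by simp [h.one]
  one := by simp [h.zero]
  iff := fun r hr => by
    have := h.iff (1 - r) (one_sub_mem_Icc.2 hr)
    simpa only [flip', mem_ofPred_eq, sub_sub_cancel] using this

/-- Both maps agree on the marked points. At any other point both values are strictly on the same
side of a given marked value, hence so is their average. -/
theorem average (h : EdgeMap F F' e) (h' : EdgeMap F F' e') (hF : F ⊆ Icc 0 1)
    (hF' : F' ⊆ Icc 0 1) (hfin : F.Finite) : EdgeMap F F' fun r => (e r + e' r) / 2 where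
  cont := (h.cont.add h'.cont).div_const _
  mono := fun x hx y hy hxy => by
    have := h.mono hx hy hxy
    have := h'.mono hx hy hxy
    simp only
    linarith
  zero := by simp [h.zero, h'.zero]
  one := by simp [h.one, h'.one]
  iff := fun r hr => by
    have heq := h.eqOn h' hF hfin
    constructor
    · intro h1
      obtain ⟨x, hx, ex⟩ := h.surj (hF' h1)
      have hxF : x ∈ F := (h.iff x hx).1 (by rwa [ex])
      have h2 := heq hxF
      rcases lt_trichotomy r x with hlt | rfl | hlt
      · have := h.mono hr hx hlt
        have := h'.mono hr hx hlt
        linarith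
      · exact hxF
      · have := h.mono hx hr hlt
        have := h'.mono hx hr hlt
        linarith
    · intro h1
      rw [← heq h1, add_self_div_two]
      exact (h.iff r hr).2 h1

end EdgeMap

/-- A choice that depends only on the two sets of positions, symmetrised by averaging with its own
reversal. The resulting map of an edge does not depend on the direction in which the edge is read,
and so is respected by every gluing. -/
theorem exists_symm_edgeMap : ∃ E : Set ℝ → Set ℝ → ℝ → ℝ,
    (∀ F F', F ⊆ Icc 0 1 → F' ⊆ Icc 0 1 → F.Finite → (∃ e, EdgeMap F F' e) → EdgeMap F F' (E F F')) ∧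
    ∀ F F' r, E (flip' F) (flip' F') r = 1 - E F F' (1 - r) := by
  classical
  let e₀ : Set ℝ → Set ℝ → ℝ → ℝ := fun F F' => if h : ∃ e, EdgeMap F F' e then h.choose else id
  have he₀ : ∀ F F', (∃ e, EdgeMap F F' e) → EdgeMap F F' (e₀ F F') := fun F F' h => by
    simp only [e₀, dif_pos h]
    exact h.choose_spec
  refine ⟨fun F F' r => (e₀ F F' r + (1 - e₀ (flip' F) (flip' F') (1 - r))) / 2, ?_, ?_⟩
  · intro F F' hF hF' hfin h
    have h2 := (he₀ (flip' F) (flip' F') (h.imp' _ fun e he => he.flip)).flip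
    rw [flip'_flip', flip'_flip'] at h2
    exact (he₀ F F' h).average h2 hF hF' hfin
  · intro F F' r
    simp only [flip'_flip', sub_sub_cancel]
    ring

theorem edgePt_mem {p q : Fin 4} {r : ℝ} (hr : r ∈ Icc (0 : ℝ) 1) : edgePt p q r ∈ face {p, q} :=
  edge_point_mem p q hr

theorem eq_edgePt {p q : Fin 4} (hpq : p ≠ q) {x : Vec} (hx : x ∈ face {p, q}) :
    x p ∈ Icc (0 : ℝ) 1 ∧ x = edgePt p q (x p) := by
  refine ⟨⟨hx.1.1 p, ?_⟩, mem_edge_eq hpq hx⟩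
  have := Finset.single_le_sum (fun i _ => hx.1.1 i) (Finset.mem_univ p)
  rwa [hx.1.2] at this

theorem exists_edge_of_skel {x : Vec} (hx : x ∈ skel 2) : ∃ p q, p ≠ q ∧ x ∈ face {p, q} := by
  obtain ⟨s, hs, hxs⟩ := exists_face_of_skel (k := 1) (by norm_num) hx
  obtain ⟨p, q, hpq, rfl⟩ := Finset.card_eq_two.1 hs
  exact ⟨p, q, hpq, hxs⟩

theorem HomeoOn.edge {g : Vec → Vec} {K : Set Vec} (hg : HomeoOn g K) (hgs : SuppPres g K)
    (hK : K ⊆ simplex) {p q : Fin 4} (hpq : _root_.face {p, q} ⊆ K) : HomeoOn g (_root_.face {p, q}) :=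
  hg.face hgs hK (P := fun s => s ⊆ {p, q}) fun _ hx h => hpq ⟨hx, h⟩

/-- A homeomorphism that respects the faces is increasing on every edge. -/
theorem HomeoOn.edgeMap {g : Vec → Vec} {p q : Fin 4} (hpq : p ≠ q)
    (hg : HomeoOn g (_root_.face {p, q})) (hgs : SuppPres g (_root_.face {p, q})) {Z Z' : Set Vec}
    (hZ : ∀ x ∈ _root_.face {p, q}, g x ∈ Z' ↔ x ∈ Z) :
    EdgeMap (edgePts Z p q) (edgePts Z' p q) (fun r => g (edgePt p q r) p) ∧
      ∀ r ∈ Icc (0 : ℝ) 1, g (edgePt p q r) = edgePt p q (g (edgePt p q r) p) := by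
  have h2 : ∀ r ∈ Icc (0 : ℝ) 1, g (edgePt p q r) p ∈ Icc (0 : ℝ) 1 ∧
      g (edgePt p q r) = edgePt p q (g (edgePt p q r) p) := fun r hr =>
    eq_edgePt hpq (hg.mem (edgePt_mem hr))
  have hv : ∀ i ∈ ({p, q} : Finset (Fin 4)), g (vert i) = vert i := fun i hi =>
    hgs.fix_vert (fun x hx => (hg.mem hx).1) ⟨vert_mem i, by rw [supp_vert]; simpa using hi⟩
  have hc : ContinuousOn (fun r => g (edgePt p q r) p) (Icc 0 1) :=
    (continuous_apply p).comp_continuousOn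
      (hg.cont.comp (continuous_edgePt p q).continuousOn fun r hr => edgePt_mem hr)
  have h0 : g (edgePt p q 0) p = 0 := by
    simp only [edgePt, zero_smul, zero_add, sub_zero, one_smul]
    rw [hv q (by simp)]
    simp [vert, hpq]
  have h1 : g (edgePt p q 1) p = 1 := by
    simp only [edgePt, one_smul, sub_self, zero_smul, add_zero]
    rw [hv p (by simp)]
    simp [vert]
  refine ⟨⟨hc, ?_, h0, h1, fun r hr => ?_⟩, fun r hr => (h2 r hr).2⟩
  · refine hc.strictMonoOn_of_injOn_Icc zero_le_one (by rw [h0, h1]; exact zero_le_one) ?_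
    intro r hr s hs e
    have := hg.inj (edgePt_mem hr) (edgePt_mem hs)
      (by rw [(h2 r hr).2, (h2 s hs).2]; exact congrArg _ e)
    rw [← edgePt_apply hpq r, this, edgePt_apply hpq]
  · simp only [edgePts, mem_ofPred_eq]
    rw [← (h2 r hr).2, hZ _ (edgePt_mem hr), and_iff_right (h2 r hr).1, and_iff_right hr]

theorem EdgeMap.id (F : Set ℝ) : EdgeMap F F fun r => r :=
  ⟨continuousOn_id, fun _ _ _ _ h => h, rfl, rfl, fun _ _ => Iff.rfl⟩

/-- A homeomorphism that preserves finitely many points on each edge fixes them. -/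
theorem fix_edge_points {g : Vec → Vec} {K : Set Vec} (hg : HomeoOn g K) (hgs : SuppPres g K)
    (hK : K ⊆ simplex) {Z : Set Vec} (hZ : ∀ x ∈ K, g x ∈ Z ↔ x ∈ Z) {p q : Fin 4} (hpq : p ≠ q)
    (hpK : face {p, q} ⊆ K) (hfin : (edgePts Z p q).Finite) {x : Vec} (hx : x ∈ face {p, q})
    (hxZ : x ∈ Z) : g x = x := by
  obtain ⟨h1, h2⟩ := (hg.edge hgs hK hpK).edgeMap hpq (fun x hx => hgs x (hpK hx))
    (Z := Z) (Z' := Z) fun x hx => hZ x (hpK hx)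
  obtain ⟨hx1, hx2⟩ := eq_edgePt hpq hx
  rw [hx2, h2 _ hx1]
  refine congrArg _ (h1.eqOn (EdgeMap.id _) (fun r hr => hr.1) hfin ⟨hx1, ?_⟩)
  rwa [← hx2]

/-! ### Standard discs on faces -/

theorem isClosed_stdDisc (τ : DiscType) (j : ℕ) : IsClosed (τ.stdDisc j) :=
  isCompact_simplex.isClosed.inter (isClosed_eq (τ.continuous_stdFn j) continuous_const)

theorem vert_not_mem_stdDisc (τ : DiscType) (j : ℕ) (v : Fin 4) : vert v ∉ τ.stdDisc j := by
  intro h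
  by_cases hτ : τ.IsFlat
  · have h2 := h.2
    rw [stdFn_of_flat hτ] at h2
    have hl := τ.level_mem j
    by_cases hv : v ∈ τ.side
    · have : ∑ i ∈ τ.side, vert v i = 1 := by simp [vert, Pi.single_apply, hv]
      linarith
    · have : ∑ i ∈ τ.side, vert v i = 0 := by simp [vert, Pi.single_apply, hv]
      linarith
  · cases τ with
    | tri v => exact hτ trivial
    | quad v => exact hτ trivial
    | oct i =>
      have := le_of_oct h.1 h.2 v
      rw [vert_self] at this
      norm_num at this

/-- A standard disc meets a two-dimensional face in at most two straight segments, even if it is an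
octagon; so the linear methods apply on faces. -/
theorem exists_faceCutters (c : DiscType → ℕ) {s : Finset (Fin 4)} (hs : s.card = 3) :
    ∃ L : List (Vec →L[ℝ] ℝ), ∀ x ∈ face s, x ∈ stdUnion c ↔ ∃ ℓ ∈ L, ℓ x = 0 := by
  classical
  obtain ⟨C, hC⟩ := exists_stdCutters c
  have ho : ∀ i : Fin 3, ∃ L : List (Vec →L[ℝ] ℝ), ∀ x ∈ face s,
      (DiscType.oct i).fn x = 0 ↔ ∃ ℓ ∈ L, ℓ x = 0 := fun i => by
    obtain ⟨a, b, c, d, h, e⟩ := exists_ordering i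
    exact ⟨_, fun x hx => by rw [e]; exact h.octFun_face hs hx⟩
  choose L hL using ho
  refine ⟨C ++ (List.finRange 3).flatMap fun i => if 0 < c (.oct i) then L i else [], fun x hx => ?_⟩
  constructor
  · rintro ⟨σ, j, hj, hxs⟩
    by_cases hσ : σ.IsFlat
    · refine ⟨_, List.mem_append_left _ ((hC _).2 ⟨σ, hσ, j, hj, rfl⟩), ?_⟩
      rw [cutter_eq_stdFn hσ j hx.1]; exact hxs.2
    · cases σ with
      | tri v => exact (hσ trivial).elim
      | quad v => exact (hσ trivial).elim
      | oct i =>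
        obtain ⟨ℓ, h1, h2⟩ := (hL i x hx).1 hxs.2
        refine ⟨ℓ, List.mem_append_right _ (List.mem_flatMap.2 ⟨i, by simp, ?_⟩), h2⟩
        rwa [if_pos (by omega)]
  · rintro ⟨ℓ, hℓ, h0⟩
    rcases List.mem_append.1 hℓ with h | h
    · obtain ⟨σ, hσ, j, hj, rfl⟩ := (hC _).1 h
      exact ⟨σ, j, hj, hx.1, by rwa [← cutter_eq_stdFn hσ j hx.1]⟩
    · obtain ⟨i, -, hi⟩ := List.mem_flatMap.1 h
      split_ifs at hi with hc
      · exact ⟨.oct i, 0, hc, hx.1, (hL i x hx).2 ⟨ℓ, hi, h0⟩⟩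
      · simp at hi

theorem finite_edgePts_std (c : DiscType → ℕ) {p q : Fin 4} (hpq : p ≠ q) :
    (edgePts (stdUnion c) p q).Finite := by
  obtain ⟨r, hr⟩ : ∃ r, r ∉ ({p, q} : Finset (Fin 4)) := by
    by_contra h
    push Not at h
    have := Finset.card_le_card (fun i _ => h i : (Finset.univ : Finset (Fin 4)) ⊆ {p, q})
    rw [Finset.card_pair hpq] at this
    simp at this
  have hcard : (insert r {p, q} : Finset (Fin 4)).card = 3 := by
    rw [Finset.card_insert_of_notMem hr, Finset.card_pair hpq]
  obtain ⟨L, hL⟩ := exists_faceCutters c hcard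
  classical
  -- A functional that does not vanish at a vertex has at most one zero on an edge from that vertex.
  have hv : ∀ ℓ ∈ L, ℓ (vert p) ≠ 0 := fun ℓ hℓ h0 => by
    obtain ⟨τ, j, -, h⟩ := (hL (vert p) ⟨vert_mem p, by rw [supp_vert]; simp⟩).2 ⟨ℓ, hℓ, h0⟩
    exact vert_not_mem_stdDisc τ j p h
  have hsub : edgePts (stdUnion c) p q ⊆ ⋃ ℓ ∈ L.toFinset, {r | ℓ (edgePt p q r) = 0} := by
    rintro t ⟨ht, htz⟩
    have hm := edgePt_mem (p := p) (q := q) ht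
    obtain ⟨ℓ, hℓ, h0⟩ := (hL _ ⟨hm.1, hm.2.trans (Finset.subset_insert _ _)⟩).1 htz
    exact mem_biUnion (List.mem_toFinset.2 hℓ) h0
  refine Set.Finite.subset (Finset.finite_toSet _ |>.biUnion fun ℓ hℓ => ?_) hsub
  refine Set.Subsingleton.finite fun t ht t' ht' => ?_
  simp only [mem_ofPred_eq, edgePt, map_add, map_smul, smul_eq_mul] at ht ht'
  by_contra hne
  have h1 : (t - t') * ℓ (vert p) = (t - t') * ℓ (vert q) := by linear_combination ht - ht'
  have h2 := mul_left_cancel₀ (sub_ne_zero.2 hne) h1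
  rw [← h2] at ht
  exact hv ℓ (List.mem_toFinset.1 hℓ) (by linear_combination ht)

open DiscType

/-! ### Extending matchings over faces and tetrahedra -/

/-- At most one type of quadrilateral or octagon occurs. -/
def ValidCount (c : DiscType → ℕ) : Prop :=
  ∀ σ τ, (∀ v, σ ≠ .tri v) → (∀ v, τ ≠ .tri v) → 0 < c σ → 0 < c τ → σ = τ

/-- Discs of one flat type are parallel, triangles stay clear of all other types, and validity
excludes two different types of quadrilaterals or octagons. -/
theorem ValidCount.disjoint {c : DiscType → ℕ} (hc : ValidCount c) {σ τ : DiscType} {j k : ℕ}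
    (hσ : σ.IsFlat) (hj : j < c σ) (hk : k < c τ) (hne : ¬ (τ = σ ∧ k = j)) {x : Vec}
    (h1 : x ∈ σ.stdDisc j) (h2 : x ∈ τ.stdDisc k) : False := by
  by_cases e : τ = σ
  · subst e
    have e1 := h1.2
    have e2 := h2.2
    rw [stdFn_of_flat hσ] at e1 e2
    exact hne ⟨rfl, τ.level_strictMono.injective (by linarith)⟩
  · have key : ∀ σ τ : DiscType, ∀ j k, σ ≠ τ → x ∈ σ.stdDisc j → x ∈ τ.stdDisc k → ∀ v, σ ≠ .tri v := by
      rintro σ τ j k hne h1 h2 v rfl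
      have h3 := lt_of_mem_stdDisc hne h2
      rw [mem_stdDisc_tri] at h1
      linarith [level_tri v j]
    exact e (hc σ τ (key σ τ j k (Ne.symm e) h1 h2) (key τ σ k j e h2 h1) (by omega) (by omega)).symm

/-- A flat disc that meets a face separates two of its vertices, so it crosses the edge between
them. The crossing point anchors the disc, because maps that preserve the standard family fix it. -/
theorem exists_fixed_edge_point {σ : DiscType} (hσ : σ.IsFlat) {j : ℕ} {s : Finset (Fin 4)} {x : Vec}
    (hx : x ∈ σ.stdDisc j) (hxs : x ∈ face s) :
    ∃ p q, p ≠ q ∧ p ∈ s ∧ q ∈ s ∧ ∃ e ∈ face {p, q}, e ∈ σ.stdDisc j := by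
  have hl := σ.level_mem j
  have h1 := hx.2
  rw [stdFn_of_flat hσ] at h1
  obtain ⟨p, hp, hp0⟩ := Finset.exists_ne_zero_of_sum_ne_zero
    (by linarith : ∑ i ∈ σ.side, x i ≠ 0)
  obtain ⟨q, hq, hq0⟩ : ∃ q ∉ σ.side, x q ≠ 0 := by
    by_contra h
    push Not at h
    have := Finset.sum_subset (Finset.subset_univ σ.side) fun i _ hi => h i hi
    rw [hx.1.2] at this
    linarith
  have hpq : p ≠ q := by rintro rfl; exact hq hp
  have hm := edgePt_mem (p := p) (q := q) (r := σ.level j) ⟨hl.1.le, hl.2.le⟩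
  refine ⟨p, q, hpq, hxs.2 (mem_supp.2 hp0), hxs.2 (mem_supp.2 hq0), _, hm, hm.1, ?_⟩
  rw [stdFn_of_flat hσ, edgePt, sum_edge_point hp hq, sub_self]

theorem convex_stdDisc_inter {σ : DiscType} (hσ : σ.IsFlat) (j : ℕ) (s : Finset (Fin 4)) :
    Convex ℝ (σ.stdDisc j ∩ face s) := by
  have : σ.stdDisc j ∩ face s = face s ∩ {x | cutter σ.side (σ.level j) x = 0} := by
    ext x
    constructor
    · rintro ⟨h1, h2⟩
      exact ⟨h2, by rw [mem_ofPred_eq, cutter_eq_stdFn hσ j h2.1]; exact h1.2⟩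
    · rintro ⟨h1, h2⟩
      exact ⟨⟨h1.1, by rw [← cutter_eq_stdFn hσ j h1.1]; exact h2⟩, h1⟩
  rw [this]
  refine (convex_face s).inter ?_
  exact convex_hyperplane (cutter σ.side (σ.level j)).toLinearMap.isLinear 0

theorem stdUnion_fixed {c : DiscType → ℕ} {β : Vec → Vec} {K : Set Vec} (hβ : HomeoOn β K)
    (hβs : SuppPres β K) (hK : K ⊆ simplex) (hZ : ∀ x ∈ K, β x ∈ stdUnion c ↔ x ∈ stdUnion c)
    {p q : Fin 4} (hpq : p ≠ q) (hpK : face {p, q} ⊆ K) {x : Vec} (hx : x ∈ face {p, q})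
    (hxZ : x ∈ stdUnion c) : β x = x :=
  fix_edge_points hβ hβs hK hZ hpq hpK (finite_edgePts_std c hpq) hx hxZ

/-- The family has finitely many points on each edge, and an increasing map that preserves a finite
set fixes it. Hence the boundary map respects the zeros of each line separately, not merely those of
their union. -/
theorem exists_std_face_ext (c : DiscType → ℕ) {s : Finset (Fin 4)} (hs : s.card = 3) {β : Vec → Vec}
    (hβ : HomeoOn β (faceBd s)) (hβs : SuppPres β (faceBd s))
    (hZ : ∀ x ∈ faceBd s, β x ∈ stdUnion c ↔ x ∈ stdUnion c) :
    ∃ m, HomeoOn m (face s) ∧ SuppPres m (face s) ∧ EqOn m β (faceBd s) ∧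
      ∀ x ∈ face s, m x ∈ stdUnion c ↔ x ∈ stdUnion c := by
  obtain ⟨L, hL⟩ := exists_faceCutters c hs
  have hK : faceBd s ⊆ simplex := fun x hx => hx.1
  have hfix : ∀ x ∈ faceBd s, x ∈ stdUnion c → β x = x := by
    intro x hx hxZ
    have h1 := Finset.card_lt_card hx.2
    obtain ⟨t, h2, h3, h4⟩ := Finset.exists_subsuperset_card_eq hx.2.1 (n := 2) (by omega) (by omega)
    obtain ⟨p, q, hpq, rfl⟩ := Finset.card_eq_two.1 h4
    refine stdUnion_fixed hβ hβs hK hZ hpq (fun y hy => ⟨hy.1, hy.2.trans_ssubset ?_⟩) ⟨hx.1, h2⟩ hxZ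
    exact h3.ssubset_of_ne fun e => by rw [e] at h4; omega
  obtain ⟨m, m1, m2, m3, m4⟩ := exists_face_sign_ext (s := s) (Finset.card_pos.1 (by omega)) L hβ hβs
    (by
      intro ℓ hℓ
      refine signPres_of_zero_linear hβ.cont hβs hβ.bij.mapsTo hK
        (fun x hx y hy => ⟨hy.1, hy.2.trans_ssubset hx.2⟩) fun x hx => ⟨fun h0 => ?_, fun h0 => ?_⟩
      · have h1 : β x ∈ stdUnion c :=
          (hL _ (faceBd_subset_face s (hβ.mem hx))).2 ⟨ℓ, hℓ, h0⟩
        rw [hfix x hx ((hZ x hx).1 h1)] at h0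
        exact h0
      · have h1 : x ∈ stdUnion c := (hL _ (faceBd_subset_face s hx)).2 ⟨ℓ, hℓ, h0⟩
        rw [hfix x hx h1]
        exact h0)
  refine ⟨m, m1, m3, m2, fun x hx => ?_⟩
  rw [hL _ (m1.mem hx), hL _ hx]
  exact exists_congr fun ℓ => and_congr_right fun hℓ => (m4 ℓ hℓ).eq_zero_iff hx

/-- The part of the disc in a face is connected and contains a fixed point on an edge. Its image
lies in a finite union of closed standard discs, of which this one is disjoint from the rest, so it
stays in the disc containing the fixed point. -/
theorem std_boundary_mem {c : DiscType → ℕ} (hc : ValidCount c) {β : Vec → Vec}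
    (hβ : HomeoOn β (skel 3)) (hβs : SuppPres β (skel 3))
    (hZ : ∀ x ∈ skel 3, β x ∈ stdUnion c ↔ x ∈ stdUnion c) {σ : DiscType} (hσ : σ.IsFlat) {j : ℕ}
    (hj : j < c σ) {x : Vec} (hx : x ∈ skel 3) (hxs : x ∈ σ.stdDisc j) : β x ∈ σ.stdDisc j := by
  obtain ⟨s, hs, hxf⟩ := exists_face_of_skel (k := 2) (by norm_num) hx
  obtain ⟨p, q, hpq, hp, hq, e, he, hes⟩ := exists_fixed_edge_point hσ hxs hxf
  have hpqs : ({p, q} : Finset (Fin 4)) ⊆ s := by simp [Finset.insert_subset_iff, hp, hq]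
  have hfs : face s ⊆ skel 3 := face_subset_skel hs
  have hfix : β e = e := stdUnion_fixed hβ hβs (skel_subset 3) hZ hpq
    (fun y hy => hfs ⟨hy.1, hy.2.trans hpqs⟩) he ⟨σ, j, hj, hes⟩
  let Rest : Set Vec := ⋃ τ : DiscType, ⋃ k ∈ {k | k < c τ ∧ ¬ (τ = σ ∧ k = j)}, τ.stdDisc k
  have hRest : IsClosed Rest := isClosed_iUnion_of_finite fun τ =>
    Set.Finite.isClosed_biUnion ((Set.finite_Iio (c τ)).subset fun k hk => hk.1) fun k _ =>
      isClosed_stdDisc τ k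
  have hpre : IsPreconnected (β '' (σ.stdDisc j ∩ face s)) :=
    (convex_stdDisc_inter hσ j s).isPreconnected.image _ (hβ.cont.mono fun y hy => hfs hy.2)
  rcases isPreconnected_iff_subset_of_disjoint_closed.1 hpre (σ.stdDisc j) Rest
    (isClosed_stdDisc σ j) hRest (by
      rintro _ ⟨y, hy, rfl⟩
      obtain ⟨τ, k, hk, h⟩ := (hZ y (hfs hy.2)).2 ⟨σ, j, hj, hy.1⟩
      by_cases hτ : τ = σ ∧ k = j
      · obtain ⟨rfl, rfl⟩ := hτ
        exact Or.inl h
      · exact Or.inr (mem_iUnion.2 ⟨τ, mem_biUnion ⟨hk, hτ⟩ h⟩)) (by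
      rw [eq_empty_iff_forall_notMem]
      rintro y ⟨-, h1, h2⟩
      obtain ⟨τ, h2⟩ := mem_iUnion.1 h2
      obtain ⟨k, hk, h2⟩ := mem_iUnion₂.1 h2
      exact hc.disjoint hσ hj hk.1 hk.2 h1 h2) with h | h
  · exact h ⟨x, ⟨hxs, hxf⟩, rfl⟩
  · exfalso
    obtain ⟨τ, h2⟩ := mem_iUnion.1 (h ⟨e, ⟨hes, he.1, he.2.trans hpqs⟩, hfix⟩)
    obtain ⟨k, hk, h2⟩ := mem_iUnion₂.1 h2
    exact hc.disjoint hσ hj hk.1 hk.2 hes h2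

theorem isCompact_skel_three : IsCompact (skel 3) := faceBd_univ ▸ isCompact_faceBd Finset.univ

theorem std_boundary_iff {c : DiscType → ℕ} (hc : ValidCount c) {β : Vec → Vec}
    (hβ : HomeoOn β (skel 3)) (hβs : SuppPres β (skel 3))
    (hZ : ∀ x ∈ skel 3, β x ∈ stdUnion c ↔ x ∈ stdUnion c) {σ : DiscType} (hσ : σ.IsFlat) {j : ℕ}
    (hj : j < c σ) {x : Vec} (hx : x ∈ skel 3) : β x ∈ σ.stdDisc j ↔ x ∈ σ.stdDisc j := by
  refine ⟨fun h => ?_, std_boundary_mem hc hβ hβs hZ hσ hj hx⟩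
  obtain ⟨β', h1, h2, h3⟩ := hβ.exists_inv isCompact_skel_three
  have := std_boundary_mem hc h1 (fun y hy => by rw [← hβs _ (h1.mem hy), h3 y hy])
    (fun y hy => by rw [← hZ _ (h1.mem hy), h3 y hy]) hσ hj (hβ.mem hx) h
  rwa [h2 x hx] at this

/-- Without an octagon this is the sign-preserving extension. With one, the other discs are
triangles: the coned map is right on the octagon, and an extension is wanted that agrees with it
there and still has the right signs for the triangles. -/
theorem exists_std_tetra_ext {c : DiscType → ℕ} (hc : ValidCount c) {β : Vec → Vec}
    (hβ : HomeoOn β (skel 3)) (hβs : SuppPres β (skel 3))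
    (hZ : ∀ x ∈ skel 3, β x ∈ stdUnion c ↔ x ∈ stdUnion c) :
    ∃ m, HomeoOn m simplex ∧ SuppPres m simplex ∧ EqOn m β (skel 3) ∧
      ∀ x ∈ simplex, m x ∈ stdUnion c ↔ x ∈ stdUnion c := by
  obtain ⟨C, hC⟩ := exists_stdCutters c
  have hb : ∀ σ : DiscType, σ.IsFlat → ∀ j < c σ, ∀ x ∈ skel 3, β x ∈ σ.stdDisc j ↔ x ∈ σ.stdDisc j :=
    fun σ hσ j hj x hx => std_boundary_iff hc hβ hβs hZ hσ hj hx
  have hsign : ∀ ℓ ∈ C, SignPres ℓ β (skel 3) := by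
    intro ℓ hℓ
    obtain ⟨σ, hσ, j, hj, rfl⟩ := (hC ℓ).1 hℓ
    refine signPres_of_zero_linear hβ.cont hβs hβ.bij.mapsTo (skel_subset 3)
      (fun x hx => face_subset_of_mem_skel hx) fun x hx => ?_
    have := hb σ hσ j hj x hx
    rw [cutter_eq_stdFn hσ j hx.1, cutter_eq_stdFn hσ j (hβ.mem hx).1]
    simpa only [stdDisc, mem_ofPred_eq, hx.1, (hβ.mem hx).1, true_and] using this
  have hflat : ∀ m : Vec → Vec, HomeoOn m simplex → (∀ ℓ ∈ C, SignPres ℓ m simplex) →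
      ∀ σ : DiscType, σ.IsFlat → ∀ j < c σ, ∀ x ∈ simplex, m x ∈ σ.stdDisc j ↔ x ∈ σ.stdDisc j := by
    intro m hm hmC σ hσ j hj x hx
    have := (hmC _ ((hC _).2 ⟨σ, hσ, j, hj, rfl⟩)).eq_zero_iff hx
    rw [cutter_eq_stdFn hσ j hx, cutter_eq_stdFn hσ j (hm.mem hx)] at this
    simpa only [stdDisc, mem_ofPred_eq, hx, hm.mem hx, true_and] using this
  by_cases ho : ∃ i, 0 < c (.oct i)
  · obtain ⟨i, hi⟩ := ho
    have huniq : ∀ τ : DiscType, (∀ v, τ ≠ .tri v) → 0 < c τ → τ = .oct i := fun τ h1 h2 =>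
      hc τ (.oct i) h1 (by simp) h2 hi
    have hoct : ∀ τ : DiscType, ∀ k < c τ, ¬ τ.IsFlat → τ = .oct i := fun τ k hk hτ =>
      huniq τ (fun v e => by rw [e] at hτ; exact hτ trivial) (by omega)
    have hiff : ∀ x ∈ skel 3, β x ∈ (DiscType.oct i).stdDisc 0 ↔ x ∈ (DiscType.oct i).stdDisc 0 := by
      intro x hx
      constructor
      · intro h
        obtain ⟨τ, k, hk, hxk⟩ := (hZ x hx).1 ⟨_, 0, hi, h⟩
        by_cases hτ : τ.IsFlat
        · exact (hc.disjoint hτ hk hi (by rintro ⟨rfl, -⟩; exact hτ) ((hb τ hτ k hk x hx).2 hxk) h).elim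
        · obtain rfl := hoct τ k hk hτ
          exact hxk
      · intro h
        obtain ⟨τ, k, hk, hxk⟩ := (hZ x hx).2 ⟨_, 0, hi, h⟩
        by_cases hτ : τ.IsFlat
        · exact (hc.disjoint hτ hk hi (by rintro ⟨rfl, -⟩; exact hτ) ((hb τ hτ k hk x hx).1 hxk) h).elim
        · obtain rfl := hoct τ k hk hτ
          exact hxk
    have hstd : (DiscType.oct i).stdFn 0 = (DiscType.oct i).fn := rfl
    obtain ⟨m, m1, m2, m3, m4⟩ := exists_oct_ext (i := i) hβ hβs fun x hx => by
      have := hiff x hx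
      simpa only [stdDisc, hstd, mem_ofPred_eq, hx.1, (hβ.mem hx).1, true_and] using this
    have hmO : ∀ x ∈ simplex, m x ∈ (DiscType.oct i).stdDisc 0 ↔ x ∈ (DiscType.oct i).stdDisc 0 := by
      intro x hx
      have := m4.eq_zero_iff hx
      simpa only [stdDisc, hstd, mem_ofPred_eq, hx, m1.mem hx, true_and] using this
    -- The octagon lies on the negative side of all triangles, whereas `exists_face_ext_eqOn` asks
    -- for positive functionals; hence the negation.
    have hneg : ∀ ℓ ∈ C.map Neg.neg, ∀ x ∈ (DiscType.oct i).stdDisc 0, 0 < ℓ x := by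
      intro ℓ hℓ x hx
      obtain ⟨ℓ₁, hℓ₁, rfl⟩ := List.mem_map.1 hℓ
      obtain ⟨σ, hσ, j, hj, rfl⟩ := (hC ℓ₁).1 hℓ₁
      rw [_root_.neg_apply, neg_pos, cutter_eq_stdFn hσ j hx.1]
      by_cases h : ∃ v, σ = .tri v
      · obtain ⟨v, rfl⟩ := h
        have := lt_of_mem_stdDisc (v := v) (by simp) hx
        rw [stdFn_of_flat hσ]
        simp only [side, Finset.sum_singleton]
        linarith [level_tri v j]
      · push Not at h
        have := huniq σ h (by omega)
        rw [this] at hσ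
        exact hσ.elim
    rw [← faceBd_univ] at hβ hβs hsign m3 ⊢
    rw [← face_univ] at m1 hmO hflat ⊢
    obtain ⟨G, g1, g2, g3, g4, g5⟩ := exists_face_ext_eqOn Finset.univ_nonempty
      (C := C.map Neg.neg) (D := (DiscType.oct i).stdDisc 0) (isClosed_stdDisc _ _)
      (fun x hx => face_univ ▸ hx.1) hβ hβs
      (fun ℓ hℓ => by
        obtain ⟨ℓ₁, hℓ₁, rfl⟩ := List.mem_map.1 hℓ
        exact (hsign ℓ₁ hℓ₁).neg) m1 m3 hneg
      (fun ℓ hℓ x hx => hneg ℓ hℓ _ ((hmO x (face_univ ▸ hx.1)).2 hx))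
    refine ⟨G, g1, g4, g2, fun x hx => ?_⟩
    have hGf := hflat G g1 fun ℓ hℓ => by
      have := (g5 _ (List.mem_map.2 ⟨ℓ, hℓ, rfl⟩)).neg
      rwa [neg_neg] at this
    have hGO : G x ∈ (DiscType.oct i).stdDisc 0 ↔ x ∈ (DiscType.oct i).stdDisc 0 := by
      constructor
      · intro h
        obtain ⟨y, hy, e⟩ := m1.surj (g1.mem hx)
        have hyO := (hmO y hy).1 (e ▸ h)
        rw [← g3 hyO] at e
        exact g1.inj hy hx e ▸ hyO
      · intro h
        rw [g3 h]
        exact (hmO x hx).2 h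
    refine exists_congr fun τ => exists_congr fun k => and_congr_right fun hk => ?_
    by_cases hτ : τ.IsFlat
    · exact hGf τ hτ k hk x hx
    · obtain rfl := hoct τ k hk hτ
      exact hGO
  · push Not at ho
    obtain ⟨G, g1, g2, g3, g4⟩ := exists_simplex_sign_ext C hβ hβs hsign
    refine ⟨G, g1, g3, g2, fun x hx => ?_⟩
    refine exists_congr fun τ => exists_congr fun k => and_congr_right fun hk => ?_
    refine hflat G g1 g4 τ ?_ k hk x hx
    cases τ with
    | tri v => trivial
    | quad v => trivial
    | oct i => have := ho i; omega

/-! ### Transfer from the standard position to arbitrary families of discs. -/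

/-- `Z` can be moved to standard position with given numbers of discs. -/
def HasCount (Z : Set Vec) (c : DiscType → ℕ) : Prop :=
  ∃ st, HomeoOn st simplex ∧ SuppPres st simplex ∧ ∀ x ∈ simplex, x ∈ Z ↔ st x ∈ stdUnion c

/-- Conjugation by the standardisations of `Z` and `Z'` turns `g` into a boundary map that preserves
the standard family. -/
theorem exists_conj_ext {Z Z' : Set Vec} {c : DiscType → ℕ} (hZ : HasCount Z c) (hZ' : HasCount Z' c)
    {s : Finset (Fin 4)}
    (hext : ∀ β : Vec → Vec, HomeoOn β (faceBd s) → SuppPres β (faceBd s) →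
      (∀ x ∈ faceBd s, β x ∈ stdUnion c ↔ x ∈ stdUnion c) →
      ∃ m, HomeoOn m (face s) ∧ SuppPres m (face s) ∧ EqOn m β (faceBd s) ∧
        ∀ x ∈ face s, m x ∈ stdUnion c ↔ x ∈ stdUnion c)
    {g : Vec → Vec} (hg : HomeoOn g (faceBd s)) (hgs : SuppPres g (faceBd s))
    (hgZ : ∀ x ∈ faceBd s, g x ∈ Z' ↔ x ∈ Z) :
    ∃ m, HomeoOn m (face s) ∧ SuppPres m (face s) ∧ EqOn m g (faceBd s) ∧
      ∀ x ∈ face s, m x ∈ Z' ↔ x ∈ Z := by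
  obtain ⟨a, a1, a2, a3⟩ := hZ
  obtain ⟨b, b1, b2, b3⟩ := hZ'
  obtain ⟨a', i1, i2, i3⟩ := a1.exists_inv isCompact_simplex
  obtain ⟨b', k1, k2, k3⟩ := b1.exists_inv isCompact_simplex
  have i4 : SuppPres a' simplex := fun x hx => by rw [← a2 _ (i1.mem hx), i3 x hx]
  have k4 : SuppPres b' simplex := fun x hx => by rw [← b2 _ (k1.mem hx), k3 x hx]
  have bd : ∀ h : Vec → Vec, HomeoOn h simplex → SuppPres h simplex → HomeoOn h (faceBd s) :=
    fun h h1 h2 => h1.face h2 subset_rfl (P := fun r => r ⊂ s) fun x hx _ => hx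
  have fc : ∀ h : Vec → Vec, HomeoOn h simplex → SuppPres h simplex → HomeoOn h (face s) :=
    fun h h1 h2 => h1.face h2 subset_rfl (P := fun r => r ⊆ s) fun x hx _ => hx
  have hi := bd a' i1 i4
  have hb := bd b b1 b2
  obtain ⟨m, m1, m2, m3, m4⟩ := hext _ (hb.comp (hg.comp hi))
    (fun x hx => by
      rw [b2 _ (hg.mem (hi.mem hx)).1, hgs _ (hi.mem hx), i4 x hx.1])
    (fun x hx => by
      rw [← b3 _ (hg.mem (hi.mem hx)).1, hgZ _ (hi.mem hx), a3 _ (hi.mem hx).1, i3 x hx.1])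
  have ha := fc a a1 a2
  refine ⟨_, (fc b' k1 k4).comp (m1.comp ha), fun x hx => ?_, fun x hx => ?_, fun x hx => ?_⟩
  · rw [k4 _ (m1.mem (ha.mem hx)).1, m2 _ (ha.mem hx), a2 x hx.1]
  · simp only
    rw [m3 ((bd a a1 a2).mem hx)]
    simp only
    rw [i2 x hx.1, k2 _ (hg.mem hx).1]
  · rw [b3 _ (k1.mem (m1.mem (ha.mem hx)).1), k3 _ (m1.mem (ha.mem hx)).1, m4 _ (ha.mem hx), ← a3 x hx.1]

open DiscType

/-! ### Matching two surfaces with the same numbers of discs -/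

theorem exists_edge_in {x : Vec} (hx : x ∈ skel 2) {s : Finset (Fin 4)} (hs : 2 ≤ s.card)
    (hxs : supp x ⊆ s) : ∃ p q, p ≠ q ∧ p ∈ s ∧ q ∈ s ∧ x ∈ face {p, q} := by
  obtain ⟨t, h1, h2, h3⟩ := Finset.exists_subsuperset_card_eq hxs (n := 2) hx.2 hs
  obtain ⟨p, q, hpq, rfl⟩ := Finset.card_eq_two.1 h3
  exact ⟨p, q, hpq, h2 (by simp), h2 (by simp), hx.1, h1⟩

theorem mem_face_compl {f : Fin 4} {x : Vec} : x ∈ face {f}ᶜ ↔ x ∈ simplex ∧ x f = 0 := by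
  refine and_congr_right fun _ => ?_
  rw [supp_subset]
  simp

theorem card_compl_singleton (f : Fin 4) : ({f}ᶜ : Finset (Fin 4)).card = 3 := by
  rw [Finset.card_compl, Finset.card_singleton]; rfl

theorem EdgeMap.homeoOn {F F' : Set ℝ} {e : ℝ → ℝ} (h : EdgeMap F F' e) {p q : Fin 4} (hpq : p ≠ q) :
    HomeoOn (fun x : Vec => edgePt p q (e (x p))) (face {p, q}) ∧
      SuppPres (fun x : Vec => edgePt p q (e (x p))) (face {p, q}) ∧
      EqOn (fun x : Vec => edgePt p q (e (x p))) (fun x => x) (faceBd {p, q}) := by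
  have hI : ∀ x ∈ face {p, q}, x p ∈ Icc (0 : ℝ) 1 := fun x hx => (eq_edgePt hpq hx).1
  refine ⟨⟨?_, ?_⟩, ?_, ?_⟩
  · exact (continuous_edgePt p q).comp_continuousOn
      (h.cont.comp (continuous_apply p).continuousOn fun x hx => hI x hx)
  · refine ⟨fun x hx => edgePt_mem (h.mem (hI x hx)), fun x hx y hy hxy => ?_, fun y hy => ?_⟩
    · have h1 := congrFun hxy p
      simp only [edgePt_apply hpq] at h1
      have h2 := h.mono.injOn (hI x hx) (hI y hy) h1
      rw [(eq_edgePt hpq hx).2, (eq_edgePt hpq hy).2, h2]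
    · obtain ⟨r, hr, er⟩ := h.surj (hI y hy)
      refine ⟨edgePt p q r, edgePt_mem hr, ?_⟩
      simp only [edgePt_apply hpq, er]
      exact (eq_edgePt hpq hy).2.symm
  · intro x hx
    have h0 : e (x p) = 0 ↔ x p = 0 := by
      rw [← h.mono.injOn.eq_iff (hI x hx) (by simp : (0 : ℝ) ∈ Icc (0 : ℝ) 1), h.zero]
    have h1 : e (x p) = 1 ↔ x p = 1 := by
      rw [← h.mono.injOn.eq_iff (hI x hx) (by simp : (1 : ℝ) ∈ Icc (0 : ℝ) 1), h.one]
    have hcoord : ∀ r i, edgePt p q r i = if i = p then r else if i = q then 1 - r else 0 := by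
      intro r i
      by_cases hip : i = p
      · subst hip; simp [edgePt_apply hpq]
      · by_cases hiq : i = q
        · subst hiq; simp [edgePt, vert, hip]
        · simp [edgePt, vert, hip, hiq]
    refine supp_eq_supp.2 fun i => ?_
    conv_rhs => rw [(eq_edgePt hpq hx).2]
    change edgePt p q (e (x p)) i = 0 ↔ _
    rw [hcoord, hcoord]
    split_ifs
    · exact h0
    · rw [sub_eq_zero, sub_eq_zero, eq_comm, h1, eq_comm]
    · rfl
  · intro x hx
    have hxf := faceBd_subset_face _ hx
    simp only
    conv_rhs => rw [(eq_edgePt hpq hxf).2]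
    congr 1
    have hcases : x p = 0 ∨ x q = 0 := by
      by_contra hcon
      push Not at hcon
      refine hx.2.2 ?_
      intro i hi
      simp only [Finset.mem_insert, Finset.mem_singleton] at hi
      rcases hi with rfl | rfl
      exacts [mem_supp.2 hcon.1, mem_supp.2 hcon.2]
    rcases hcases with h0 | h0
    · rw [h0, h.zero]
    · have : x p = 1 := by
        have := congrFun (eq_edgePt hpq hxf).2 q
        rw [h0, ← edgePt_swap, edgePt_swap, ← sub_sub_cancel 1 (x p), edgePt_swap,
          edgePt_apply hpq.symm] at this
        linarith
      rw [this, h.one]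

theorem HasCount.exists_homeo {Z Z' : Set Vec} {c : DiscType → ℕ} (hZ : HasCount Z c)
    (hZ' : HasCount Z' c) : ∃ g, HomeoOn g simplex ∧ SuppPres g simplex ∧
      ∀ x ∈ simplex, g x ∈ Z' ↔ x ∈ Z := by
  obtain ⟨a, a1, a2, a3⟩ := hZ
  obtain ⟨b, b1, b2, b3⟩ := hZ'
  obtain ⟨b', k1, k2, k3⟩ := b1.exists_inv isCompact_simplex
  have k4 : SuppPres b' simplex := fun x hx => by rw [← b2 _ (k1.mem hx), k3 x hx]
  refine ⟨_, k1.comp a1, fun x hx => by rw [k4 _ (a1.mem hx), a2 x hx], fun x hx => ?_⟩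
  rw [b3 _ (k1.mem (a1.mem hx)), k3 _ (a1.mem hx), a3 x hx]

theorem hasCount_std (c : DiscType → ℕ) : HasCount (stdUnion c) c :=
  ⟨_, HomeoOn.id _, fun _ _ => rfl, fun _ _ => Iff.rfl⟩

theorem edge_subset_simplex (p q : Fin 4) : face {p, q} ⊆ simplex := fun _ hx => hx.1

theorem HasCount.exists_edgeMap {Z Z' : Set Vec} {c : DiscType → ℕ} (hZ : HasCount Z c)
    (hZ' : HasCount Z' c) {p q : Fin 4} (hpq : p ≠ q) :
    ∃ e, EdgeMap (edgePts Z p q) (edgePts Z' p q) e := by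
  obtain ⟨g, g1, g2, g3⟩ := hZ.exists_homeo hZ'
  exact ⟨_, ((g1.edge g2 subset_rfl (edge_subset_simplex p q)).edgeMap hpq
    (fun x hx => g2 x hx.1) fun x hx => g3 x hx.1).1⟩

theorem HasCount.finite_edgePts {Z : Set Vec} {c : DiscType → ℕ} (hZ : HasCount Z c) {p q : Fin 4}
    (hpq : p ≠ q) : (edgePts Z p q).Finite := by
  obtain ⟨e, he⟩ := hZ.exists_edgeMap (hasCount_std c) hpq
  refine Set.Finite.of_finite_image (f := e) ((finite_edgePts_std c hpq).subset ?_)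
    (he.mono.injOn.mono fun r hr => hr.1)
  rintro _ ⟨r, hr, rfl⟩
  exact (he.iff r hr.1).2 hr

theorem HasCount.ncard_edgePts {Z Z' : Set Vec} {c : DiscType → ℕ} (hZ : HasCount Z c)
    (hZ' : HasCount Z' c) {p q : Fin 4} (hpq : p ≠ q) :
    (edgePts Z p q).ncard = (edgePts Z' p q).ncard := by
  obtain ⟨e, he⟩ := hZ.exists_edgeMap hZ' hpq
  rw [← (he.mono.injOn.mono fun r hr => hr.1 : InjOn e (edgePts Z p q)).ncard_image]
  congr 1
  ext s
  constructor
  · rintro ⟨r, hr, rfl⟩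
    exact (he.iff r hr.1).2 hr
  · intro hs
    obtain ⟨r, hr, rfl⟩ := he.surj hs.1
    exact ⟨r, (he.iff r hr).1 hs, rfl⟩

/-- Here `skel 2` is the union of the edges. The explicit formula in the conclusion is what will be
compared across gluings. -/
theorem exists_two_skeleton_map {Z Z' : Set Vec} {c : DiscType → ℕ} (hZ : HasCount Z c)
    (hZ' : HasCount Z' c) {E : Set ℝ → Set ℝ → ℝ → ℝ}
    (hE : ∀ F F', F ⊆ Icc 0 1 → F' ⊆ Icc 0 1 → F.Finite → (∃ e, EdgeMap F F' e) → EdgeMap F F' (E F F'))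
    (hEs : ∀ F F' r, E (flip' F) (flip' F') r = 1 - E F F' (1 - r)) :
    ∃ g, HomeoOn g (skel 2) ∧ SuppPres g (skel 2) ∧ (∀ x ∈ skel 2, g x ∈ Z' ↔ x ∈ Z) ∧
      ∀ p q, p ≠ q → ∀ x ∈ face {p, q},
        g x = edgePt p q (E (edgePts Z p q) (edgePts Z' p q) (x p)) := by
  have hem : ∀ p q, p ≠ q → EdgeMap (edgePts Z p q) (edgePts Z' p q)
      (E (edgePts Z p q) (edgePts Z' p q)) := fun p q hpq =>
    hE _ _ (fun r hr => hr.1) (fun r hr => hr.1) (hZ.finite_edgePts hpq) (hZ.exists_edgeMap hZ' hpq)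
  have hswap : ∀ p q, p ≠ q → ∀ x ∈ face {p, q},
      edgePt q p (E (edgePts Z q p) (edgePts Z' q p) (x q)) =
        edgePt p q (E (edgePts Z p q) (edgePts Z' p q) (x p)) := by
    intro p q hpq x hx
    have hxq : x q = 1 - x p := by
      rw [(eq_edgePt hpq hx).2, edgePt_apply hpq]
      simp [edgePt, vert, hpq.symm]
    rw [← flip'_edgePts Z, ← flip'_edgePts Z', hEs, hxq, sub_sub_cancel, edgePt_swap]
  -- An edge is an unordered pair of vertices; by `hswap` the formula does not depend on their
  -- order.
  have hγ : ∀ s : Finset (Fin 4), ∃ γ : Vec → Vec, ∀ p q, p ≠ q → s = {p, q} → ∀ x ∈ face {p, q},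
      γ x = edgePt p q (E (edgePts Z p q) (edgePts Z' p q) (x p)) := by
    intro s
    by_cases hs : ∃ p q, p ≠ q ∧ s = {p, q}
    · obtain ⟨p, q, hpq, rfl⟩ := hs
      refine ⟨fun x => edgePt p q (E (edgePts Z p q) (edgePts Z' p q) (x p)), ?_⟩
      intro p' q' hpq' e x hx
      have h1 : p' = p ∨ p' = q := by
        have : p' ∈ ({p, q} : Finset (Fin 4)) := by rw [e]; simp
        simpa using this
      have h2 : q' = p ∨ q' = q := by
        have : q' ∈ ({p, q} : Finset (Fin 4)) := by rw [e]; simp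
        simpa using this
      rcases h1 with rfl | rfl <;> rcases h2 with rfl | rfl
      · exact (hpq' rfl).elim
      · rfl
      · exact hswap _ _ hpq' x hx
      · exact (hpq' rfl).elim
    · exact ⟨id, fun p q hpq e => (hs ⟨p, q, hpq, e⟩).elim⟩
  choose γ hγ using hγ
  obtain ⟨g, g1, g2, -, g4⟩ := exists_skel_ext (k := 1) (by norm_num) (HomeoOn.id (skel 1))
    (fun _ _ => rfl) (γ := γ) (by
      intro s hs
      obtain ⟨p, q, hpq, rfl⟩ := Finset.card_eq_two.1 hs
      obtain ⟨h1, h2, h3⟩ := (hem p q hpq).homeoOn hpq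
      have he : EqOn (γ {p, q}) (fun x => edgePt p q (E (edgePts Z p q) (edgePts Z' p q) (x p)))
        (face {p, q}) := fun x hx => hγ _ p q hpq rfl x hx
      refine ⟨h1.congr he.symm, fun x hx => ?_, fun x hx => ?_⟩
      · rw [he hx]; exact h2 x hx
      · rw [he (faceBd_subset_face _ hx)]; exact h3 hx)
  have key : ∀ p q, p ≠ q → ∀ x ∈ face {p, q},
      g x = edgePt p q (E (edgePts Z p q) (edgePts Z' p q) (x p)) := fun p q hpq x hx => by
    rw [g4 {p, q} (Finset.card_pair hpq) hx, hγ _ p q hpq rfl x hx]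
  refine ⟨g, g1, g2, fun x hx => ?_, key⟩
  obtain ⟨p, q, hpq, hxe⟩ := exists_edge_of_skel hx
  obtain ⟨h1, h2⟩ := eq_edgePt hpq hxe
  have := (hem p q hpq).iff (x p) h1
  simp only [edgePts, mem_ofPred_eq, h1, true_and, ← h2] at this
  rw [key p q hpq x hxe, ← this, and_iff_right]
  · rfl
  · exact (hem p q hpq).mem h1

/-! ### Matchings that are compatible with the gluings. -/

namespace Triangulation

variable {n : ℕ} {T : Triangulation n}

variable (T) in
/-- A family of subsets of the tetrahedra that matches along the glued faces. -/
def Matches (Z : Fin n → Set Vec) : Prop :=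
  ∀ t f u p, T.glue t f = some (u, p) → ∀ x ∈ simplex, x f = 0 → (relabel p x ∈ Z u ↔ x ∈ Z t)

theorem Matches.edgePts {Z : Fin n → Set Vec} (hZ : T.Matches Z) {t u : Fin n} {f : Fin 4}
    {π : Equiv.Perm (Fin 4)} (h : T.glue t f = some (u, π)) {p q : Fin 4} (hp : p ≠ f) (hq : q ≠ f) :
    _root_.edgePts (Z u) (π p) (π q) = _root_.edgePts (Z t) p q := by
  ext r
  simp only [_root_.edgePts, mem_ofPred_eq]
  refine and_congr_right fun hr => ?_
  rw [← relabel_edgePt]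
  refine hZ t f u π h _ (edgePt_mem hr).1 ?_
  simp [edgePt, vert, hp.symm, hq.symm]

variable (T) in
/-- A map of a face that restricts to `g` on its boundary and carries `Z` to `Z'`. -/
def FaceMatch (g : Fin n → Vec → Vec) (Z Z' : Fin n → Set Vec) (t : Fin n) (f : Fin 4)
    (k : Vec → Vec) : Prop :=
  HomeoOn k (face {f}ᶜ) ∧ SuppPres k (face {f}ᶜ) ∧ EqOn k (g t) (faceBd {f}ᶜ) ∧
    ∀ x ∈ face {f}ᶜ, k x ∈ Z' t ↔ x ∈ Z t

theorem relabel_mem_face {π : Equiv.Perm (Fin 4)} {f : Fin 4} {x : Vec} (hx : x ∈ face {f}ᶜ) :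
    relabel π x ∈ face {π f}ᶜ := by
  rw [mem_face_compl] at hx ⊢
  exact ⟨relabel_mem_simplex hx.1, by rw [relabel_apply]; exact hx.2⟩

theorem relabel_symm_mem_face {π : Equiv.Perm (Fin 4)} {f : Fin 4} {x : Vec}
    (hx : x ∈ face {π f}ᶜ) : relabel π.symm x ∈ face {f}ᶜ := by
  have := relabel_mem_face (π := π.symm) hx
  rwa [Equiv.symm_apply_apply] at this

theorem FaceMatch.transport {g : Fin n → Vec → Vec} {Z Z' : Fin n → Set Vec} (hZ : T.Matches Z)
    (hZ' : T.Matches Z')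
    (hgc : ∀ t f u p, T.glue t f = some (u, p) → ∀ x ∈ skel 2, x f = 0 →
      g u (relabel p x) = relabel p (g t x))
    {t u : Fin n} {f : Fin 4} {π : Equiv.Perm (Fin 4)} (h : T.glue t f = some (u, π))
    {k : Vec → Vec} (hk : FaceMatch g Z Z' u (π f) k) :
    FaceMatch g Z Z' t f fun x => relabel π.symm (k (relabel π x)) := by
  obtain ⟨h1, h2, h3, h4⟩ := hk
  have hm : ∀ x ∈ face {f}ᶜ, relabel π.symm (k (relabel π x)) ∈ face {f}ᶜ := fun x hx =>
    relabel_symm_mem_face (h1.mem (relabel_mem_face hx))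
  refine ⟨⟨?_, hm, fun x hx y hy e => ?_, fun y hy => ?_⟩, fun x hx => ?_, fun x hx => ?_, fun x hx => ?_⟩
  · exact (continuous_relabel _).comp_continuousOn
      (h1.cont.comp (continuous_relabel _).continuousOn fun x hx => relabel_mem_face hx)
  · have e1 := congrArg (relabel π) e
    simp only [relabel_relabel_symm] at e1
    have e2 := congrArg (relabel π.symm) (h1.inj (relabel_mem_face hx) (relabel_mem_face hy) e1)
    simpa only [relabel_symm_relabel] using e2
  · obtain ⟨z, hz, e⟩ := h1.surj (relabel_mem_face (π := π) hy)
    exact ⟨relabel π.symm z, relabel_symm_mem_face hz, by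
      simp only [relabel_relabel_symm, e, relabel_symm_relabel]⟩
  · rw [supp_relabel, h2 _ (relabel_mem_face hx), supp_relabel]
    ext i
    simp
  · have hxf := (mem_face_compl.1 (faceBd_subset_face _ hx))
    have hx2 : x ∈ skel 2 := faceBd_subset_skel (card_compl_singleton f) hx
    have hb : relabel π x ∈ faceBd {π f}ᶜ := by
      refine ⟨relabel_mem_simplex hx.1, (relabel_mem_face (faceBd_subset_face _ hx)).2.ssubset_of_ne ?_⟩
      intro e
      have := congrArg Finset.card e
      rw [supp_relabel, Finset.card_map, card_compl_singleton] at this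
      have := hx2.2
      omega
    simp only
    rw [h3 hb, hgc t f u π h x hx2 hxf.2, relabel_symm_relabel]
  · have hmx := mem_face_compl.1 (hm x hx)
    have hxf := mem_face_compl.1 hx
    rw [← hZ' t f u π h _ hmx.1 hmx.2, relabel_relabel_symm, h4 _ (relabel_mem_face hx),
      hZ t f u π h x hxf.1 hxf.2]

/-- Each glued pair of faces receives one map, chosen on the lexicographically smaller face and
transported to the other. No face is glued to itself, so the order always decides. -/
theorem exists_face_maps {g : Fin n → Vec → Vec} {Z Z' : Fin n → Set Vec} (hZ : T.Matches Z)
    (hZ' : T.Matches Z')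
    (hgc : ∀ t f u p, T.glue t f = some (u, p) → ∀ x ∈ skel 2, x f = 0 →
      g u (relabel p x) = relabel p (g t x))
    (hex : ∀ t f, ∃ k, FaceMatch g Z Z' t f k) :
    ∃ κ : Fin n → Fin 4 → Vec → Vec, (∀ t f, FaceMatch g Z Z' t f (κ t f)) ∧
      ∀ t f u p, T.glue t f = some (u, p) → ∀ x, κ u (p f) (relabel p x) = relabel p (κ t f x) := by
  choose κ₀ hκ₀ using hex
  let κ : Fin n → Fin 4 → Vec → Vec := fun t f => match T.glue t f with
    | none => κ₀ t f
    | some (u, π) => if toLex (t, f) < toLex (u, π f) then κ₀ t f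
        else fun x => relabel π.symm (κ₀ u (π f) (relabel π x))
  have hnone : ∀ t f, T.glue t f = none → κ t f = κ₀ t f := fun t f h => by
    simp only [κ, h]
  have hlt : ∀ t f u π, T.glue t f = some (u, π) → toLex (t, f) < toLex (u, π f) → κ t f = κ₀ t f :=
    fun t f u π h h' => by
      simp only [κ, h, if_pos h']
  have hge : ∀ t f u π, T.glue t f = some (u, π) → ¬ toLex (t, f) < toLex (u, π f) →
      κ t f = fun x => relabel π.symm (κ₀ u (π f) (relabel π x)) := fun t f u π h h' => by
    simp only [κ, h, if_neg h']
  refine ⟨κ, fun t f => ?_, fun t f u π h x => ?_⟩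
  · cases h : T.glue t f with
    | none => rw [hnone t f h]; exact hκ₀ t f
    | some P =>
      obtain ⟨u, π⟩ := P
      by_cases h' : toLex (t, f) < toLex (u, π f)
      · rw [hlt t f u π h h']; exact hκ₀ t f
      · rw [hge t f u π h h']; exact FaceMatch.transport hZ hZ' hgc h (hκ₀ u (π f))
  · have hs := T.glue_symm t f u π h
    have hne := T.glue_ne_self t f u π h
    by_cases h' : toLex (t, f) < toLex (u, π f)
    · rw [hlt t f u π h h', hge u (π f) t π.symm hs (by rw [Equiv.symm_apply_apply]; exact h'.not_gt)]
      simp only [Equiv.symm_symm, Equiv.symm_apply_apply, relabel_symm_relabel]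
    · have h2 : toLex (u, π f) < toLex (t, f) :=
        lt_of_le_of_ne (not_lt.1 h') fun e => hne (toLex.injective e)
      rw [hge t f u π h h', hlt u (π f) t π.symm hs (by rw [Equiv.symm_apply_apply]; exact h2)]
      simp only [relabel_relabel_symm]

/-- Two families with the same numbers of discs of every type are carried to each other by
compatible homeomorphisms of the tetrahedra. -/
theorem exists_matching {Z Z' : Fin n → Set Vec} (hZ : T.Matches Z) (hZ' : T.Matches Z')
    {c : Fin n → DiscType → ℕ} (hv : ∀ t, ValidCount (c t)) (hc : ∀ t, HasCount (Z t) (c t))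
    (hc' : ∀ t, HasCount (Z' t) (c t)) :
    ∃ h : Fin n → Vec → Vec, (∀ t, HomeoOn (h t) simplex) ∧ (∀ t, SuppPres (h t) simplex) ∧
      T.Compat h ∧ ∀ t, ∀ x ∈ simplex, h t x ∈ Z' t ↔ x ∈ Z t := by
  obtain ⟨E, hE, hEs⟩ := exists_symm_edgeMap
  have h2 := fun t => exists_two_skeleton_map (hc t) (hc' t) hE hEs
  choose g g1 g2 g3 g4 using h2
  -- The edge maps depend only on the positions of the marked points, and these positions agree
  -- across the gluing.
  have hgc : ∀ t f u p, T.glue t f = some (u, p) → ∀ x ∈ skel 2, x f = 0 →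
      g u (relabel p x) = relabel p (g t x) := by
    intro t f u π h x hx hxf
    obtain ⟨p, q, hpq, hp, hq, hxe⟩ := exists_edge_in hx (s := {f}ᶜ)
      (by rw [card_compl_singleton]; norm_num) (mem_face_compl.2 ⟨hx.1, hxf⟩).2
    rw [Finset.mem_compl, Finset.mem_singleton] at hp hq
    have hre : relabel π x ∈ face {π p, π q} := by
      refine ⟨relabel_mem_simplex hx.1, ?_⟩
      rw [supp_relabel]
      intro i hi
      obtain ⟨j, hj, rfl⟩ := Finset.mem_map.1 hi
      have := hxe.2 hj
      simp only [Finset.mem_insert, Finset.mem_singleton] at this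
      rcases this with rfl | rfl <;> simp
    rw [g4 t p q hpq x hxe, g4 u (π p) (π q) (π.injective.ne hpq) _ hre, relabel_apply,
      relabel_edgePt, hZ.edgePts h hp hq, hZ'.edgePts h hp hq]
  have hbd : ∀ f : Fin 4, faceBd {f}ᶜ ⊆ skel 2 := fun f => faceBd_subset_skel (card_compl_singleton f)
  obtain ⟨κ, κ1, κ2⟩ := exists_face_maps hZ hZ' hgc fun t f => by
    obtain ⟨k, k1, k2, k3, k4⟩ := exists_conj_ext (hc t) (hc' t) (s := {f}ᶜ)
      (fun β => exists_std_face_ext (c t) (card_compl_singleton f))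
      ((g1 t).face (g2 t) (skel_subset 2) (P := fun r => r ⊂ {f}ᶜ) fun x hx hxs => hbd f ⟨hx, hxs⟩)
      (fun x hx => g2 t x (hbd f hx)) (fun x hx => g3 t x (hbd f hx))
    exact ⟨k, k1, k2, k3, k4⟩
  have hex : ∀ t, ∃ h, HomeoOn h simplex ∧ SuppPres h simplex ∧
      (∀ f, EqOn h (κ t f) (face {f}ᶜ)) ∧ ∀ x ∈ simplex, h x ∈ Z' t ↔ x ∈ Z t := by
    intro t
    have hs : ∀ s : Finset (Fin 4), s.card = 3 → ∃ f, s = {f}ᶜ := by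
      intro s hs
      have h1 : sᶜ.card = 1 := by rw [Finset.card_compl, hs]; rfl
      obtain ⟨f, hf⟩ := Finset.card_eq_one.1 h1
      exact ⟨f, by rw [← hf, compl_compl]⟩
    have hγ : ∀ s : Finset (Fin 4), ∃ γ, ∀ f, s = {f}ᶜ → γ = κ t f := by
      intro s
      by_cases h : ∃ f, s = {f}ᶜ
      · obtain ⟨f, rfl⟩ := h
        refine ⟨κ t f, fun f' e => ?_⟩
        rw [Finset.singleton_injective (compl_injective e)]
      · exact ⟨id, fun f e => (h ⟨f, e⟩).elim⟩
    choose γ hγ using hγ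
    obtain ⟨β, b1, b2, b3, b4⟩ := exists_skel_ext (k := 2) (by norm_num) (g1 t) (g2 t) (γ := γ) (by
      intro s h
      obtain ⟨f, rfl⟩ := hs s h
      rw [hγ _ f rfl]
      exact ⟨(κ1 t f).1, (κ1 t f).2.1, (κ1 t f).2.2.1⟩)
    have bκ : ∀ f, EqOn β (κ t f) (face {f}ᶜ) := fun f => by
      have := b4 _ (card_compl_singleton f)
      rwa [hγ _ f rfl] at this
    have bZ : ∀ x ∈ skel 3, β x ∈ Z' t ↔ x ∈ Z t := by
      intro x hx
      obtain ⟨s, h, hxs⟩ := exists_face_of_skel (k := 2) (by norm_num) hx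
      obtain ⟨f, rfl⟩ := hs s h
      rw [bκ f hxs]
      exact (κ1 t f).2.2.2 x hxs
    have hext := exists_conj_ext (hc t) (hc' t) (s := Finset.univ) (g := β) (by
      rw [faceBd_univ, face_univ]
      exact fun β => exists_std_tetra_ext (hv t))
    rw [faceBd_univ, face_univ] at hext
    obtain ⟨m, m1, m2, m3, m4⟩ := hext b1 b2 bZ
    refine ⟨m, m1, m2, fun f x hx => ?_, m4⟩
    rw [m3 (face_subset_skel (card_compl_singleton f) hx), bκ f hx]
  choose h h1 h2 h3 h4 using hex
  refine ⟨h, h1, h2, fun t f u π hglue x hx hxf => ?_, h4⟩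
  have hxc := mem_face_compl.2 ⟨hx, hxf⟩
  rw [h3 t f hxc, h3 u (π f) (relabel_mem_face hxc), κ2 t f u π hglue]

end Triangulation

open DiscType

/-! ### The type of a disc is well defined -/

/-- The edge from vertex 3 to vertex `![2, 1, 0] i` is one of the two that octagons of type `i` meet
twice. Octagons of the other types meet it once, which tells the types apart. -/
theorem oct_edge_twice (i : Fin 3) : (DiscType.oct i).fn (edgePt 3 (![2, 1, 0] i) (3 / 4)) = 0 ∧
    (DiscType.oct i).fn (edgePt 3 (![2, 1, 0] i) (1 / 4)) = 0 := by
  fin_cases i <;> constructor <;> simp [DiscType.fn, octFun, edgePt, vert] <;>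
    norm_num [abs_of_pos, abs_of_neg]

theorem oct_edge_once {i k : Fin 3} (h : i ≠ k) {r : ℝ} (hr : r ∈ Icc (0 : ℝ) 1)
    (h0 : (DiscType.oct k).fn (edgePt 3 (![2, 1, 0] i) r) = 0) : r = 1 / 2 := by
  have h1 : |1 - r| = 1 - r := abs_of_nonneg (by linarith [hr.2])
  have h2 : |r| = r := abs_of_nonneg hr.1
  have h3 : |r - 1| = 1 - r := by rw [abs_sub_comm, h1]
  fin_cases i <;> fin_cases k <;> first
    | exact absurd rfl h
    | (simp [DiscType.fn, octFun, edgePt, vert, h1, h2, h3] at h0; linarith)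

theorem IsDiscVec.oct_unique {i k : Fin 3} {D : Set Vec} (hi : IsDiscVec (.oct i) D)
    (hk : IsDiscVec (.oct k) D) : i = k := by
  by_contra hne
  obtain ⟨hD, a, a1, a2, a3⟩ := hi
  obtain ⟨-, b, b1, b2, b3⟩ := hk
  set q : Fin 4 := ![2, 1, 0] i with hq
  have hpq : (3 : Fin 4) ≠ q := by rw [hq]; fin_cases i <;> decide
  have ha := a1.edge a2 subset_rfl (edge_subset_simplex 3 q)
  have hb := b1.edge b2 subset_rfl (edge_subset_simplex 3 q)
  obtain ⟨x, hx, ex⟩ := ha.surj (edgePt_mem (p := 3) (q := q) (r := 3 / 4) (by norm_num))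
  obtain ⟨y, hy, ey⟩ := ha.surj (edgePt_mem (p := 3) (q := q) (r := 1 / 4) (by norm_num))
  have hxD : x ∈ D := (a3 x hx.1).2 (by rw [ex]; exact (oct_edge_twice i).1)
  have hyD : y ∈ D := (a3 y hy.1).2 (by rw [ey]; exact (oct_edge_twice i).2)
  have key : ∀ z ∈ D, z ∈ face {3, q} → b z = edgePt 3 q (1 / 2) := by
    intro z hz hze
    obtain ⟨h1, h2⟩ := eq_edgePt hpq (hb.mem hze)
    have h3 := (b3 z hze.1).1 hz
    rw [h2] at h3
    rw [h2, oct_edge_once hne h1 h3]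
  have hxy := hb.inj hx hy (by rw [key x hxD hx, key y hyD hy])
  rw [hxy, ey] at ex
  have := congrFun ex 3
  rw [edgePt_apply hpq, edgePt_apply hpq] at this
  norm_num at this

/-- Discs of any other type meet some edge whose ends are on the same side of `σ`, and discs of type
`σ` miss such edges. -/
theorem IsDiscVec.eq_of_flat {σ τ : DiscType} {D : Set Vec} (h1 : IsDiscVec σ D)
    (h2 : IsDiscVec τ D) (hσ : σ.IsFlat) : σ = τ := by
  by_contra hne
  have key : ∃ p q, τ.Meets p q ∧ (p ∈ σ.side ↔ q ∈ σ.side) := by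
    rcases std_side hσ hne 0 0 with ⟨⟨p, q, h, hp, hq⟩, -⟩ | ⟨⟨p, q, h, hp, hq⟩, -⟩ |
      ⟨⟨p, q, h, hp, hq⟩, -⟩
    exacts [⟨p, q, h, by simp [hp, hq]⟩, ⟨p, q, h, by simp [hp, hq]⟩, ⟨p, q, h, by simp [hp, hq]⟩]
  obtain ⟨p, q, h, hpq⟩ := key
  obtain ⟨x, hx, hxe⟩ := h2.exists_mem_edge h.1 h.2
  exact h1.not_mem_edge hσ hpq hx hxe

theorem IsDiscVec.type_unique {σ τ : DiscType} {D : Set Vec} (h1 : IsDiscVec σ D)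
    (h2 : IsDiscVec τ D) : σ = τ := by
  by_cases hσ : σ.IsFlat
  · exact h1.eq_of_flat h2 hσ
  by_cases hτ : τ.IsFlat
  · exact (h2.eq_of_flat h1 hτ).symm
  cases σ with
  | tri v => exact (hσ trivial).elim
  | quad v => exact (hσ trivial).elim
  | oct i =>
    cases τ with
    | tri v => exact (hτ trivial).elim
    | quad v => exact (hτ trivial).elim
    | oct k => rw [h1.oct_unique h2]

theorem IsDisc.type_unique {σ τ : DiscType} {D : Set Tetra} (h1 : IsDisc σ D)
    (h2 : IsDisc τ D) : σ = τ := h1.vec.type_unique h2.vec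

/-- Disjoint discs of two types neither of which is a triangle. -/
theorem IsDiscVec.not_disjoint_quad {i : Fin 3} {τ : DiscType} {D D' : Set Vec}
    (h1 : IsDiscVec (.quad i) D) (h2 : IsDiscVec τ D') (hD' : IsPreconnected D')
    (hne : DiscType.quad i ≠ τ) (hτ : ∀ v, τ ≠ .tri v) : ¬ Disjoint D D' := by
  intro hdis
  have hl := (DiscType.quad i).level_mem 0
  -- Once the quadrilateral is flat, the other disc has points on both sides of it.
  obtain ⟨G, g1, g2, -, g4⟩ := exists_place_flat (C := []) h1 trivial hl.1 hl.2 (by simp)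
  obtain ⟨hp, hn⟩ := exists_meets_quad hne hτ
  have h3 := h2.image g1 g2
  obtain ⟨x, hx, hpos⟩ := h3.exists_stdFn_pos (σ := .quad i) trivial 0 hp
  obtain ⟨y, hy, hneg⟩ := h3.exists_stdFn_neg (σ := .quad i) trivial 0 hn
  refine absurd (pos_of_preconnected ((DiscType.quad i).continuous_stdFn 0)
    (hD'.image _ (g1.cont.mono h2.1)) ?_ hx hpos y hy) hneg.not_gt
  rintro _ ⟨z, hz, rfl⟩ h0
  rw [← cutter_eq_stdFn (σ := .quad i) trivial 0 (g1.mem (h2.1 hz)), g4 z (h2.1 hz)] at h0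
  exact disjoint_left.1 hdis h0 hz

namespace Triangulation

variable {n : ℕ} {T : Triangulation n}

/-! ### Counting the pieces of a surface -/

/-- The part of `S` in a tetrahedron. -/
def part (S : Set T.Space) (t : Fin n) : Set Vec := Subtype.val '' (T.char t ⁻¹' S)

theorem mem_part {S : Set T.Space} {t : Fin n} (x : Tetra) : x.1 ∈ part S t ↔ T.char t x ∈ S := by
  constructor
  · rintro ⟨y, hy, e⟩; rw [← Subtype.ext e]; exact hy
  · exact fun h => ⟨x, h, rfl⟩

theorem matches_part (S : Set T.Space) : T.Matches (part S) := by
  intro t f u p h x hx hxf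
  have := char_eq_of_glue h ⟨x, hx⟩ ⟨relabel p x, relabel_mem_simplex hx⟩ hxf rfl
  rw [show x ∈ part S t ↔ _ from mem_part ⟨x, hx⟩, this]
  exact mem_part ⟨relabel p x, relabel_mem_simplex hx⟩

theorem pieces_disjoint {S : Set T.Space} {t : Fin n} {D D' : Set Tetra} (h : D ∈ T.pieces S t)
    (h' : D' ∈ T.pieces S t) (hne : D ≠ D') : Disjoint D D' := by
  obtain ⟨x, hx, rfl⟩ := h
  obtain ⟨y, hy, rfl⟩ := h'
  rw [disjoint_left]
  intro z hz hz'
  exact hne ((connectedComponentIn_eq hz).trans (connectedComponentIn_eq hz').symm)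

theorem pieces_preconnected {S : Set T.Space} {t : Fin n} {D : Set Tetra} (h : D ∈ T.pieces S t) :
    IsPreconnected D := by
  obtain ⟨x, hx, rfl⟩ := h
  exact isPreconnected_connectedComponentIn

theorem mem_pieces_cover {S : Set T.Space} {t : Fin n} {x : Tetra} :
    T.char t x ∈ S ↔ ∃ D ∈ T.pieces S t, x ∈ D := by
  constructor
  · exact fun h => ⟨_, ⟨x, h, rfl⟩, mem_connectedComponentIn h⟩
  · rintro ⟨_, ⟨y, hy, rfl⟩, hx⟩
    exact connectedComponentIn_subset (T.char t ⁻¹' S) _ hx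

theorem disjoint_val_image {D D' : Set Tetra} (h : Disjoint D D') :
    Disjoint (Subtype.val '' D : Set Vec) (Subtype.val '' D') :=
  (disjoint_image_iff Subtype.val_injective).2 h

namespace OctSurface

variable (S : T.OctSurface)

theorem oct_unique {t : Fin n} {D D' : Set Tetra} (h : D ∈ T.pieces S.carrier t)
    (h' : D' ∈ T.pieces S.carrier t) {i k : Fin 3} (hi : IsDisc (.oct i) D) (hk : IsDisc (.oct k) D') :
    D = D' := by
  have := S.existsUnique_octagon.unique (y₁ := (t, D)) (y₂ := (t, D')) ⟨h, i, hi⟩ ⟨h', k, hk⟩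
  exact (Prod.ext_iff.1 this).2

theorem finite_count (t : Fin n) (τ : DiscType) :
    {D | D ∈ T.pieces S.carrier t ∧ IsDisc τ D}.Finite :=
  (S.finite_pieces t).subset fun _ h => h.1

theorem exists_of_count_pos {t : Fin n} {τ : DiscType} (h : 0 < S.count t τ) :
    ∃ D ∈ T.pieces S.carrier t, IsDisc τ D := by
  obtain ⟨D, h1, h2⟩ := (Set.ncard_pos (S.finite_count t τ)).1 h
  exact ⟨D, h1, h2⟩

/-- Different pieces are disjoint, but a quadrilateral crosses every quadrilateral of another type
and every octagon; two octagons are excluded by the definition of the surface. -/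
theorem validCount (t : Fin n) : ValidCount (S.count t) := by
  intro σ τ hσ hτ h1 h2
  obtain ⟨D, hD, hD1⟩ := S.exists_of_count_pos h1
  obtain ⟨D', hD', hD1'⟩ := S.exists_of_count_pos h2
  by_contra hne
  have hDD : D ≠ D' := fun e => hne (hD1.type_unique (e ▸ hD1'))
  have hdis := disjoint_val_image (pieces_disjoint hD hD' hDD)
  have hc := (pieces_preconnected hD).image _ continuous_subtype_val.continuousOn
  have hc' := (pieces_preconnected hD').image _ continuous_subtype_val.continuousOn
  cases σ with
  | tri v => exact hσ v rfl
  | quad i => exact hD1.vec.not_disjoint_quad hD1'.vec hc' hne hτ hdis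
  | oct i =>
    cases τ with
    | tri v => exact hτ v rfl
    | quad k => exact hD1'.vec.not_disjoint_quad hD1.vec hc (Ne.symm hne) hσ hdis.symm
    | oct k => exact hDD (S.oct_unique hD hD' hD1 hD1')

-- Since the type of a disc is unique, the number of pieces with a given chosen type is `count`.
open Classical in
theorem hasCount (t : Fin n) : HasCount (part S.carrier t) (S.count t) := by
  have hty : ∀ D, ∃ τ, D ∈ T.pieces S.carrier t → IsDisc τ D := fun D => by
    by_cases h : D ∈ T.pieces S.carrier t
    · obtain ⟨τ, hτ⟩ := S.isDisc_of_mem_pieces t D h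
      exact ⟨τ, fun _ => hτ⟩
    · exact ⟨.tri 0, fun h' => (h h').elim⟩
  choose ty hty using hty
  have hfin := S.finite_pieces t
  have hR : ∀ D, D ∈ hfin.toFinset ↔ D ∈ T.pieces S.carrier t := fun D => hfin.mem_toFinset
  obtain ⟨G, g1, g2, g3⟩ := exists_standardise (R := hfin.toFinset) (τ := ty)
    (D := fun D => Subtype.val '' D)
    (fun D hD => (hty D ((hR D).1 hD)).vec)
    (fun D hD => (pieces_preconnected ((hR D).1 hD)).image _ continuous_subtype_val.continuousOn)
    (fun D hD D' hD' hne => disjoint_val_image (pieces_disjoint ((hR D).1 hD) ((hR D').1 hD') hne))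
    (fun D hD D' hD' h h' => by
      have h1 := hty D ((hR D).1 hD)
      have h2 := hty D' ((hR D').1 hD')
      have ho : ∀ τ : DiscType, ¬ τ.IsFlat → ∃ i, τ = .oct i := fun τ hτ => by
        cases τ with
        | tri v => exact (hτ trivial).elim
        | quad v => exact (hτ trivial).elim
        | oct i => exact ⟨i, rfl⟩
      obtain ⟨i, e1⟩ := ho _ h
      obtain ⟨k, e2⟩ := ho _ h'
      rw [e1] at h1
      rw [e2] at h2
      exact S.oct_unique ((hR D).1 hD) ((hR D').1 hD') h1 h2)
  have hcount : typeCount hfin.toFinset ty = S.count t := by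
    funext σ
    rw [typeCount, count, ← Set.ncard_coe_finset]
    congr 1
    ext D
    simp only [Finset.coe_filter, mem_ofPred_eq, hR]
    exact and_congr_right fun hD => ⟨fun e => e ▸ hty D hD, fun h => (hty D hD).type_unique h⟩
  rw [hcount] at g3
  refine ⟨G, g1, g2, fun x hx => ?_⟩
  rw [← g3 x hx, ← Subtype.coe_mk (p := (· ∈ simplex)) x hx, mem_part, mem_pieces_cover]
  simp only [hR]
  exact exists_congr fun D => and_congr_right fun _ => ⟨fun h => ⟨_, h, rfl⟩, by
    rintro ⟨y, hy, e⟩; rwa [← Subtype.ext (a1 := y) (a2 := ⟨x, hx⟩) e]⟩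

end OctSurface

theorem normalIsotopic_of_hasCount {S S' : Set T.Space} {c : Fin n → DiscType → ℕ}
    (hv : ∀ t, ValidCount (c t)) (hc : ∀ t, HasCount (part S t) (c t))
    (hc' : ∀ t, HasCount (part S' t) (c t)) : T.NormalIsotopic S S' := by
  obtain ⟨h, h1, h2, h3, h4⟩ := exists_matching (matches_part S) (matches_part S') hv hc hc'
  refine normalIsotopic_of_compat h1 h2 h3 fun t x y e => ?_
  rw [← mem_part x, ← mem_part y, e, h4 t x.1 x.2]

theorem normalIsotopic_of_count_eq (S S' : T.OctSurface) (h : ∀ t τ, S.count t τ = S'.count t τ) :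
    T.NormalIsotopic S.carrier S'.carrier :=
  normalIsotopic_of_hasCount S.validCount S.hasCount fun t => by
    rw [show S.count t = S'.count t from funext (h t)]
    exact S'.hasCount t

end Triangulation

open DiscType

/-! ### Connected components of finite disjoint unions -/

theorem connectedComponentIn_sUnion {X : Type*} [TopologicalSpace X] {R : Set (Set X)}
    (hfin : R.Finite) (hcl : ∀ D ∈ R, IsClosed D) (hpre : ∀ D ∈ R, IsPreconnected D)
    (hdis : ∀ D ∈ R, ∀ D' ∈ R, D ≠ D' → Disjoint D D') {D : Set X} (hD : D ∈ R) {x : X}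
    (hx : x ∈ D) : connectedComponentIn (⋃₀ R) x = D := by
  have hxU : x ∈ ⋃₀ R := ⟨D, hD, hx⟩
  refine Subset.antisymm ?_ ((hpre D hD).subset_connectedComponentIn hx (subset_sUnion_of_mem hD))
  have hrest : IsClosed (⋃₀ (R \ {D})) := by
    rw [sUnion_eq_biUnion]
    exact (hfin.subset sdiff_subset).isClosed_biUnion fun D' hD' => hcl D' hD'.1
  rcases isPreconnected_iff_subset_of_disjoint_closed.1 (isPreconnected_connectedComponentIn
    (x := x) (F := ⋃₀ R)) D (⋃₀ (R \ {D})) (hcl D hD) hrest (by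
      intro y hy
      obtain ⟨D', hD', hyD'⟩ := connectedComponentIn_subset _ _ hy
      by_cases h : D' = D
      · exact Or.inl (h ▸ hyD')
      · exact Or.inr ⟨D', ⟨hD', h⟩, hyD'⟩) (by
      rw [eq_empty_iff_forall_notMem]
      rintro y ⟨-, h1, D', ⟨hD', h⟩, h2⟩
      exact disjoint_left.1 (hdis D' hD' D hD h) h2 h1) with h | h
  · exact h
  · obtain ⟨D', ⟨hD', hne⟩, hxD'⟩ := h (mem_connectedComponentIn hxU)
    exact (disjoint_left.1 (hdis D' hD' D hD hne) hxD' hx).elim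

/-- Used to read off the pieces of a surface from an explicit decomposition of its preimage. -/
theorem components_eq_of_cover {X : Type*} [TopologicalSpace X] {R : Set (Set X)} {Z : Set X}
    (hZ : Z = ⋃₀ R) (hfin : R.Finite) (hcl : ∀ D ∈ R, IsClosed D) (hpre : ∀ D ∈ R, IsPreconnected D)
    (hne : ∀ D ∈ R, D.Nonempty) (hdis : ∀ D ∈ R, ∀ D' ∈ R, D ≠ D' → Disjoint D D') :
    {D | ∃ x ∈ Z, D = connectedComponentIn Z x} = R := by
  subst hZ
  ext D
  constructor
  · rintro ⟨x, ⟨D', hD', hx⟩, rfl⟩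
    rwa [connectedComponentIn_sUnion hfin hcl hpre hdis hD' hx]
  · intro hD
    obtain ⟨x, hx⟩ := hne D hD
    exact ⟨x, ⟨D, hD, hx⟩, (connectedComponentIn_sUnion hfin hcl hpre hdis hD hx).symm⟩

/-! ### Triangles parallel to a face -/

theorem IsDiscVec.isDisc {τ : DiscType} {D : Set Tetra} (h : IsDiscVec τ (Subtype.val '' D)) :
    IsDisc τ D := by
  obtain ⟨-, k, k1, k2, k3⟩ := h
  obtain ⟨e, he⟩ := k1.exists_tetra
  refine ⟨e.symm, ((facePreserving_iff he).2 k2).symm, ?_⟩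
  ext x
  have h1 := k3 x.1 x.2
  rw [Subtype.val_injective.mem_set_image, ← he, ← DiscType.mem_model] at h1
  rw [h1]
  constructor
  · exact fun h => ⟨e x, h, e.symm_apply_apply x⟩
  · rintro ⟨y, hy, rfl⟩
    rwa [e.apply_symm_apply]

theorem isDiscVec_level (v : Fin 4) {r : ℝ} (h0 : 0 < r) (h1 : r < 1) :
    IsDiscVec (.tri v) {x | x ∈ simplex ∧ x v = r} := by
  -- This weight carries the level `r` to the level 1/2 of the model triangle.
  have hα : 0 < (1 - r) / r := div_pos (by linarith) h0
  obtain ⟨w1, w2⟩ := homeoOn_weigh (s := {v}) hα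
  refine ⟨fun x hx => hx.1, _, w1, w2, fun x hx => ?_⟩
  have hp := weigh_pos (s := {v}) hα hx
  rw [fn_of_flat (τ := .tri v) trivial, mem_ofPred_eq, and_iff_right hx]
  simp only [side]
  rw [sum_weigh, sub_eq_zero, div_eq_iff hp.ne']
  simp only [Finset.sum_singleton]
  have e : (1 - r) / r * r = 1 - r := div_mul_cancel₀ _ h0.ne'
  constructor
  · rintro rfl
    linear_combination 1 / 2 * e
  · intro h
    have h2 : (1 - r) / r * x v = 1 - x v := by linarith
    rw [div_mul_eq_mul_div, div_eq_iff h0.ne'] at h2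
    linarith

theorem isDisc_level (v : Fin 4) {r : ℝ} (h0 : 0 < r) (h1 : r < 1) :
    IsDisc (.tri v) {x : Tetra | x.1 v = r} := by
  refine IsDiscVec.isDisc ?_
  convert isDiscVec_level v h0 h1 using 1
  ext x
  constructor
  · rintro ⟨y, hy, rfl⟩; exact ⟨y.2, hy⟩
  · rintro ⟨hx, h⟩; exact ⟨⟨x, hx⟩, h, rfl⟩

theorem convex_level (v : Fin 4) (r : ℝ) : Convex ℝ {x : Vec | x ∈ simplex ∧ x v = r} :=
  (convex_stdSimplex ℝ (Fin 4)).inter (convex_hyperplane (coord v).toLinearMap.isLinear r)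

theorem isPreconnected_level (v : Fin 4) (r : ℝ) : IsPreconnected {x : Tetra | x.1 v = r} := by
  rw [← Topology.IsInducing.subtypeVal.isPreconnected_image]
  convert (convex_level v r).isPreconnected using 1
  ext x
  constructor
  · rintro ⟨y, hy, rfl⟩; exact ⟨y.2, hy⟩
  · rintro ⟨hx, h⟩; exact ⟨⟨x, hx⟩, h, rfl⟩

theorem isClosed_level (v : Fin 4) (r : ℝ) : IsClosed {x : Tetra | x.1 v = r} :=
  isClosed_eq ((continuous_apply v).comp continuous_subtype_val) continuous_const

theorem level_nonempty (v : Fin 4) {r : ℝ} (hr : r ∈ Icc (0 : ℝ) 1) :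
    {x : Tetra | x.1 v = r}.Nonempty := by
  obtain ⟨q, hq⟩ : ∃ q, v ≠ q := exists_ne v |>.imp fun _ h => h.symm
  exact ⟨⟨edgePt v q r, (edgePt_mem hr).1⟩, edgePt_apply hq r⟩

theorem eq_of_levels {x : Vec} (hx : x ∈ simplex) {v w : Fin 4} {r : ℝ} (hr : 1 / 2 < r)
    (hv : x v = r) (hw : x w = r) : v = w := by
  by_contra h
  have : x v + x w ≤ 1 := by
    rw [← hx.2, ← Finset.sum_pair h]
    exact Finset.sum_le_sum_of_subset_of_nonneg (Finset.subset_univ _) fun i _ _ => hx.1 i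
  linarith

theorem IsDisc.isClosed {τ : DiscType} {D : Set Tetra} (h : IsDisc τ D) : IsClosed D := by
  have := h.vec.isClosed.preimage continuous_subtype_val (X := Tetra)
  rwa [preimage_image_eq _ Subtype.val_injective] at this

namespace Triangulation

variable {n : ℕ} {T : Triangulation n}

theorem vertex_glue {t u : Fin n} {f : Fin 4} {p : Equiv.Perm (Fin 4)}
    (h : T.glue t f = some (u, p)) {v : Fin 4} (hv : v ≠ f) : T.vertex t v = T.vertex u (p v) := by
  refine char_eq_of_glue h _ _ ?_ ?_
  · exact vert_ne hv.symm
  · funext i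
    simp [relabel, Pi.single_apply, Equiv.symm_apply_eq]

theorem isClosed_space_iff {S : Set T.Space} : IsClosed S ↔ ∀ t, IsClosed (T.char t ⁻¹' S) := by
  have hcont : ∀ t, Continuous (T.char t) := fun t =>
    continuous_quot_mk.comp (Continuous.prodMk_right t)
  refine ⟨fun h t => h.preimage (hcont t), fun h => ?_⟩
  rw [← isQuotientMap_quot_mk.isClosed_preimage]
  have : Quot.mk T.GlueRel ⁻¹' S = ⋃ t : Fin n, {t} ×ˢ (T.char t ⁻¹' S) := by
    ext ⟨t, x⟩
    simp only [mem_preimage, mem_iUnion, mem_prod, mem_singleton_iff, exists_eq_left', char]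
  rw [this]
  exact isClosed_iUnion_of_finite fun t => (isClosed_discrete _).prod (h t)

/-! ### Parallel copies of vertex links -/

variable (T) in
/-- The vertex link at a given height. -/
def linkAt (V : T.Space) (r : ℝ) : Set T.Space :=
  {P | ∃ (t : Fin n) (v : Fin 4) (x : Tetra), T.vertex t v = V ∧ x v = r ∧ P = T.char t x}

theorem linkAt_three_quarters (V : T.Space) : T.linkAt V (3 / 4) = T.link V := rfl

/-- The condition on the right is invariant under gluing, so it depends only on the point of `|T|`.
Positivity of `r` ensures that the corner `v` belongs to the glued face. -/
theorem char_mem_linkAt {V : T.Space} {r : ℝ} (hr : 0 < r) {t : Fin n} {x : Tetra} :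
    T.char t x ∈ T.linkAt V r ↔ ∃ v, T.vertex t v = V ∧ x.1 v = r := by
  let Q : Fin n × Tetra → Prop := fun P => ∃ v, T.vertex P.1 v = V ∧ P.2.1 v = r
  have h1 : ∀ P P', T.GlueRel P P' → Q P → Q P' := by
    rintro ⟨t, x⟩ ⟨u, y⟩ ⟨f, p, h, hf, hp⟩ ⟨v, hv, hxv⟩
    have hvf : v ≠ f := by
      rintro rfl
      have : x.1 v = 0 := hf
      linarith
    exact ⟨p v, (vertex_glue h hvf).symm.trans hv, (hp v).trans hxv⟩
  have h2 : ∀ P P', T.GlueRel P P' → Q P = Q P' := fun P P' h =>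
    propext ⟨h1 P P' h, h1 P' P (glueRel_symm h)⟩
  constructor
  · rintro ⟨t', v, x', hv, hx, e⟩
    have : Quot.lift Q h2 (T.char t x) = Quot.lift Q h2 (T.char t' x') := by rw [e]
    exact (show Q (t', x') = Q (t, x) from this.symm).mp ⟨v, hv, hx⟩
  · rintro ⟨v, hv, hx⟩
    exact ⟨t, v, x, hv, hx, rfl⟩

variable (T) in
open Classical in
/-- The numbers of discs of a vertex link. -/
noncomputable def linkCount (V : T.Space) (t : Fin n) : DiscType → ℕ
  | .tri v => if T.vertex t v = V then 1 else 0
  | _ => 0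

-- A level above 1/2 makes the triangles at different corners of one tetrahedron disjoint.
open Classical in
theorem hasCount_linkAt (V : T.Space) {r : ℝ} (h0 : 1 / 2 < r) (h1 : r < 1) (t : Fin n) :
    HasCount (part (T.linkAt V r) t) (T.linkCount V t) := by
  obtain ⟨G, g1, g2, g3⟩ := exists_standardise (τ := DiscType.tri)
    (R := Finset.univ.filter fun v => T.vertex t v = V) (D := fun v => {x | x ∈ simplex ∧ x v = r})
    (fun v _ => isDiscVec_level v (by linarith) h1) (fun v _ => (convex_level v r).isPreconnected)
    (fun v _ w _ hne => disjoint_left.2 fun x hx hx' => hne (eq_of_levels hx.1 h0 hx.2 hx'.2))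
    (fun v _ w _ h => (h trivial).elim)
  refine ⟨G, g1, g2, fun x hx => ?_⟩
  have hc : typeCount (Finset.univ.filter fun v => T.vertex t v = V) DiscType.tri = T.linkCount V t := by
    funext σ
    rw [typeCount, Finset.filter_filter]
    cases σ with
    | tri v =>
      simp only [linkCount, DiscType.tri.injEq]
      split_ifs with h
      · rw [Finset.card_eq_one]
        refine ⟨v, ?_⟩
        ext w
        simp only [Finset.mem_filter, Finset.mem_univ, true_and, Finset.mem_singleton]
        exact ⟨fun h => h.2, fun e => ⟨e ▸ h, e⟩⟩
      · rw [Finset.card_eq_zero, Finset.filter_eq_empty_iff]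
        rintro w - ⟨h', rfl⟩
        exact h h'
    | quad i => simp [linkCount]
    | oct i => simp [linkCount]
  rw [← hc, ← g3 x hx, show x ∈ part _ t ↔ _ from mem_part (⟨x, hx⟩ : Tetra),
    char_mem_linkAt (by linarith)]
  simp [hx]

theorem validCount_linkCount (V : T.Space) (t : Fin n) : ValidCount (T.linkCount V t) := by
  intro σ τ h1 _ h3 _
  cases σ with
  | tri v => exact (h1 v rfl).elim
  | quad i => exact (lt_irrefl 0 h3).elim
  | oct i => exact (lt_irrefl 0 h3).elim

theorem normalIsotopic_linkAt (V : T.Space) {r s : ℝ} (h0 : 1 / 2 < r) (h1 : r < 1)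
    (h2 : 1 / 2 < s) (h3 : s < 1) : T.NormalIsotopic (T.linkAt V r) (T.linkAt V s) :=
  normalIsotopic_of_hasCount (validCount_linkCount V) (hasCount_linkAt V h0 h1)
    (hasCount_linkAt V h2 h3)

theorem NormalIsotopic.exists_homeo {S S' : Set T.Space} (h : T.NormalIsotopic S S') :
    ∃ φ : T.Space ≃ₜ T.Space, T.PreservesSimplices φ ∧ φ '' S = S' := by
  obtain ⟨H, -, h1, -, h2⟩ := h
  exact ⟨H 1, h1 1, h2⟩

theorem NormalIsotopic.isPreconnected {S S' : Set T.Space} (h : T.NormalIsotopic S S')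
    (hS : IsPreconnected S') : IsPreconnected S := by
  obtain ⟨φ, -, rfl⟩ := h.exists_homeo
  have := hS.image φ.symm φ.symm.continuous.continuousOn
  rwa [image_image, funext fun x => φ.symm_apply_apply x, image_id'] at this

theorem IsCompactManifold.isPreconnected_link (hT : T.IsCompactManifold) (t : Fin n) (v : Fin 4) :
    IsPreconnected (T.link (T.vertex t v)) := by
  rw [isPreconnected_iff_preconnectedSpace]
  rcases hT.2 t v with ⟨⟨e⟩⟩ | ⟨⟨e⟩⟩
  · have : IsPreconnected (Metric.sphere (0 : EuclideanSpace ℝ (Fin 3)) 1) := by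
      refine isPreconnected_sphere ?_ _ _
      rw [← Module.finrank_eq_rank, finrank_euclideanSpace, Fintype.card_fin]
      norm_num
    have := Subtype.preconnectedSpace this
    exact e.symm.surjective.denseRange.preconnectedSpace e.symm.continuous
  · have : IsPreconnected (Metric.closedBall (0 : EuclideanSpace ℝ (Fin 2)) 1) :=
      (convex_closedBall _ _).isPreconnected
    have := Subtype.preconnectedSpace this
    exact e.symm.surjective.denseRange.preconnectedSpace e.symm.continuous

end Triangulation

open DiscType

namespace Triangulation

variable {n : ℕ} {T : Triangulation n}

namespace OctSurface

/-! ### Adding a vertex link -/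

theorem isClosed_piece (S : T.OctSurface) {t : Fin n} {D : Set Tetra}
    (hD : D ∈ T.pieces S.carrier t) : IsClosed D := by
  obtain ⟨τ, h⟩ := S.isDisc_of_mem_pieces t D hD
  exact h.isClosed

theorem preimage_eq_sUnion (S : T.OctSurface) (t : Fin n) :
    T.char t ⁻¹' S.carrier = ⋃₀ T.pieces S.carrier t := by
  ext x
  exact mem_pieces_cover

theorem isClosed_preimage (S : T.OctSurface) (t : Fin n) : IsClosed (T.char t ⁻¹' S.carrier) := by
  rw [S.preimage_eq_sUnion t, sUnion_eq_biUnion]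
  exact (S.finite_pieces t).isClosed_biUnion fun D hD => S.isClosed_piece hD

theorem isClosed_carrier (S : T.OctSurface) : IsClosed S.carrier :=
  isClosed_space_iff.2 S.isClosed_preimage

theorem vertex_not_mem (S : T.OctSurface) (t : Fin n) (v : Fin 4) : T.vertex t v ∉ S.carrier := by
  intro h
  obtain ⟨st, s1, s2, s3⟩ := S.hasCount t
  have h1 := (s3 (vert v) (vert_mem v)).1 ((mem_part (⟨vert v, vert_mem v⟩ : Tetra)).2 h)
  rw [s2.fix_vert s1.bij.mapsTo (vert_mem v)] at h1
  obtain ⟨τ, j, -, h2⟩ := h1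
  exact vert_not_mem_stdDisc τ j v h2

/-- The maximum of the coordinate on the compact preimage is attained; it could equal 1 only at the
vertex, which the surface misses. -/
theorem exists_height_bound (S : T.OctSurface) (t : Fin n) (v : Fin 4) :
    ∃ m < (1 : ℝ), ∀ x : Tetra, T.char t x ∈ S.carrier → x.1 v ≤ m := by
  have hc : Continuous fun x : Tetra => x.1 v := (continuous_apply v).comp continuous_subtype_val
  rcases (T.char t ⁻¹' S.carrier).eq_empty_or_nonempty with h | h
  · exact ⟨0, zero_lt_one, fun x hx => (notMem_empty x (h ▸ hx)).elim⟩
  · obtain ⟨y, hy, hmax⟩ := (S.isClosed_preimage t).isCompact.exists_isMaxOn h hc.continuousOn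
    refine ⟨y.1 v, ?_, fun x hx => hmax hx⟩
    have hle : y.1 v ≤ 1 := by
      have := Finset.single_le_sum (fun i _ => y.2.1 i) (Finset.mem_univ v)
      rwa [y.2.2] at this
    refine hle.lt_of_ne fun e => S.vertex_not_mem t v ?_
    have hyv : y.1 = vert v := by
      refine eq_vert_of_supp y.2 (supp_subset.2 fun i hi => ?_)
      rw [Finset.mem_singleton] at hi
      have : y.1 v + y.1 i ≤ 1 := by
        rw [← y.2.2, ← Finset.sum_pair (Ne.symm hi)]
        exact Finset.sum_le_sum_of_subset_of_nonneg (Finset.subset_univ _) fun i _ _ => y.2.1 i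
      exact le_antisymm (by linarith) (y.2.1 i)
    have : y = ⟨Pi.single v 1, single_mem_stdSimplex ℝ v⟩ := Subtype.ext hyv
    rw [vertex, ← this]
    exact hy

theorem exists_free_height (S : T.OctSurface) : ∃ r : ℝ, 3 / 4 < r ∧ r < 1 ∧
    ∀ (t : Fin n) (v : Fin 4) (x : Tetra), T.char t x ∈ S.carrier → x.1 v < r := by
  choose m hm1 hm2 using S.exists_height_bound
  have h1 : ∀ᶠ r in 𝓝[<] (1 : ℝ), r ∈ Ioo (3 / 4 : ℝ) 1 := Ioo_mem_nhdsLT (by norm_num)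
  have h2 : ∀ᶠ r in 𝓝[<] (1 : ℝ), ∀ t v, m t v < r := by
    rw [eventually_all]
    intro t
    rw [eventually_all]
    intro v
    filter_upwards [Ioo_mem_nhdsLT (hm1 t v)] with r hr using hr.1
  obtain ⟨r, hr1, hr2⟩ := (h1.and h2).exists
  exact ⟨r, hr1.1, hr1.2, fun t v x hx => (hm2 t v x hx).trans_lt (hr2 t v)⟩

open Classical in
/-- A vertex link can be added to a surface. -/
theorem exists_add_link (hT : T.IsCompactManifold) (S : T.OctSurface) (t₀ : Fin n) (v₀ : Fin 4) :
    ∃ S₁ : T.OctSurface, S₁.RemovesLink S ∧ ∀ t,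
      (∀ τ, (∀ v, τ ≠ .tri v) → S₁.count t τ = S.count t τ) ∧
      ∀ v, S₁.count t (.tri v) =
        S.count t (.tri v) + if T.vertex t v = T.vertex t₀ v₀ then 1 else 0 := by
  -- The copy of the link is placed between the vertices and the whole of `S`.
  obtain ⟨r, hr0, hr1, hfree⟩ := S.exists_free_height
  set V := T.vertex t₀ v₀ with hV
  have hr : 0 < r := by linarith
  let L : Fin n → Set (Set Tetra) := fun t => (fun v => {x : Tetra | x.1 v = r}) '' {v | T.vertex t v = V}
  have hLfin : ∀ t, (L t).Finite := fun t => (Set.toFinite _).image _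
  have hcov : ∀ t, T.char t ⁻¹' (S.carrier ∪ T.linkAt V r) = ⋃₀ (T.pieces S.carrier t ∪ L t) := by
    intro t
    rw [preimage_union, sUnion_union, S.preimage_eq_sUnion t]
    congr 1
    ext x
    rw [mem_preimage, char_mem_linkAt hr]
    simp [L]
  have hSL : ∀ t, ∀ D ∈ T.pieces S.carrier t, ∀ D' ∈ L t, Disjoint D D' := by
    rintro t D hD _ ⟨v, -, rfl⟩
    rw [disjoint_left]
    intro x hx hxv
    have := hfree t v x (mem_pieces_cover.2 ⟨D, hD, hx⟩)
    have hxv : x.1 v = r := hxv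
    linarith
  have hpieces : ∀ t, T.pieces (S.carrier ∪ T.linkAt V r) t = T.pieces S.carrier t ∪ L t := by
    intro t
    refine components_eq_of_cover (hcov t) ((S.finite_pieces t).union (hLfin t)) ?_ ?_ ?_ ?_
    · rintro D (hD | ⟨v, -, rfl⟩)
      exacts [S.isClosed_piece hD, isClosed_level v r]
    · rintro D (hD | ⟨v, -, rfl⟩)
      exacts [pieces_preconnected hD, isPreconnected_level v r]
    · rintro D (⟨x, hx, rfl⟩ | ⟨v, -, rfl⟩)
      exacts [⟨x, mem_connectedComponentIn hx⟩, level_nonempty v ⟨hr.le, hr1.le⟩]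
    · rintro D (hD | hD) D' (hD' | hD') hne
      · exact pieces_disjoint hD hD' hne
      · exact hSL t D hD D' hD'
      · exact (hSL t D' hD' D hD).symm
      · obtain ⟨v, -, rfl⟩ := hD
        obtain ⟨w, -, rfl⟩ := hD'
        rw [disjoint_left]
        intro x hx hx'
        exact hne (by rw [eq_of_levels x.2 (by linarith) hx hx'])
  have hLdisc : ∀ t, ∀ D ∈ L t, ∃ v, T.vertex t v = V ∧ IsDisc (.tri v) D ∧ D = {x : Tetra | x.1 v = r} := by
    rintro t _ ⟨v, hv, rfl⟩
    exact ⟨v, hv, isDisc_level v hr hr1, rfl⟩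
  let S₁ : T.OctSurface :=
    { carrier := S.carrier ∪ T.linkAt V r
      finite_pieces := fun t => by
        rw [hpieces]; exact (S.finite_pieces t).union (hLfin t)
      isDisc_of_mem_pieces := fun t D hD => by
        rw [hpieces] at hD
        rcases hD with hD | hD
        · exact S.isDisc_of_mem_pieces t D hD
        · obtain ⟨v, -, h, -⟩ := hLdisc t D hD
          exact ⟨_, h⟩
      existsUnique_octagon := by
        obtain ⟨P, ⟨h1, i, h2⟩, h3⟩ := S.existsUnique_octagon
        refine ⟨P, ⟨by rw [hpieces]; exact Or.inl h1, i, h2⟩, ?_⟩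
        rintro P' ⟨h4, k, h5⟩
        rw [hpieces] at h4
        rcases h4 with h4 | h4
        · exact h3 P' ⟨h4, k, h5⟩
        · obtain ⟨v, -, h6, -⟩ := hLdisc _ _ h4
          exact absurd (h5.type_unique h6) (by simp) }
  have hdis : Disjoint S.carrier (T.linkAt V r) := by
    rw [disjoint_left]
    rintro _ hP ⟨t, v, x, -, hx, rfl⟩
    have := hfree t v x hP
    have hx : x.1 v = r := hx
    linarith
  have hclosed : IsClosed (T.linkAt V r) := isClosed_space_iff.2 fun t => by
    have : T.char t ⁻¹' T.linkAt V r = ⋃₀ L t := by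
      ext x
      rw [mem_preimage, char_mem_linkAt hr]
      simp [L]
    rw [this, sUnion_eq_biUnion]
    refine (hLfin t).isClosed_biUnion ?_
    rintro _ ⟨v, -, rfl⟩
    exact isClosed_level v r
  have hiso : T.NormalIsotopic (T.linkAt V r) (T.link V) := by
    rw [← linkAt_three_quarters]
    exact normalIsotopic_linkAt V (by linarith) hr1 (by norm_num) (by norm_num)
  -- Connectedness of the sphere or disc makes the copy a single component.
  have hpre : IsPreconnected (T.linkAt V r) := hiso.isPreconnected (hT.isPreconnected_link t₀ v₀)
  refine ⟨S₁, ⟨T.linkAt V r, ⟨?_, t₀, v₀, hiso⟩, ?_⟩, fun t => ?_⟩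
  · obtain ⟨x, hx⟩ := level_nonempty v₀ (r := r) ⟨hr.le, hr1.le⟩
    have hxL : T.char t₀ x ∈ T.linkAt V r := (char_mem_linkAt hr).2 ⟨v₀, rfl, hx⟩
    refine ⟨T.char t₀ x, Or.inr hxL, Subset.antisymm
      (hpre.subset_connectedComponentIn hxL subset_union_right) ?_⟩
    rcases isPreconnected_iff_subset_of_disjoint_closed.1 (isPreconnected_connectedComponentIn
      (x := T.char t₀ x) (F := S₁.carrier)) S.carrier (T.linkAt V r) S.isClosed_carrier hclosed
      (connectedComponentIn_subset _ _) (by rw [hdis.inter_eq, inter_empty]) with h | h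
    · exact (disjoint_left.1 hdis (h (mem_connectedComponentIn (Or.inr hxL))) hxL).elim
    · exact h
  · change S.carrier = (S.carrier ∪ T.linkAt V r) \ T.linkAt V r
    rw [union_sdiff_right, hdis.sdiff_eq_left]
  · have hset : ∀ τ, {D | D ∈ T.pieces S₁.carrier t ∧ IsDisc τ D} =
        {D | D ∈ T.pieces S.carrier t ∧ IsDisc τ D} ∪ {D | D ∈ L t ∧ IsDisc τ D} := by
      intro τ
      change {D | D ∈ T.pieces (S.carrier ∪ T.linkAt V r) t ∧ IsDisc τ D} = _
      rw [hpieces]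
      ext D
      simp only [mem_ofPred_eq, mem_union, or_and_right]
    have hempty : ∀ τ, (∀ v, T.vertex t v = V → τ ≠ .tri v) → {D | D ∈ L t ∧ IsDisc τ D} = ∅ := by
      intro τ hτ
      rw [eq_empty_iff_forall_notMem]
      rintro D ⟨hD, h⟩
      obtain ⟨v, hv, h2, -⟩ := hLdisc t D hD
      exact hτ v hv (h.type_unique h2)
    refine ⟨fun τ hτ => ?_, fun v => ?_⟩
    · rw [count, hset, hempty τ fun v _ => hτ v, union_empty, count]
    · rw [count, hset, count]
      split_ifs with h
      · have hone : {D | D ∈ L t ∧ IsDisc (.tri v) D} = {{x : Tetra | x.1 v = r}} := by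
          ext D
          constructor
          · rintro ⟨hD, h'⟩
            obtain ⟨w, -, h2, rfl⟩ := hLdisc t D hD
            have := h'.type_unique h2
            rw [DiscType.tri.injEq] at this
            rw [this]
            rfl
          · rintro rfl
            exact ⟨⟨v, h, rfl⟩, isDisc_level v hr hr1⟩
        rw [ncard_union_eq ?_ (S.finite_count t _) ((hLfin t).subset fun D hD => hD.1), hone,
          ncard_singleton]
        rw [disjoint_left]
        rintro D ⟨h1, h2⟩ ⟨h3, -⟩
        obtain ⟨x, hx⟩ : D.Nonempty := by
          obtain ⟨w, -, -, rfl⟩ := hLdisc t D h3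
          exact level_nonempty w ⟨hr.le, hr1.le⟩
        exact disjoint_left.1 (hSL t D h1 D h3) hx hx
      · rw [hempty, union_empty, add_zero]
        rintro w hw e
        rw [DiscType.tri.injEq] at e
        exact h (e ▸ hw)

/-! ### Invariance of the quadrilateral and octagon numbers -/

theorem preimage_image {φ : T.Space ≃ₜ T.Space} {t : Fin n} {h : Tetra ≃ₜ Tetra}
    (hφ : ∀ x, φ (T.char t x) = T.char t (h x)) (S : Set T.Space) :
    T.char t ⁻¹' (φ '' S) = h '' (T.char t ⁻¹' S) := by
  ext y
  obtain ⟨x, rfl⟩ := h.surjective y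
  rw [mem_preimage, ← hφ, φ.injective.mem_set_image, h.injective.mem_set_image, mem_preimage]

theorem isDisc_image_iff {h : Tetra ≃ₜ Tetra} (hh : FacePreserving h) {τ : DiscType} {D : Set Tetra} :
    IsDisc τ (h '' D) ↔ IsDisc τ D := by
  have key : ∀ (h : Tetra ≃ₜ Tetra) (D : Set Tetra), FacePreserving h → IsDisc τ D → IsDisc τ (h '' D) := by
    rintro h _ hh ⟨k, hk, rfl⟩
    exact ⟨k.trans h, hk.trans hh, by rw [image_image]; rfl⟩
  refine ⟨fun h' => ?_, key h D hh⟩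
  have := key h.symm _ hh.symm h'
  rwa [image_image, funext fun x => h.symm_apply_apply x, image_id'] at this

theorem count_eq_of_normalIsotopic (S S' : T.OctSurface)
    (h : T.NormalIsotopic S.carrier S'.carrier) (t : Fin n) (τ : DiscType) :
    S.count t τ = S'.count t τ := by
  obtain ⟨φ, hφ, e⟩ := h.exists_homeo
  obtain ⟨k, hk, hφk⟩ := hφ t
  have hpre := preimage_image hφk S.carrier
  rw [e] at hpre
  rw [count, count, ← (image_injective.2 k.injective).injOn.ncard_image]
  congr 1
  ext D
  constructor
  · rintro ⟨D, ⟨⟨x, hx, rfl⟩, h2⟩, rfl⟩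
    refine ⟨⟨k x, ?_, ?_⟩, (isDisc_image_iff hk).2 h2⟩
    · rw [hpre]; exact ⟨x, hx, rfl⟩
    · rw [hpre, k.image_connectedComponentIn hx]
  · rintro ⟨⟨y, hy, rfl⟩, h2⟩
    obtain ⟨x, rfl⟩ := k.surjective y
    rw [hpre] at hy h2 ⊢
    have hx : x ∈ T.char t ⁻¹' S.carrier := by
      obtain ⟨z, hz, ez⟩ := hy
      exact k.injective ez ▸ hz
    rw [← k.image_connectedComponentIn hx] at h2 ⊢
    exact ⟨_, ⟨⟨x, hx, rfl⟩, (isDisc_image_iff hk).1 h2⟩, rfl⟩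

/-- A quadrilateral or octagon does not lie in a vertex linking component. -/
theorem not_subset_link {C V : Set T.Space} {φ : T.Space ≃ₜ T.Space} (hφ : T.PreservesSimplices φ)
    {P : T.Space} (hV : V = T.link P) (e : φ '' C = V) {t : Fin n} {τ : DiscType}
    {D : Set Tetra} (hD : IsDisc τ D) (hpre : IsPreconnected D) (hτ : ∀ v, τ ≠ .tri v)
    (hsub : D ⊆ T.char t ⁻¹' C) : False := by
  obtain ⟨k, hk, hφk⟩ := hφ t
  have hD' : IsDisc τ (k '' D) := (isDisc_image_iff hk).2 hD
  have hpre' : IsPreconnected (k '' D) := hpre.image _ k.continuous.continuousOn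
  have hlev : ∀ x ∈ k '' D, ∃ v, x.1 v = 3 / 4 := by
    rintro _ ⟨x, hx, rfl⟩
    have : T.char t (k x) ∈ T.linkAt P (3 / 4) := by
      rw [linkAt_three_quarters, ← hV, ← e, ← hφk]
      exact ⟨_, hsub hx, rfl⟩
    obtain ⟨v, -, h⟩ := (char_mem_linkAt (by norm_num)).1 this
    exact ⟨v, h⟩
  obtain ⟨p, q, hm, -, -⟩ := exists_meets_tri τ 0 (hτ 0).symm
  obtain ⟨_, ⟨x, hx, rfl⟩, -⟩ := hD'.vec.exists_mem_edge hm.1 hm.2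
  obtain ⟨v, hv⟩ := hlev x hx
  -- The triangles of the link in one tetrahedron are disjoint and closed, so a connected set in
  -- their union lies in one of them.
  have hall : k '' D ⊆ {x : Tetra | x.1 v = 3 / 4} := by
    rcases isPreconnected_iff_subset_of_disjoint_closed.1 hpre' {x : Tetra | x.1 v = 3 / 4}
      (⋃ w ∈ {w | w ≠ v}, {x : Tetra | x.1 w = 3 / 4}) (isClosed_level v _)
      ((Set.toFinite _).isClosed_biUnion fun w _ => isClosed_level w _) (by
        intro y hy
        obtain ⟨w, hw⟩ := hlev y hy
        by_cases h : w = v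
        · exact Or.inl (h ▸ hw)
        · exact Or.inr (mem_biUnion h hw)) (by
        rw [eq_empty_iff_forall_notMem]
        rintro y ⟨-, h1, h2⟩
        obtain ⟨w, hw, h2⟩ := mem_iUnion₂.1 h2
        exact hw (eq_of_levels y.2 (by norm_num) h2 h1)) with h | h
    · exact h
    · obtain ⟨w, hw, h2⟩ := mem_iUnion₂.1 (h hx)
      exact (hw (eq_of_levels x.2 (by norm_num) h2 hv)).elim
  -- The disc also meets an edge of the face opposite `v`, where the coordinate at `v` is zero.
  obtain ⟨p, q, hm, hp, hq⟩ := exists_meets_tri τ v (hτ v).symm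
  obtain ⟨_, ⟨y, hy, rfl⟩, hye⟩ := hD'.vec.exists_mem_edge hm.1 hm.2
  have h1 : y.1 v = 3 / 4 := hall hy
  have h2 : y.1 v = 0 := supp_subset.1 hye.2 v (by simp [hp.symm, hq.symm])
  rw [h2] at h1
  norm_num at h1

/-- A connected piece that meets the component `C` lies in it. Removing `C` therefore removes whole
pieces, none of which is a quadrilateral or octagon. -/
theorem RemovesLink.count_eq {S S₁ : T.OctSurface} (h : S.RemovesLink S₁) (t : Fin n)
    {τ : DiscType} (hτ : ∀ v, τ ≠ .tri v) : S.count t τ = S₁.count t τ := by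
  obtain ⟨C, ⟨⟨P, hP, hC⟩, u, w, hiso⟩, hS₁⟩ := h
  obtain ⟨φ, hφ, e⟩ := hiso.exists_homeo
  have hcont : Continuous (T.char t) := continuous_quot_mk.comp (Continuous.prodMk_right t)
  have hdich : ∀ D ∈ T.pieces S.carrier t, ∀ x ∈ D, T.char t x ∈ C → D ⊆ T.char t ⁻¹' C := by
    intro D hD x hx hxC y hy
    rw [hC] at hxC
    have h1 : T.char t '' D ⊆ connectedComponentIn S.carrier (T.char t x) :=
      ((pieces_preconnected hD).image _ hcont.continuousOn).subset_connectedComponentIn ⟨x, hx, rfl⟩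
        (by rintro _ ⟨z, hz, rfl⟩; exact mem_pieces_cover.2 ⟨D, hD, hz⟩)
    rw [← connectedComponentIn_eq hxC, ← hC] at h1
    exact h1 ⟨y, hy, rfl⟩
  have hpieces : T.pieces S₁.carrier t =
      {D | D ∈ T.pieces S.carrier t ∧ ∀ x ∈ D, T.char t x ∉ C} := by
    refine components_eq_of_cover ?_ ((S.finite_pieces t).subset fun D hD => hD.1)
      (fun D hD => S.isClosed_piece hD.1) (fun D hD => pieces_preconnected hD.1) ?_
      (fun D hD D' hD' hne => pieces_disjoint hD.1 hD'.1 hne)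
    · rw [hS₁]
      ext x
      constructor
      · rintro ⟨h1, h2⟩
        obtain ⟨D, hD, hx⟩ := mem_pieces_cover.1 h1
        exact ⟨D, ⟨hD, fun y hy hyC => h2 (hdich D hD y hy hyC hx)⟩, hx⟩
      · rintro ⟨D, ⟨hD, h⟩, hx⟩
        exact ⟨mem_pieces_cover.2 ⟨D, hD, hx⟩, h x hx⟩
    · rintro D ⟨⟨x, hx, rfl⟩, -⟩
      exact ⟨x, mem_connectedComponentIn hx⟩
  rw [count, count]
  congr 1
  ext D
  rw [hpieces]
  constructor
  · rintro ⟨h1, h2⟩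
    refine ⟨⟨h1, fun x hx hxC => ?_⟩, h2⟩
    exact not_subset_link hφ rfl e h2 (pieces_preconnected h1) hτ (hdich D h1 x hx hxC)
  · rintro ⟨⟨h1, -⟩, h2⟩
    exact ⟨h1, h2⟩

theorem AddRemoveLinks.count_eq {S S₁ : T.OctSurface} (h : S.AddRemoveLinks S₁) (t : Fin n)
    {τ : DiscType} (hτ : ∀ v, τ ≠ .tri v) : S.count t τ = S₁.count t τ := by
  induction h with
  | refl => rfl
  | tail _ h ih =>
    rcases h with h | h
    · exact ih.trans (h.count_eq t hτ)
    · exact ih.trans (h.count_eq t hτ).symm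

theorem quadOctVector_eq_iff {S S' : T.OctSurface} : S.quadOctVector = S'.quadOctVector ↔
    ∀ t τ, (∀ v, τ ≠ .tri v) → S.count t τ = S'.count t τ := by
  constructor
  · intro h t τ hτ
    cases τ with
    | tri v => exact (hτ v rfl).elim
    | quad i => exact Nat.cast_injective (R := ℝ) (congrFun h (t, .inl i))
    | oct i => exact Nat.cast_injective (R := ℝ) (congrFun h (t, .inr i))
  · intro h
    funext ⟨t, k⟩
    cases k with
    | inl i => simp only [quadOctVector, h t (.quad i) (by simp)]
    | inr i => simp only [quadOctVector, h t (.oct i) (by simp)]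

end OctSurface

end Triangulation

open DiscType

/-! ### Edge weights -/

/-- Forget the triangles. -/
def forgetTri (c : DiscType → ℕ) : DiscType → ℕ
  | .tri _ => 0
  | τ => c τ

theorem forgetTri_of_ne {c : DiscType → ℕ} {τ : DiscType} (h : ∀ v, τ ≠ .tri v) :
    forgetTri c τ = c τ := by
  cases τ with
  | tri v => exact (h v rfl).elim
  | quad i => rfl
  | oct i => rfl

theorem edgePts_std (c : DiscType → ℕ) {p q : Fin 4} (hpq : p ≠ q) :
    edgePts (stdUnion c) p q = ((DiscType.tri p).level '' Iio (c (.tri p)) ∪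
      (fun j => 1 - (DiscType.tri q).level j) '' Iio (c (.tri q))) ∪
        edgePts (stdUnion (forgetTri c)) p q := by
  have hq : ∀ r, edgePt p q r q = 1 - r := fun r => by
    rw [← sub_sub_cancel 1 r, edgePt_swap, edgePt_apply hpq.symm, sub_sub_cancel]
  ext r
  constructor
  · rintro ⟨hr, τ, j, hj, hx⟩
    by_cases h : ∃ v, τ = .tri v
    · obtain ⟨v, rfl⟩ := h
      rw [mem_stdDisc_tri] at hx
      left
      by_cases hvp : v = p
      · subst hvp
        rw [edgePt_apply hpq] at hx
        exact Or.inl ⟨j, hj, hx.2.symm⟩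
      · by_cases hvq : v = q
        · subst hvq
          rw [hq] at hx
          exact Or.inr ⟨j, hj, by simp only [← hx.2]; ring⟩
        · have h0 : edgePt p q r v = 0 := by simp [edgePt, vert, hvp, hvq]
          have := level_tri v j
          linarith [hx.2]
    · push Not at h
      exact Or.inr ⟨hr, τ, j, by rwa [forgetTri_of_ne h], hx⟩
  · rintro ((⟨j, hj, rfl⟩ | ⟨j, hj, rfl⟩) | ⟨hr, τ, j, hj, hx⟩)
    · have hl := level_tri p j
      have hr : (DiscType.tri p).level j ∈ Icc (0 : ℝ) 1 := ⟨by linarith, hl.2.le⟩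
      exact ⟨hr, .tri p, j, hj, mem_stdDisc_tri.2 ⟨(edgePt_mem hr).1, edgePt_apply hpq _⟩⟩
    · have hl := level_tri q j
      have hr : 1 - (DiscType.tri q).level j ∈ Icc (0 : ℝ) 1 := ⟨by linarith, by linarith⟩
      exact ⟨hr, .tri q, j, hj, mem_stdDisc_tri.2 ⟨(edgePt_mem hr).1, by rw [hq, sub_sub_cancel]⟩⟩
    · refine ⟨hr, τ, j, ?_, hx⟩
      cases τ with
      | tri v => exact (Nat.not_lt_zero _ hj).elim
      | quad i => exact hj
      | oct i => exact hj

/-- Triangles at `p` cut the edge at coordinates of at least 4/5, triangles at `q` at coordinates of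
at most 1/5, and all other discs strictly between; so the three contributions are disjoint. -/
theorem ncard_edgePts_std (c : DiscType → ℕ) {p q : Fin 4} (hpq : p ≠ q) :
    (edgePts (stdUnion c) p q).ncard =
      c (.tri p) + c (.tri q) + (edgePts (stdUnion (forgetTri c)) p q).ncard := by
  have h1 : ((DiscType.tri p).level '' Iio (c (.tri p))).Finite := (Set.finite_Iio _).image _
  have h2 : ((fun j => 1 - (DiscType.tri q).level j) '' Iio (c (.tri q))).Finite :=
    (Set.finite_Iio _).image _
  have hq : ∀ r, edgePt p q r q = 1 - r := fun r => by
    rw [← sub_sub_cancel 1 r, edgePt_swap, edgePt_apply hpq.symm, sub_sub_cancel]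
  rw [edgePts_std c hpq, ncard_union_eq ?_ (h1.union h2) (finite_edgePts_std _ hpq),
    ncard_union_eq ?_ h1 h2, ((level_strictMono _).injective.injOn).ncard_image,
    InjOn.ncard_image ?_]
  · simp [Set.ncard_eq_toFinset_card']
  · intro i _ j _ e
    exact (level_strictMono _).injective (by simpa using e)
  · rw [disjoint_left]
    rintro _ ⟨i, -, rfl⟩ ⟨j, -, e⟩
    have := level_tri p i
    have := level_tri q j
    simp only at e
    linarith
  · rw [disjoint_left]
    rintro r h ⟨hr, τ, j, hj, hx⟩
    have hτ : ∀ v, DiscType.tri v ≠ τ := by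
      rintro v rfl
      exact Nat.not_lt_zero _ hj
    have hp' := lt_of_mem_stdDisc (hτ p) hx
    have hq' := lt_of_mem_stdDisc (hτ q) hx
    rw [edgePt_apply hpq] at hp'
    rw [hq] at hq'
    rcases h with ⟨i, -, rfl⟩ | ⟨i, -, rfl⟩
    · linarith [level_tri p i]
    · linarith [level_tri q i]

theorem sum_natAbs_lt {ι : Type} [Fintype ι] {f g : ι → ℤ} (h : ∀ i, g i = f i ∨ (g i).natAbs < (f i).natAbs)
    {i₀ : ι} (h₀ : (g i₀).natAbs < (f i₀).natAbs) : ∑ i, (g i).natAbs < ∑ i, (f i).natAbs :=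
  Finset.sum_lt_sum (fun i _ => (h i).elim (fun e => by rw [e]) le_of_lt) ⟨i₀, Finset.mem_univ _, h₀⟩

/-! ### The discrepancy in triangle numbers and its elimination. -/

namespace Triangulation

variable {n : ℕ} {T : Triangulation n}

namespace OctSurface

/-- The difference between the numbers of triangles of two surfaces. -/
noncomputable def triDiff (S S' : T.OctSurface) (t : Fin n) (v : Fin 4) : ℤ :=
  S.count t (.tri v) - S'.count t (.tri v)

variable {S S' : T.OctSurface}

theorem weight_diff (h : ∀ t τ, (∀ v, τ ≠ .tri v) → S.count t τ = S'.count t τ) (t : Fin n)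
    {p q : Fin 4} (hpq : p ≠ q) :
    ((edgePts (part S.carrier t) p q).ncard : ℤ) - (edgePts (part S'.carrier t) p q).ncard =
      triDiff S S' t p + triDiff S S' t q := by
  rw [(S.hasCount t).ncard_edgePts (hasCount_std _) hpq,
    (S'.hasCount t).ncard_edgePts (hasCount_std _) hpq, ncard_edgePts_std (S.count t) hpq,
    ncard_edgePts_std (S'.count t) hpq]
  have : forgetTri (S.count t) = forgetTri (S'.count t) := by
    funext τ
    cases τ with
    | tri v => rfl
    | quad i => exact h t _ (by simp)
    | oct i => exact h t _ (by simp)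
  rw [this, triDiff, triDiff]
  push_cast
  ring

/-- The sums over pairs of vertices of the face agree on both sides, because they are differences of
edge weights; three pairwise sums determine their three terms. -/
theorem triDiff_glue (h : ∀ t τ, (∀ v, τ ≠ .tri v) → S.count t τ = S'.count t τ) {t u : Fin n}
    {f : Fin 4} {π : Equiv.Perm (Fin 4)} (hg : T.glue t f = some (u, π)) {v : Fin 4} (hv : v ≠ f) :
    triDiff S S' t v = triDiff S S' u (π v) := by
  have key : ∀ p q, p ≠ q → p ≠ f → q ≠ f → triDiff S S' t p + triDiff S S' t q =
      triDiff S S' u (π p) + triDiff S S' u (π q) := by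
    intro p q hpq hp hq
    rw [← weight_diff h t hpq, ← weight_diff h u (π.injective.ne hpq),
      (matches_part S.carrier).edgePts hg hp hq, (matches_part S'.carrier).edgePts hg hp hq]
  obtain ⟨p, q, h1, h2, h3, h4, h5⟩ : ∃ p q : Fin 4, p ≠ v ∧ q ≠ v ∧ p ≠ q ∧ p ≠ f ∧ q ≠ f := by
    have : ∀ v f : Fin 4, v ≠ f → ∃ p q : Fin 4, p ≠ v ∧ q ≠ v ∧ p ≠ q ∧ p ≠ f ∧ q ≠ f := by decide
    exact this v f hv
  have e1 := key v p h1.symm hv h4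
  have e2 := key v q h2.symm hv h5
  have e3 := key p q h3 h4 h5
  linarith

theorem triDiff_vertex (h : ∀ t τ, (∀ v, τ ≠ .tri v) → S.count t τ = S'.count t τ) {t u : Fin n}
    {v w : Fin 4} (hvw : T.vertex t v = T.vertex u w) : triDiff S S' t v = triDiff S S' u w := by
  -- The discrepancies at the corners where a point has coordinate 1 form a set that is invariant
  -- under gluing, hence a function on `|T|`. At a vertex it has a single element.
  let Q : Fin n × Tetra → Set ℤ := fun P => {z | ∃ v, P.2.1 v = 1 ∧ z = triDiff S S' P.1 v}
  have h1 : ∀ P P', T.GlueRel P P' → Q P ⊆ Q P' := by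
    rintro ⟨t, x⟩ ⟨u, y⟩ ⟨f, π, hg, hf, hp⟩ _ ⟨v, hxv, rfl⟩
    have hvf : v ≠ f := by
      rintro rfl
      have : x.1 v = 0 := hf
      simp only at hxv
      linarith
    exact ⟨π v, (hp v).trans hxv, triDiff_glue h hg hvf⟩
  have h2 : ∀ P P', T.GlueRel P P' → Q P = Q P' := fun P P' hP =>
    (h1 P P' hP).antisymm (h1 P' P (glueRel_symm hP))
  have e : Quot.lift Q h2 (T.vertex t v) = Quot.lift Q h2 (T.vertex u w) := by rw [hvw]
  have hm : triDiff S S' t v ∈ Q (u, ⟨Pi.single w 1, single_mem_stdSimplex ℝ w⟩) :=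
    (show Q (t, ⟨Pi.single v 1, single_mem_stdSimplex ℝ v⟩) =
      Q (u, ⟨Pi.single w 1, single_mem_stdSimplex ℝ w⟩) from e).subset ⟨v, vert_self v, rfl⟩
  obtain ⟨w', h3, h4⟩ := hm
  have : w' = w := by
    by_contra hne
    have h5 : (1 : ℝ) = 0 := h3.symm.trans (vert_ne hne)
    norm_num at h5
  rw [h4, this]

/-- While some discrepancy is non-zero, a link is added at that vertex to the surface with fewer
triangles there. The discrepancy is the same at all corners of the vertex, so every one of them
moves toward zero and the total absolute value drops. -/
theorem exists_common (hT : T.IsCompactManifold) (N : ℕ) : ∀ S S' : T.OctSurface,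
    ∑ P : Fin n × Fin 4, (triDiff S S' P.1 P.2).natAbs = N →
    (∀ t τ, (∀ v, τ ≠ .tri v) → S.count t τ = S'.count t τ) →
    ∃ S₁ S₁' : T.OctSurface, S.AddRemoveLinks S₁ ∧ S'.AddRemoveLinks S₁' ∧
      T.NormalIsotopic S₁.carrier S₁'.carrier := by
  induction N using Nat.strong_induction_on with
  | _ N ih =>
    intro S S' hN h
    by_cases h0 : ∀ t v, triDiff S S' t v = 0
    · refine ⟨S, S', .refl, .refl, normalIsotopic_of_count_eq S S' fun t τ => ?_⟩
      by_cases hτ : ∃ v, τ = .tri v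
      · obtain ⟨v, rfl⟩ := hτ
        have := h0 t v
        rw [triDiff] at this
        omega
      · push Not at hτ
        exact h t τ hτ
    · push Not at h0
      obtain ⟨t₀, v₀, hd⟩ := h0
      rcases lt_or_gt_of_ne hd with hneg | hpos
      · obtain ⟨S₁, hr, hc⟩ := S.exists_add_link hT t₀ v₀
        have hstep : ∀ t v, triDiff S₁ S' t v = triDiff S S' t v ∧ T.vertex t v ≠ T.vertex t₀ v₀ ∨
            triDiff S₁ S' t v = triDiff S S' t v + 1 ∧ triDiff S S' t v < 0 := by
          intro t v
          by_cases hv : T.vertex t v = T.vertex t₀ v₀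
          · right
            rw [triDiff_vertex h hv]
            refine ⟨?_, hneg⟩
            rw [← triDiff_vertex h hv, triDiff, (hc t).2 v, if_pos hv, triDiff]
            push_cast; ring
          · left
            exact ⟨by rw [triDiff, (hc t).2 v, if_neg hv, triDiff]; simp, hv⟩
        obtain ⟨S₂, S₂', h1, h2, h3⟩ := ih _ (hN ▸ sum_natAbs_lt
          (f := fun P : Fin n × Fin 4 => triDiff S S' P.1 P.2)
          (g := fun P => triDiff S₁ S' P.1 P.2) (fun P => by
            rcases hstep P.1 P.2 with ⟨e, -⟩ | ⟨e, hlt⟩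
            · exact Or.inl e
            · right; rw [e]; omega) (i₀ := (t₀, v₀)) (by
            rcases hstep t₀ v₀ with ⟨-, hne⟩ | ⟨e, hlt⟩
            · exact (hne rfl).elim
            · simp only; rw [e]; omega)) S₁ S' rfl
          fun t τ hτ => ((hc t).1 τ hτ).trans (h t τ hτ)
        -- Adding a link is recorded as the reverse of removing it.
        exact ⟨S₂, S₂', .head (Or.inr hr) h1, h2, h3⟩
      · obtain ⟨S₁', hr, hc⟩ := S'.exists_add_link hT t₀ v₀
        have hstep : ∀ t v, triDiff S S₁' t v = triDiff S S' t v ∧ T.vertex t v ≠ T.vertex t₀ v₀ ∨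
            triDiff S S₁' t v = triDiff S S' t v - 1 ∧ 0 < triDiff S S' t v := by
          intro t v
          by_cases hv : T.vertex t v = T.vertex t₀ v₀
          · right
            rw [triDiff_vertex h hv]
            refine ⟨?_, hpos⟩
            rw [← triDiff_vertex h hv, triDiff, (hc t).2 v, if_pos hv, triDiff]
            push_cast; ring
          · left
            exact ⟨by rw [triDiff, (hc t).2 v, if_neg hv, triDiff]; simp, hv⟩
        obtain ⟨S₂, S₂', h1, h2, h3⟩ := ih _ (hN ▸ sum_natAbs_lt
          (f := fun P : Fin n × Fin 4 => triDiff S S' P.1 P.2)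
          (g := fun P => triDiff S S₁' P.1 P.2) (fun P => by
            rcases hstep P.1 P.2 with ⟨e, -⟩ | ⟨e, hlt⟩
            · exact Or.inl e
            · right; rw [e]; omega) (i₀ := (t₀, v₀)) (by
            rcases hstep t₀ v₀ with ⟨-, hne⟩ | ⟨e, hlt⟩
            · exact (hne rfl).elim
            · simp only; rw [e]; omega)) S S₁' rfl
          fun t τ hτ => (h t τ hτ).trans ((hc t).1 τ hτ).symm
        exact ⟨S₂, S₂', h1, .head (Or.inr hr) h2, h3⟩

end OctSurface

end Triangulation

theorem mainTheorem3 {n : ℕ} (T : Triangulation n) (hT : T.IsCompactManifold)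
    (S S' : T.OctSurface) :
    S.quadOctVector = S'.quadOctVector ↔
      (T.NormalIsotopic S.carrier S'.carrier ∨
        ∃ S₁ S₁' : T.OctSurface, S.AddRemoveLinks S₁ ∧ S'.AddRemoveLinks S₁' ∧
          T.NormalIsotopic S₁.carrier S₁'.carrier) := by
  rw [Triangulation.OctSurface.quadOctVector_eq_iff]
  constructor
  -- The second alternative contains the first, as the case in which no link is added or removed.
  · exact fun h => Or.inr (Triangulation.OctSurface.exists_common hT _ S S' rfl h)
  · rintro (h | ⟨S₁, S₁', h1, h2, h3⟩) t τ hτ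
    · exact Triangulation.OctSurface.count_eq_of_normalIsotopic S S' h t τ
    · rw [h1.count_eq t hτ, h2.count_eq t hτ]
      exact Triangulation.OctSurface.count_eq_of_normalIsotopic S₁ S₁' h3 t τ
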